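/- **Setting.** Let $(\Omega,\mathcal F)$ be a measurable space, $\mathbb P$ a probability measure on it, and $\mathcal G\subseteq\mathcal F$ a sub-$\sigma$-algebra such that $\{\mathbb P(B):B\in\mathcal G,\ B\subseteq A\}=[0,\mathbb P(A)]$ for every $A\in\mathcal G$. An *act* is a bounded $\mathcal F$-measurable function $X:\Omega\to\mathbb R$; $\mathcal X$ is the set of acts, $\mathcal X(\mathcal G)$ the set of $\mathcal G$-measurable acts, and constants are identified with constant acts. For $A\in\mathcal F$ and $x,y\in\mathbb R$, $xAy$ is the act equal to $x$ on $A$ and to $y$ off $A$. Let $\succsim$ be a total preorder on $\mathcal X$, with symmetric part $\simeq$ and strict part $\succ$. Put $\mathcal G_{\mathrm{cf}}=\{R\in\mathcal G:\mathbb P(R)=1/2\}$. Acts $X,Y$ are *comonotonic* if $(X(\omega)-X(\tilde\omega))(Y(\omega)-Y(\tilde\omega))\ge 0$ for all $\omega,\tilde\omega\in\Omega$. Consider the following axioms. - (RC) If $X,Y\in\mathcal X(\mathcal G)$ and $\mathbb P(X>x)=\mathbb P(Y>x)$ for all $x\in\mathbb R$, then $X\simeq Y$. - (M) If $X,Y\in\mathcal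 X$ and $X(\omega)\ge Y(\omega)$ for all $\omega\in\Omega$, then $X\succsim Y$. - (SRM) If $X,Y\in\mathcal X(\mathcal G)$, $\mathbb P(X\ge Y)=1$ and $\mathbb P(Y\ge X)<1$, then $X\succ Y$. - (C) For every $X\in\mathcal X$, the sets $\{Y\in\mathcal X:X\succsim Y\}$ and $\{Y\in\mathcal X:Y\succsim X\}$ contain every act that is the pointwise limit of a uniformly bounded sequence of their elements. - (RS) For all $R\in\mathcal G_{\mathrm{cf}}$ and $x,y,z,z'\in\mathbb R$ with $x\ge y$ and $z,z'\in[y,x]$: $\;c_{xRz}\,R\,c_{z'Ry}\simeq c_{xRz'}\,R\,c_{zRy}$. - (SCI) For all pairwise comonotonic $X,Y,Z\in\mathcal X$: if $X\simeq Y$, then $\tfrac12X\oplus\tfrac12Z\simeq\tfrac12Y\oplus\tfrac12Z$. The last two axioms are stated for relations satisfying (RC), (M), (SRM), (C). For such relations, $c_X$ is the unique real number with $X\simeq c_X$. For $x\ge y$, $\tfrac12x\oplus\tfrac12y=\tfrac12y\oplus\tfrac12x$ is the unique $z\in[y,x]$ with $xRy\simeq c_{xRz}\,R\,c_{zRy}$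 for $R\in\mathcal G_{\mathrm{cf}}$ (it does not depend on $R$). The mixture of acts $\tfrac12X\oplus\tfrac12Y\in\mathcal X$ is defined statewise. A *capacity* is a function $\nu:\mathcal F\to\mathbb R$ with $\nu(\varnothing)=0$, $\nu(\Omega)=1$ and $\nu(A)\le\nu(B)$ whenever $A\subseteq B$. It is *continuous* if $\nu(A_n)\to\nu(\bigcup_nA_n)$ for every increasing sequence and $\nu(A_n)\to\nu(\bigcap_nA_n)$ for every decreasing sequence $(A_n)$ in $\mathcal F$. It is *risk conforming* if $\nu(A)=\mathbb P(A)$ for all $A\in\mathcal G$. A *distortion function* is an increasing $g:[0,1]\to[0,1]$ with $g(0)=0$ and $g(1)=1$. For a capacity $\tau$ and a bounded measurable $f$, $$\int_\Omega f\,\mathrm d\tau=\int_0^\infty\tau(f>x)\,\mathrm dx+\int_{-\infty}^0(\tau(f>x)-1)\,\mathrm dx .$$ A *$\succsim$-matching probability* is a function $m:\mathcal F\to[0,1]$ such that for every $A\in\mathcal F$ there is $R_A\in\mathcal G$ with $m(A)=\mathbb P(R_A)$ and $\mathbf 1_A\simeq\mathbf 1_{R_A}$. **Theorem.** The relation $\succsim$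 satisfies (RC), (M), (SRM), (C), (RS) and (SCI) if and only if there exist a strictly increasing continuous $u:\mathbb R\to\mathbb R$, a strictly increasing continuous distortion function $g$, and a continuous risk-conforming capacity $\nu$ such that $$X\succsim Y\iff\int_\Omega u(X)\,\mathrm d(g\circ\nu)\ge\int_\Omega u(Y)\,\mathrm d(g\circ\nu),\qquad X,Y\in\mathcal X.\tag{$*$}$$ Moreover, in the representation $(*)$, $u$ is unique up to positive affine transformations (any other such representation has utility $au+b$ with $a>0$, $b\in\mathbb R$, and every such $au+b$ represents $\succsim$ with the same $g$ and $\nu$); $g$ is unique; and $\nu$ is unique and is the unique $\succsim$-matching probability. -/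

import Mathlib

open MeasureTheory Filter Topology

namespace CRDU

/-! ### Capacities, distortions, utilities, the Choquet integral

Set functions on the σ-algebra `F` are represented by functions `Set Ω → ℝ` of which only the values
on `F`-measurable sets matter; distortion functions on `[0,1]` by functions `ℝ → ℝ` of which only
the values on `[0,1]` matter. -/

/-- `ν` is a (normalized) capacity on the measurable space `Ω`. -/
structure IsCapacity {Ω : Type*} [MeasurableSpace Ω] (ν : Set Ω → ℝ) : Prop where
  empty : ν ∅ = 0
  univ : ν Set.univ = 1
  mono : ∀ A B : Set Ω, MeasurableSet A → MeasurableSet B → A ⊆ B → ν A ≤ ν B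

/-- Upward and downward continuity of a set function along sequences of measurable sets. -/
structure IsContinuousSetFun {Ω : Type*} [MeasurableSpace Ω] (ν : Set Ω → ℝ) : Prop where
  upward : ∀ A : ℕ → Set Ω, (∀ n, MeasurableSet (A n)) → (∀ n, A n ⊆ A (n + 1)) →
    Tendsto (fun n => ν (A n)) atTop (𝓝 (ν (⋃ n, A n)))
  downward : ∀ A : ℕ → Set Ω, (∀ n, MeasurableSet (A n)) → (∀ n, A (n + 1) ⊆ A n) →
    Tendsto (fun n => ν (A n)) atTop (𝓝 (ν (⋂ n, A n)))

/-- `ν` agrees with the reference probability `P` on the sub-σ-algebra `G`. -/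
def IsRiskConforming {Ω : Type*} (G : MeasurableSpace Ω) [MeasurableSpace Ω] (P : Measure Ω)
    (ν : Set Ω → ℝ) : Prop :=
  ∀ A : Set Ω, MeasurableSet[G] A → ν A = P.real A

/-- A distortion function: an increasing map `[0,1] → [0,1]` fixing `0` and `1`. -/
structure IsDistortion (g : ℝ → ℝ) : Prop where
  mapsTo : Set.MapsTo g (Set.Icc 0 1) (Set.Icc 0 1)
  mono : MonotoneOn g (Set.Icc 0 1)
  zero : g 0 = 0
  one : g 1 = 1

/-- A von Neumann–Morgenstern utility function: non-constant, increasing and continuous. -/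
structure IsVNMUtility (u : ℝ → ℝ) : Prop where
  mono : Monotone u
  continuous : Continuous u
  nonconstant : ∃ x y : ℝ, u x ≠ u y

/-- The Choquet integral
`∫ f dν = ∫_0^∞ ν(f > x) dx + ∫_{-∞}^0 (ν(f > x) - 1) dx`. -/
noncomputable def choquet {Ω : Type*} (ν : Set Ω → ℝ) (f : Ω → ℝ) : ℝ :=
  (∫ x in Set.Ioi (0 : ℝ), ν {ω | x < f ω}) + ∫ x in Set.Iio (0 : ℝ), (ν {ω | x < f ω} - 1)

/-! ### Acts -/

/-- An act: a bounded measurable real-valued function. -/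
def IsAct {Ω : Type*} [MeasurableSpace Ω] (f : Ω → ℝ) : Prop :=
  Measurable f ∧ ∃ M : ℝ, ∀ ω, |f ω| ≤ M

/-- The space of acts. -/
def Act (Ω : Type*) [MeasurableSpace Ω] : Type _ := {f : Ω → ℝ // IsAct f}

instance {Ω : Type*} [MeasurableSpace Ω] : CoeFun (Act Ω) (fun _ => Ω → ℝ) := ⟨Subtype.val⟩

/-- The constant act `c`. -/
def constAct (Ω : Type*) [MeasurableSpace Ω] (c : ℝ) : Act Ω :=
  ⟨fun _ => c, measurable_const, |c|, fun _ => le_rfl⟩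

open Classical in
/-- The binary act `xAy`, equal to `x` on `A` and to `y` off `A`. -/
noncomputable def binAct {Ω : Type*} [MeasurableSpace Ω] (x : ℝ) (A : Set Ω)
    (hA : MeasurableSet A) (y : ℝ) : Act Ω :=
  ⟨fun ω => if ω ∈ A then x else y, Measurable.ite hA measurable_const measurable_const,
    max |x| |y|, fun ω => by
      by_cases h : ω ∈ A
      · simp [h]
      · simp [h]⟩

/-- The bet `𝟙_A`, paying `1` on `A` and `0` otherwise. -/
noncomputable def betAct {Ω : Type*} [MeasurableSpace Ω] (A : Set Ω) (hA : MeasurableSet A) :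
    Act Ω :=
  binAct 1 A hA 0

/-- Comonotonicity of two acts. -/
def Comonotonic {Ω : Type*} [MeasurableSpace Ω] (X Y : Act Ω) : Prop :=
  ∀ ω ω' : Ω, 0 ≤ (X ω - X ω') * (Y ω - Y ω')

/-- `X ≥ Y` almost surely under `P`. -/
def GeAS {Ω : Type*} [MeasurableSpace Ω] (P : Measure Ω) (X Y : Act Ω) : Prop :=
  P {ω | Y ω ≤ X ω} = 1

/-- The strict part of `GeAS`. -/
def GtAS {Ω : Type*} [MeasurableSpace Ω] (P : Measure Ω) (X Y : Act Ω) : Prop :=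
  GeAS P X Y ∧ ¬ GeAS P Y X

/-- First-order stochastic dominance of `X` over `Y` under `P`. -/
def GeSD {Ω : Type*} [MeasurableSpace Ω] (P : Measure Ω) (X Y : Act Ω) : Prop :=
  ∀ x : ℝ, P {ω | x < Y ω} ≤ P {ω | x < X ω}

/-- Equality in distribution under `P`: the symmetric part of `GeSD`. -/
def EqSD {Ω : Type*} [MeasurableSpace Ω] (P : Measure Ω) (X Y : Act Ω) : Prop :=
  GeSD P X Y ∧ GeSD P Y X

/-- A set of acts is B-closed if it contains the pointwise limits (among acts) of its uniformly
bounded sequences. -/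
def BClosed {Ω : Type*} [MeasurableSpace Ω] (S : Set (Act Ω)) : Prop :=
  ∀ (X : ℕ → Act Ω) (Y : Act Ω), (∀ n, X n ∈ S) → (∃ M : ℝ, ∀ n ω, |X n ω| ≤ M) →
    (∀ ω, Tendsto (fun n => X n ω) atTop (𝓝 (Y ω))) → Y ∈ S

/-! ### The setting and preference relations -/

/-- The probability space `(Ω, G, P|_G)` is atomless: for every `A ∈ G` the values `P(B)` with
`B ∈ G`, `B ⊆ A` fill the whole interval `[0, P(A)]`. -/
def IsAtomlessOn {Ω : Type*} (G : MeasurableSpace Ω) [MeasurableSpace Ω] (P : Measure Ω) : Prop :=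
  ∀ A : Set Ω, MeasurableSet[G] A →
    {p : ℝ | ∃ B : Set Ω, MeasurableSet[G] B ∧ B ⊆ A ∧ P.real B = p} = Set.Icc 0 (P.real A)

/-- A preference relation (`pref X Y` reads "`X` is weakly preferred to `Y`"): a total preorder. -/
structure IsPreference {Ω : Type*} [MeasurableSpace Ω] (pref : Act Ω → Act Ω → Prop) : Prop where
  total : ∀ X Y, pref X Y ∨ pref Y X
  trans : ∀ X Y Z, pref X Y → pref Y Z → pref X Z

/-- Indifference. -/
def Indiff {Ω : Type*} [MeasurableSpace Ω] (pref : Act Ω → Act Ω → Prop) (X Y : Act Ω) : Prop :=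
  pref X Y ∧ pref Y X

/-- Strict preference. -/
def StrictPref {Ω : Type*} [MeasurableSpace Ω] (pref : Act Ω → Act Ω → Prop) (X Y : Act Ω) :
    Prop :=
  pref X Y ∧ ¬ pref Y X

/-- `m` is a matching probability of `pref`. That `m` has values in `[0,1]` is implied. -/
def IsMatchingProbability {Ω : Type*} (G : MeasurableSpace Ω) [F : MeasurableSpace Ω] (hG : G ≤ F)
    (P : Measure Ω) (pref : Act Ω → Act Ω → Prop) (m : Set Ω → ℝ) : Prop :=
  ∀ (A : Set Ω) (hA : MeasurableSet A), ∃ (R : Set Ω) (hR : MeasurableSet[G] R),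
    m A = P.real R ∧ Indiff pref (betAct A hA) (betAct R (hG R hR))

/-- The certainty equivalent `c_X`: the number `c` with `X ≃ c` (it exists and is unique under
(RC), (M), (SRM), (C)). -/
noncomputable def certEq {Ω : Type*} [MeasurableSpace Ω] (pref : Act Ω → Act Ω → Prop)
    (X : Act Ω) : ℝ :=
  Classical.epsilon fun c : ℝ => Indiff pref X (constAct Ω c)

/-- `R` is a coin-flip event: `R ∈ G` and `P(R) = 1/2`. -/
def IsCoinFlip {Ω : Type*} (G : MeasurableSpace Ω) [MeasurableSpace Ω] (P : Measure Ω)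
    (R : Set Ω) : Prop :=
  MeasurableSet[G] R ∧ P.real R = 1 / 2

/-- The subjective mixture `(1/2)x ⊕ (1/2)y` of outcomes. With `M = max x y` and `m = min x y`, it is
the `z ∈ [m, M]` such that `MRm ≃ c_{MRz} R c_{zRm}` for coin-flip events `R` (under (RC), (M),
(SRM), (C) it exists, is unique, and does not depend on `R`). -/
noncomputable def outcomeMix {Ω : Type*} (G : MeasurableSpace Ω) [F : MeasurableSpace Ω]
    (hG : G ≤ F) (P : Measure Ω) (pref : Act Ω → Act Ω → Prop) (x y : ℝ) : ℝ :=
  Classical.epsilon fun z : ℝ => z ∈ Set.Icc (min x y) (max x y) ∧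
    ∀ (R : Set Ω) (hR : IsCoinFlip G P R),
      Indiff pref (binAct (max x y) R (hG R hR.1) (min x y))
        (binAct (certEq pref (binAct (max x y) R (hG R hR.1) z)) R (hG R hR.1)
          (certEq pref (binAct z R (hG R hR.1) (min x y))))

open Classical in
/-- The subjective mixture `(1/2)X ⊕ (1/2)Y` of acts, defined statewise. (Under (RC), (M), (SRM),
(C) the statewise mixture is an act, so that the second branch does not occur.) -/
noncomputable def actMix {Ω : Type*} (G : MeasurableSpace Ω) [F : MeasurableSpace Ω]
    (hG : G ≤ F) (P : Measure Ω) (pref : Act Ω → Act Ω → Prop) (X Y : Act Ω) : Act Ω :=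
  if h : IsAct (fun ω => outcomeMix G hG P pref (X ω) (Y ω)) then
    ⟨fun ω => outcomeMix G hG P pref (X ω) (Y ω), h⟩
  else constAct Ω 0

/-! ### The axioms -/

/-- (RC) Risk conformity. -/
def RiskConformity {Ω : Type*} (G : MeasurableSpace Ω) [MeasurableSpace Ω] (P : Measure Ω)
    (pref : Act Ω → Act Ω → Prop) : Prop :=
  ∀ X Y : Act Ω, Measurable[G] X → Measurable[G] Y → EqSD P X Y → Indiff pref X Y

/-- (M) Monotonicity. -/
def Monotonicity {Ω : Type*} [MeasurableSpace Ω] (pref : Act Ω → Act Ω → Prop) : Prop :=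
  ∀ X Y : Act Ω, (∀ ω, Y ω ≤ X ω) → pref X Y

/-- (SRM) Strict risk monotonicity. -/
def StrictRiskMonotonicity {Ω : Type*} (G : MeasurableSpace Ω) [MeasurableSpace Ω]
    (P : Measure Ω) (pref : Act Ω → Act Ω → Prop) : Prop :=
  ∀ X Y : Act Ω, Measurable[G] X → Measurable[G] Y → GtAS P X Y → StrictPref pref X Y

/-- (C) Continuity. -/
def ContinuityAxiom {Ω : Type*} [MeasurableSpace Ω] (pref : Act Ω → Act Ω → Prop) : Prop :=
  ∀ X : Act Ω, BClosed {Y | pref X Y} ∧ BClosed {Y | pref Y X}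

/-- (RS) Risk symmetry. -/
def RiskSymmetry {Ω : Type*} (G : MeasurableSpace Ω) [F : MeasurableSpace Ω] (hG : G ≤ F)
    (P : Measure Ω) (pref : Act Ω → Act Ω → Prop) : Prop :=
  ∀ (R : Set Ω) (hR : IsCoinFlip G P R) (x y z z' : ℝ), y ≤ x →
    z ∈ Set.Icc y x → z' ∈ Set.Icc y x →
    Indiff pref
      (binAct (certEq pref (binAct x R (hG R hR.1) z)) R (hG R hR.1)
        (certEq pref (binAct z' R (hG R hR.1) y)))
      (binAct (certEq pref (binAct x R (hG R hR.1) z')) R (hG R hR.1)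
        (certEq pref (binAct z R (hG R hR.1) y)))

/-- (SCI) Subjective comonotonic independence. -/
def SubjectiveComonotonicIndependence {Ω : Type*} (G : MeasurableSpace Ω)
    [F : MeasurableSpace Ω] (hG : G ≤ F) (P : Measure Ω) (pref : Act Ω → Act Ω → Prop) : Prop :=
  ∀ X Y Z : Act Ω, Comonotonic X Y → Comonotonic X Z → Comonotonic Y Z → Indiff pref X Y →
    Indiff pref (actMix G hG P pref X Z) (actMix G hG P pref Y Z)

/-! ### The representation -/

/-- `(u, g, ν)` is a Choquet rank-dependent utility representation of `pref`: `u` is a strictly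
increasing vNM utility, `g` a strictly increasing continuous distortion function, `ν` a continuous
risk-conforming capacity, and `X ≿ Y ↔ ∫ u(X) d(g∘ν) ≥ ∫ u(Y) d(g∘ν)`. -/
structure IsCRDURepresentation {Ω : Type*} (G : MeasurableSpace Ω) [MeasurableSpace Ω]
    (P : Measure Ω) (pref : Act Ω → Act Ω → Prop) (u g : ℝ → ℝ) (ν : Set Ω → ℝ) : Prop where
  utility : IsVNMUtility u
  utility_strict : StrictMono u
  distortion : IsDistortion g
  distortion_strict : StrictMonoOn g (Set.Icc 0 1)
  distortion_continuous : ContinuousOn g (Set.Icc 0 1)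
  capacity : IsCapacity ν
  capacity_continuous : IsContinuousSetFun ν
  capacity_riskConforming : IsRiskConforming G P ν
  represents : ∀ X Y : Act Ω, pref X Y ↔
    choquet (fun A => g (ν A)) (fun ω => u (X ω)) ≥ choquet (fun A => g (ν A)) (fun ω => u (Y ω))

end CRDU

/-! **Axioms to representation.** (M), (SRM) and (C) give every act a certainty equivalent,
continuous along bounded pointwise limits, and (RC) makes the coin-flip value f(x, y) = c_{xRy}
independent of R. (SCI) then says that certainty equivalents commute with mixtures of comonotonic
acts (`certEq_actMix`). Applied to a risky bet and a constant, this forces the mixture m(x, y) = ½x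
⊕ ½y to be strictly increasing; applied to two coin flips on the same event, it makes m commute with
f on ordered pairs. Since the equation defining m has a unique solution, m is bisymmetric
(`isBisymmetricMean_outcomeMix`).

A continuous, symmetric, strictly increasing bisymmetric mean is quasi-arithmetic: binary expansions
relative to iterated bisection by m produce u with u(m(x, y)) = (u(x) + u(y))/2 (`exists_utility`).
Measured in utility, the certainty equivalent is a monotone functional preserving midpoints of
comonotonic functions, and such a functional is determined by its values on indicators
(`eq_of_indicator`). The Choquet integral for A ↦ u(c_{1_A}) is another one with the same indicator
values, so the two agree (`utility_certEq_eq_choquet`). On risky events atomlessness and continuity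
make the value of a bet a continuous strictly increasing function γ of its probability; g = u ∘ γ,
and ν(A) solves γ(ν(A)) = c_{1_A}.

**Representation to axioms, and uniqueness.** The Choquet integral for a continuous capacity obeys a
bounded convergence theorem and is comonotonically additive, the latter by transfer to an ordinary
measure on the line (`exists_law_choquet_comp`). As 0 < g(1/2) < 1, the defining equation of m says
that u turns m into the arithmetic mean (`isMidpointOn_outcomeMix`); this yields (SCI). It also
determines u up to affine maps, because m depends on the preference alone; bets on risky events then
fix g, and all bets fix ν. -/

namespace CRDU

/-! ### The Choquet integral: monotonicity, convergence, additive case. -/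

section Choquet

variable {Ω : Type*} [MeasurableSpace Ω] {τ : Set Ω → ℝ} {f h : Ω → ℝ}

lemma measurableSet_tail (hf : Measurable f) (x : ℝ) : MeasurableSet {ω | x < f ω} :=
  measurableSet_lt measurable_const hf

lemma IsCapacity.nonneg (hτ : IsCapacity τ) {A : Set Ω} (hA : MeasurableSet A) : 0 ≤ τ A := by
  rw [← hτ.empty]
  exact hτ.mono _ _ MeasurableSet.empty hA (Set.empty_subset _)

lemma IsCapacity.le_one (hτ : IsCapacity τ) {A : Set Ω} (hA : MeasurableSet A) : τ A ≤ 1 := by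
  rw [← hτ.univ]
  exact hτ.mono _ _ hA MeasurableSet.univ (Set.subset_univ _)

lemma IsCapacity.antitone_tail (hτ : IsCapacity τ) (hf : Measurable f) :
    Antitone fun x => τ {ω | x < f ω} := fun x y hxy =>
  hτ.mono _ _ (measurableSet_tail hf y) (measurableSet_tail hf x)
    fun _ hω => lt_of_le_of_lt hxy hω

lemma IsCapacity.tail_of_le (hτ : IsCapacity τ) {x : ℝ} (hx : ∀ ω, f ω ≤ x) :
    τ {ω | x < f ω} = 0 := by
  rw [← hτ.empty]
  congr 1
  ext ω
  simpa using hx ω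

lemma IsCapacity.tail_of_lt (hτ : IsCapacity τ) {x : ℝ} (hx : ∀ ω, x < f ω) :
    τ {ω | x < f ω} = 1 := by
  rw [← hτ.univ]
  congr 1
  ext ω
  simpa using hx ω

/-- The integrand of the Choquet integral, as a function on the whole line. -/
noncomputable def tailDefect (τ : Set Ω → ℝ) (f : Ω → ℝ) (x : ℝ) : ℝ :=
  τ {ω | x < f ω} - (Set.Iio (0 : ℝ)).indicator 1 x

/-- To the left of `-M` the tail is exactly 1 and to the right of `M` exactly 0, so subtracting the
indicator of the negative half-line cancels it there. The bound depends on `f` only through `M`, so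
it serves as a common dominating function. -/
lemma IsCapacity.norm_tailDefect_le (hτ : IsCapacity τ) (hf : Measurable f) {M : ℝ}
    (hM : ∀ ω, |f ω| ≤ M) (hM0 : 0 ≤ M) (x : ℝ) :
    ‖tailDefect τ f x‖ ≤ (Set.Icc (-M) M).indicator 1 x := by
  have h0 := hτ.nonneg (measurableSet_tail hf x)
  have h1 := hτ.le_one (measurableSet_tail hf x)
  unfold tailDefect
  by_cases hx : x ∈ Set.Icc (-M) M
  · rw [Set.indicator_of_mem hx, Real.norm_eq_abs, abs_le]
    by_cases hx0 : x ∈ Set.Iio (0 : ℝ)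
    · rw [Set.indicator_of_mem hx0]
      simp only [Pi.one_apply]
      constructor <;> linarith
    · rw [Set.indicator_of_notMem hx0]
      simp only [Pi.one_apply]
      constructor <;> linarith
  · rw [Set.indicator_of_notMem hx]
    rcases lt_or_ge x (-M) with hlt | hge
    · rw [hτ.tail_of_lt fun ω => lt_of_lt_of_le hlt (abs_le.1 (hM ω)).1,
        Set.indicator_of_mem (show x ∈ Set.Iio (0 : ℝ) by simp; linarith)]
      simp
    · have hlt : M < x := by
        by_contra hc
        exact hx ⟨hge, not_lt.1 hc⟩
      rw [hτ.tail_of_le fun ω => ((abs_le.1 (hM ω)).2.trans hlt.le),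
        Set.indicator_of_notMem (show x ∉ Set.Iio (0 : ℝ) by simp; linarith)]
      simp

lemma IsCapacity.measurable_tailDefect (hτ : IsCapacity τ) (hf : Measurable f) :
    Measurable (tailDefect τ f) :=
  (hτ.antitone_tail hf).measurable.sub (measurable_one.indicator measurableSet_Iio)

lemma integrable_indicator_Icc (M : ℝ) :
    Integrable ((Set.Icc (-M) M).indicator (1 : ℝ → ℝ)) := by
  rw [integrable_indicator_iff measurableSet_Icc]
  exact integrableOn_const (by simp) (by simp)

lemma IsAct.exists_bound (hf : IsAct f) : ∃ M : ℝ, 0 ≤ M ∧ ∀ ω, |f ω| ≤ M := by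
  obtain ⟨M, hM⟩ := hf.2
  exact ⟨max M 0, le_max_right _ _, fun ω => (hM ω).trans (le_max_left _ _)⟩

lemma IsCapacity.integrable_tailDefect (hτ : IsCapacity τ) (hf : IsAct f) :
    Integrable (tailDefect τ f) := by
  obtain ⟨M, hM0, hM⟩ := hf.exists_bound
  exact (integrable_indicator_Icc M).mono' (hτ.measurable_tailDefect hf.1).aestronglyMeasurable
    (Eventually.of_forall (hτ.norm_tailDefect_le hf.1 hM hM0))

omit [MeasurableSpace Ω] in
-- Only integrability is assumed, so that it also applies to indicators of sets not known to be
-- measurable, as in `IsCapacity.choquet_indicator`.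
lemma choquet_eq_integral_tailDefect (hi : Integrable (tailDefect τ f)) :
    choquet τ f = ∫ x, tailDefect τ f x := by
  rw [← integral_add_compl (measurableSet_Iio (a := (0 : ℝ))) hi, Set.compl_Iio,
    integral_Ici_eq_integral_Ioi, add_comm, choquet]
  congr 1
  · refine setIntegral_congr_fun measurableSet_Ioi fun x hx => ?_
    simp [tailDefect, (Set.mem_Ioi.1 hx).le]
  · refine setIntegral_congr_fun measurableSet_Iio fun x hx => ?_
    simp [tailDefect, Set.mem_Iio.1 hx]

lemma IsCapacity.choquet_eq (hτ : IsCapacity τ) (hf : IsAct f) :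
    choquet τ f = ∫ x, tailDefect τ f x :=
  choquet_eq_integral_tailDefect (hτ.integrable_tailDefect hf)

omit [MeasurableSpace Ω] in
lemma choquet_congr {Ω' : Type*} {τ' : Set Ω' → ℝ} {f' : Ω' → ℝ}
    (h : ∀ x, τ {ω | x < f ω} = τ' {ω | x < f' ω}) : choquet τ f = choquet τ' f' := by
  simp only [choquet, h]

lemma IsCapacity.choquet_mono_of_tail (hτ : IsCapacity τ) (hf : IsAct f) (hh : IsAct h)
    (hle : ∀ x, τ {ω | x < f ω} ≤ τ {ω | x < h ω}) : choquet τ f ≤ choquet τ h := by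
  rw [hτ.choquet_eq hf, hτ.choquet_eq hh]
  exact integral_mono (hτ.integrable_tailDefect hf) (hτ.integrable_tailDefect hh)
    fun x => sub_le_sub_right (hle x) _

lemma IsCapacity.choquet_mono (hτ : IsCapacity τ) (hf : IsAct f) (hh : IsAct h)
    (hle : ∀ ω, f ω ≤ h ω) : choquet τ f ≤ choquet τ h :=
  hτ.choquet_mono_of_tail hf hh fun x => hτ.mono _ _ (measurableSet_tail hf.1 x)
    (measurableSet_tail hh.1 x) fun ω hω => lt_of_lt_of_le hω (hle ω)

/-- A gap at every level of a nondegenerate interval gives the nonnegative difference of the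
integrands a support of positive length. -/
lemma IsCapacity.choquet_lt_of_tail (hτ : IsCapacity τ) (hf : IsAct f) (hh : IsAct h)
    (hle : ∀ x, τ {ω | x < f ω} ≤ τ {ω | x < h ω}) {a b : ℝ} (hab : a < b)
    (hlt : ∀ x ∈ Set.Icc a b, τ {ω | x < f ω} < τ {ω | x < h ω}) :
    choquet τ f < choquet τ h := by
  have hi := (hτ.integrable_tailDefect hh).sub (hτ.integrable_tailDefect hf)
  have hnn : 0 ≤ tailDefect τ h - tailDefect τ f := fun x => by
    simp only [Pi.zero_apply, Pi.sub_apply, tailDefect]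
    linarith [hle x]
  have hpos : 0 < ∫ x, (tailDefect τ h - tailDefect τ f) x := by
    rw [integral_pos_iff_support_of_nonneg hnn hi]
    refine lt_of_lt_of_le ?_ (measure_mono (s := Set.Icc a b) fun x hx => ?_)
    · simpa using hab
    · simp only [Function.mem_support, Pi.sub_apply, tailDefect]
      have := hlt x hx
      intro h0
      linarith
  simp only [Pi.sub_apply] at hpos
  rw [integral_sub (hτ.integrable_tailDefect hh) (hτ.integrable_tailDefect hf)] at hpos
  rw [hτ.choquet_eq hf, hτ.choquet_eq hh]
  linarith

/-- Along a bounded pointwise convergent sequence, the tails converge wherever the limiting tail is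
continuous. -/
lemma IsCapacity.tendsto_tail (hτ : IsCapacity τ) (hc : IsContinuousSetFun τ) {F : ℕ → Ω → ℝ}
    (hF : ∀ n, Measurable (F n)) (hf : Measurable f)
    (hlim : ∀ ω, Tendsto (fun n => F n ω) atTop (𝓝 (f ω))) {x : ℝ}
    (hx : ContinuousAt (fun x => τ {ω | x < f ω}) x) :
    Tendsto (fun n => τ {ω | x < F n ω}) atTop (𝓝 (τ {ω | x < f ω})) := by
  have hmeas : ∀ n, MeasurableSet {ω | x < F n ω} := fun n => measurableSet_tail (hF n) x
  -- `A n` and `B n` require the inequality at all, respectively some, indices from `n` on. The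
  -- union of the `A n` contains `{f > x}`; the intersection of the `B n` lies in `{f ≥ x}`, hence
  -- in `{f > y}` for every `y < x`. Continuity of the tail at `x` closes the gap.
  set A : ℕ → Set Ω := fun n => ⋂ k, {ω | x < F (n + k) ω} with hA
  set B : ℕ → Set Ω := fun n => ⋃ k, {ω | x < F (n + k) ω} with hB
  have hAm : ∀ n, MeasurableSet (A n) := fun n => MeasurableSet.iInter fun k => hmeas _
  have hBm : ∀ n, MeasurableSet (B n) := fun n => MeasurableSet.iUnion fun k => hmeas _
  have hAt := hc.upward A hAm fun n ω hω => by
    simp only [hA, Set.mem_iInter, Set.mem_ofPred_eq] at hω ⊢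
    intro k
    simpa [add_assoc, add_comm 1 k] using hω (k + 1)
  have hBt := hc.downward B hBm fun n ω hω => by
    simp only [hB, Set.mem_iUnion, Set.mem_ofPred_eq] at hω ⊢
    obtain ⟨k, hk⟩ := hω
    exact ⟨k + 1, by simpa [add_assoc, add_comm 1 k] using hk⟩
  have hAU : τ {ω | x < f ω} ≤ τ (⋃ n, A n) := by
    refine hτ.mono _ _ (measurableSet_tail hf x) (MeasurableSet.iUnion hAm) fun ω hω => ?_
    obtain ⟨n, hn⟩ := eventually_atTop.1 ((hlim ω).eventually_const_lt hω)
    simp only [hA, Set.mem_iUnion, Set.mem_iInter, Set.mem_ofPred_eq]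
    exact ⟨n, fun k => hn _ (Nat.le_add_right n k)⟩
  have hBU : τ (⋂ n, B n) ≤ τ {ω | x < f ω} := by
    refine ge_of_tendsto (hx.tendsto.mono_left (nhdsWithin_le_nhds (s := Set.Iio x))) ?_
    filter_upwards [self_mem_nhdsWithin] with y hy
    refine hτ.mono _ _ (MeasurableSet.iInter hBm) (measurableSet_tail hf y) fun ω hω => ?_
    refine lt_of_lt_of_le (Set.mem_Iio.1 hy) (le_of_not_gt fun hlt => ?_)
    obtain ⟨n, hn⟩ := eventually_atTop.1 ((hlim ω).eventually_lt_const hlt)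
    simp only [hB, Set.mem_iUnion, Set.mem_iInter, Set.mem_ofPred_eq] at hω
    obtain ⟨k, hk⟩ := hω n
    exact lt_asymm hk (hn _ (Nat.le_add_right n k))
  have hAle : ∀ n, τ (A n) ≤ τ {ω | x < F n ω} := fun n =>
    hτ.mono _ _ (hAm n) (hmeas n) fun ω hω => by simpa using Set.mem_iInter.1 hω 0
  have hBge : ∀ n, τ {ω | x < F n ω} ≤ τ (B n) := fun n =>
    hτ.mono _ _ (hmeas n) (hBm n) fun ω hω => Set.mem_iUnion.2 ⟨0, by simpa using hω⟩
  have hle : τ (⋃ n, A n) ≤ τ (⋂ n, B n) :=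
    le_of_tendsto_of_tendsto' hAt hBt fun n => (hAle n).trans (hBge n)
  have e1 : τ (⋃ n, A n) = τ {ω | x < f ω} := le_antisymm (hle.trans hBU) hAU
  have e2 : τ (⋂ n, B n) = τ {ω | x < f ω} := le_antisymm hBU (hAU.trans hle)
  rw [e1] at hAt
  rw [e2] at hBt
  exact tendsto_of_tendsto_of_tendsto_of_le_of_le hAt hBt hAle hBge

/-- The Choquet integral with respect to a continuous capacity is continuous along bounded pointwise
convergent sequences. -/
lemma IsCapacity.tendsto_choquet (hτ : IsCapacity τ) (hc : IsContinuousSetFun τ) {F : ℕ → Ω → ℝ}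
    {M : ℝ} (hF : ∀ n, Measurable (F n)) (hf : Measurable f) (hM : ∀ n ω, |F n ω| ≤ M)
    (hlim : ∀ ω, Tendsto (fun n => F n ω) atTop (𝓝 (f ω))) :
    Tendsto (fun n => choquet τ (F n)) atTop (𝓝 (choquet τ f)) := by
  have hfM : ∀ ω, |f ω| ≤ M := fun ω =>
    le_of_tendsto (hlim ω).abs (Eventually.of_forall fun n => hM n ω)
  have hM' : ∀ n ω, |F n ω| ≤ max M 0 := fun n ω => (hM n ω).trans (le_max_left _ _)
  rw [hτ.choquet_eq ⟨hf, M, hfM⟩]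
  simp_rw [fun n => hτ.choquet_eq ⟨hF n, M, hM n⟩]
  refine tendsto_integral_of_dominated_convergence _
    (fun n => (hτ.measurable_tailDefect (hF n)).aestronglyMeasurable)
    (integrable_indicator_Icc (max M 0))
    (fun n => Eventually.of_forall (hτ.norm_tailDefect_le (hF n) (hM' n) (le_max_right _ _))) ?_
  -- A monotone function has countably many discontinuities, so the levels where the tails might not
  -- converge form a null set.
  have hcount := (hτ.antitone_tail hf).countable_not_continuousAt
  have hae : ∀ᵐ x : ℝ, ContinuousAt (fun x => τ {ω | x < f ω}) x := by
    simpa using hcount.ae_notMem volume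
  filter_upwards [hae] with x hx
  exact (hτ.tendsto_tail hc hF hf hlim hx).sub_const _

/-- For a probability measure, the Choquet integral is the Lebesgue integral. -/
lemma choquet_measureReal (μ : Measure Ω) [IsProbabilityMeasure μ] (hf : Measurable f)
    (hi : Integrable f μ) : choquet (fun A => μ.real A) f = ∫ ω, f ω ∂μ := by
  have hp := hi.pos_part
  have hn := hi.neg_part
  have hsub : ∫ ω, f ω ∂μ = (∫ ω, max (f ω) 0 ∂μ) - ∫ ω, max (-f ω) 0 ∂μ := by
    rw [← integral_sub hp hn]
    refine integral_congr_ae (Eventually.of_forall fun ω => ?_)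
    simp only
    rcases le_total (f ω) 0 with h0 | h0
    · rw [max_eq_right h0, max_eq_left (by linarith)]; ring
    · rw [max_eq_left h0, max_eq_right (by linarith)]; ring
  -- The negative part uses the layer-cake formula with non-strict inequalities: after `x ↦ -x` its
  -- level sets are complements of strict tails of `f`.
  rw [hsub, hp.integral_eq_integral_meas_lt (Eventually.of_forall fun ω => le_max_right _ _),
    hn.integral_eq_integral_meas_le (Eventually.of_forall fun ω => le_max_right _ _), choquet,
    sub_eq_add_neg]
  congr 1
  · refine setIntegral_congr_fun measurableSet_Ioi fun x hx => ?_
    congr 1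
    ext ω
    simp [(Set.mem_Ioi.1 hx).not_gt]
  · have e := integral_comp_neg_Ioi 0 fun x => μ.real {ω | x < f ω} - 1
    rw [neg_zero, integral_Iic_eq_integral_Iio] at e
    rw [← integral_neg, ← e]
    refine setIntegral_congr_fun measurableSet_Ioi fun x hx => ?_
    have : {ω | x ≤ max (-f ω) 0} = {ω | -x < f ω}ᶜ := by
      ext ω
      have := Set.mem_Ioi.1 hx
      simp only [le_max_iff, Set.mem_ofPred_eq, Set.mem_compl_iff, not_lt]
      constructor
      · rintro (h | h) <;> linarith
      · intro h; left; linarith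
    rw [this, probReal_compl_eq_one_sub (measurableSet_tail hf _)]
    ring

end Choquet

/-! ### Laws of acts and comonotonic additivity. -/

section Pushforward

variable {Ω : Type*} [MeasurableSpace Ω] {τ : Set Ω → ℝ} {f h : Ω → ℝ}

/-- Upper sets of the line are of the form `∅`, `univ`, `Ioi s` or `Ici s`. -/
lemma isUpperSet_real_cases {U : Set ℝ} (hU : IsUpperSet U) :
    U = ∅ ∨ U = Set.univ ∨ ∃ s, U = Set.Ioi s ∨ U = Set.Ici s := by
  rcases U.eq_empty_or_nonempty with h | hne
  · exact Or.inl h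
  by_cases hb : BddBelow U
  · refine Or.inr (Or.inr ⟨sInf U, ?_⟩)
    have hsub : Set.Ioi (sInf U) ⊆ U := fun x hx => by
      obtain ⟨y, hy, hyx⟩ := exists_lt_of_csInf_lt hne hx
      exact hU hyx.le hy
    by_cases hm : sInf U ∈ U
    · right
      exact Set.Subset.antisymm (fun x hx => csInf_le hb hx) fun x hx => hU hx hm
    · left
      exact Set.Subset.antisymm (fun x hx => lt_of_le_of_ne (csInf_le hb hx)
        fun he => hm (he ▸ hx)) hsub
  · refine Or.inr (Or.inl (Set.eq_univ_of_forall fun x => ?_))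
    simp only [BddBelow, lowerBounds, Set.Nonempty, not_exists, Set.mem_ofPred_eq, not_forall,
      not_le] at hb
    obtain ⟨y, hy, hyx⟩ := hb x
    exact hU hyx.le hy

/-- A continuous capacity and an act determine a law on the line: a probability measure whose upper
tails are those of the act. -/
lemma exists_law (hτ : IsCapacity τ) (hc : IsContinuousSetFun τ) (hh : IsAct h) :
    ∃ μ : Measure ℝ, IsProbabilityMeasure μ ∧
      ∀ x, μ.real (Set.Ioi x) = τ {ω | x < h ω} := by
  obtain ⟨M, hM0, hM⟩ := hh.exists_bound
  have hanti := hτ.antitone_tail hh.1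
  -- This is the distribution function of `h`. Its right continuity is upward continuity of `τ`,
  -- because `{h > x}` is the increasing union of the events `{h > x + 1/(n+1)}`.
  let S : StieltjesFunction ℝ :=
    { toFun := fun x => 1 - τ {ω | x < h ω}
      mono' := fun x y hxy => sub_le_sub_left (hanti hxy) 1
      right_continuous' := fun x => by
        have hmono : Monotone fun x => 1 - τ {ω | x < h ω} :=
          fun x y hxy => sub_le_sub_left (hanti hxy) 1
        rw [← continuousWithinAt_Ioi_iff_Ici]
        refine (hmono.continuousWithinAt_Ioi_iff_rightLim_eq).2 ?_
        have h1 := hmono.tendsto_rightLim x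
        have hseq : Tendsto (fun n : ℕ => x + 1 / ((n : ℝ) + 1)) atTop (𝓝[>] x) := by
          refine tendsto_nhdsWithin_iff.2 ⟨?_, Eventually.of_forall fun n => ?_⟩
          · simpa using tendsto_one_div_add_atTop_nhds_zero_nat.const_add x
          · simp only [Set.mem_Ioi, lt_add_iff_pos_right]; positivity
        have h2 := h1.comp hseq
        have h3 := hc.upward (fun n : ℕ => {ω | x + 1 / ((n : ℝ) + 1) < h ω})
          (fun n => measurableSet_tail hh.1 _) fun n ω hω => by
            simp only [Set.mem_ofPred_eq] at hω ⊢
            refine lt_of_le_of_lt ?_ hω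
            gcongr
            simp
        have h4 : (⋃ n : ℕ, {ω | x + 1 / ((n : ℝ) + 1) < h ω}) = {ω | x < h ω} := by
          ext ω
          simp only [Set.mem_iUnion, Set.mem_ofPred_eq]
          constructor
          · rintro ⟨n, hn⟩
            refine lt_trans ?_ hn
            simp only [lt_add_iff_pos_right]; positivity
          · intro hx
            obtain ⟨n, hn⟩ := exists_nat_one_div_lt (sub_pos.2 hx)
            exact ⟨n, by linarith⟩
        rw [h4] at h3
        exact tendsto_nhds_unique h2 (h3.const_sub 1) }
  have htop : Tendsto S atTop (𝓝 1) := by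
    refine tendsto_const_nhds.congr' ?_
    filter_upwards [eventually_ge_atTop M] with x hx
    change (1 : ℝ) = 1 - τ {ω | x < h ω}
    rw [hτ.tail_of_le fun ω => (abs_le.1 (hM ω)).2.trans hx, sub_zero]
  have hbot : Tendsto S atBot (𝓝 0) := by
    refine tendsto_const_nhds.congr' ?_
    filter_upwards [eventually_lt_atBot (-M)] with x hx
    change (0 : ℝ) = 1 - τ {ω | x < h ω}
    rw [hτ.tail_of_lt fun ω => lt_of_lt_of_le hx (abs_le.1 (hM ω)).1, sub_self]
  refine ⟨S.measure, S.isProbabilityMeasure hbot htop, fun x => ?_⟩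
  rw [measureReal_def, S.measure_Ioi htop]
  change (ENNReal.ofReal (1 - (1 - τ {ω | x < h ω}))).toReal = _
  rw [sub_sub_cancel, ENNReal.toReal_ofReal (hτ.nonneg (measurableSet_tail hh.1 x))]

lemma IsContinuousSetFun.tendsto_lower (hc : IsContinuousSetFun τ) (hh : Measurable h) (s : ℝ) :
    Tendsto (fun n : ℕ => τ {ω | s - 1 / ((n : ℝ) + 1) < h ω}) atTop
      (𝓝 (τ {ω | s ≤ h ω})) := by
  have h3 := hc.downward (fun n : ℕ => {ω | s - 1 / ((n : ℝ) + 1) < h ω})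
    (fun n => measurableSet_tail hh _) fun n ω hω => by
      simp only [Set.mem_ofPred_eq] at hω ⊢
      refine lt_of_le_of_lt ?_ hω
      gcongr
      simp
  convert h3 using 3
  ext ω
  simp only [Set.mem_iInter, Set.mem_ofPred_eq]
  constructor
  · intro hs n
    have : (0 : ℝ) < 1 / ((n : ℝ) + 1) := by positivity
    linarith
  · intro hs
    by_contra hlt
    obtain ⟨n, hn⟩ := exists_nat_one_div_lt (sub_pos.2 (not_le.1 hlt))
    linarith [hs n]

/-- The Choquet integral of an increasing transform of an act is the Lebesgue integral of the
transform under the law of the act. -/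
lemma exists_law_choquet_comp (hτ : IsCapacity τ) (hc : IsContinuousSetFun τ) (hh : IsAct h) :
    ∃ μ : Measure ℝ, IsProbabilityMeasure μ ∧ ∀ φ : ℝ → ℝ, Monotone φ →
      Integrable φ μ ∧ choquet τ (fun ω => φ (h ω)) = ∫ x, φ x ∂μ := by
  obtain ⟨μ, hμ, hIoi⟩ := exists_law hτ hc hh
  obtain ⟨M, hM0, hM⟩ := hh.exists_bound
  have hIci : ∀ s, μ.real (Set.Ici s) = τ {ω | s ≤ h ω} := fun s => by
    have h1 := hc.tendsto_lower hh.1 s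
    have h2 : Tendsto (fun n : ℕ => μ.real (Set.Ioi (s - 1 / ((n : ℝ) + 1)))) atTop
        (𝓝 (μ.real (Set.Ici s))) := by
      have := tendsto_measure_iInter_atTop (μ := μ)
        (s := fun n : ℕ => Set.Ioi (s - 1 / ((n : ℝ) + 1)))
        (fun n => measurableSet_Ioi.nullMeasurableSet)
        (fun m n hmn => Set.Ioi_subset_Ioi (by gcongr)) ⟨0, measure_ne_top _ _⟩
      have he : (⋂ n : ℕ, Set.Ioi (s - 1 / ((n : ℝ) + 1))) = Set.Ici s := by
        ext x
        simp only [Set.mem_iInter, Set.mem_Ioi, Set.mem_Ici]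
        constructor
        · intro hs
          by_contra hlt
          obtain ⟨n, hn⟩ := exists_nat_one_div_lt (sub_pos.2 (not_le.1 hlt))
          linarith [hs n]
        · intro hs n
          have : (0 : ℝ) < 1 / ((n : ℝ) + 1) := by positivity
          linarith
      rw [he] at this
      exact (ENNReal.tendsto_toReal (measure_ne_top _ _)).comp this
    simp only [hIoi] at h2
    exact tendsto_nhds_unique h2 h1
  -- The superlevel sets of an increasing `φ` are upper sets, so only the chain of events `{h > s}`,
  -- `{h ≥ s}` enters the Choquet integral of `φ ∘ h`. On this chain a non-additive `τ` is
  -- indistinguishable from a measure.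
  have hupper : ∀ U : Set ℝ, IsUpperSet U → μ.real U = τ {ω | h ω ∈ U} := fun U hU => by
    rcases isUpperSet_real_cases hU with rfl | rfl | ⟨s, rfl | rfl⟩
    · simpa using hτ.empty.symm
    · simpa using hτ.univ.symm
    · exact hIoi s
    · exact hIci s
  have hae : ∀ᵐ x ∂μ, x ∈ Set.Icc (-M) M := by
    have h1 : μ (Set.Ioi M) = 0 := by
      rw [← measureReal_eq_zero_iff, hIoi]
      exact hτ.tail_of_le fun ω => (abs_le.1 (hM ω)).2
    have h2 : μ (Set.Iio (-M)) = 0 := by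
      have : (Set.Iio (-M)) = (Set.Ici (-M))ᶜ := by simp
      rw [this, prob_compl_eq_zero_iff measurableSet_Ici, ← ENNReal.toReal_eq_one_iff,
        ← measureReal_def, hIci, ← hτ.univ]
      congr 1
      ext ω
      simpa using (abs_le.1 (hM ω)).1
    filter_upwards [measure_eq_zero_iff_ae_notMem.1 h1, measure_eq_zero_iff_ae_notMem.1 h2]
      with x hx1 hx2
    exact ⟨not_lt.1 hx2, not_lt.1 hx1⟩
  refine ⟨μ, hμ, fun φ hφ => ?_⟩
  have hi : Integrable φ μ := by
    refine Integrable.mono' (integrable_const (max |φ (-M)| |φ M|))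
      hφ.measurable.aestronglyMeasurable ?_
    filter_upwards [hae] with x hx
    exact abs_le_max_abs_abs (hφ hx.1) (hφ hx.2)
  refine ⟨hi, ?_⟩
  rw [← choquet_measureReal μ hφ.measurable hi]
  exact choquet_congr fun x =>
    (hupper {y | x < φ y} fun a b hab ha => lt_of_lt_of_le ha (hφ hab)).symm

lemma IsCapacity.choquet_affine (hτ : IsCapacity τ) (hc : IsContinuousSetFun τ) (hh : IsAct h)
    {a : ℝ} (ha : 0 ≤ a) (b : ℝ) :
    choquet τ (fun ω => a * h ω + b) = a * choquet τ h + b := by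
  obtain ⟨μ, hμ, hK⟩ := exists_law_choquet_comp hτ hc hh
  have h1 := hK (fun x => a * x + b) fun x y hxy => by
    simp only
    gcongr
  have h2 : Integrable (fun x : ℝ => x) μ ∧ choquet τ (fun ω => id (h ω)) = ∫ x, x ∂μ :=
    hK id monotone_id
  have h3 : choquet τ h = ∫ x, x ∂μ := h2.2
  rw [h1.2, h3, integral_add (h2.1.const_mul a) (integrable_const b),
    integral_const_mul]
  simp

lemma IsCapacity.choquet_const (hτ : IsCapacity τ) (hc : IsContinuousSetFun τ) (b : ℝ) :
    choquet τ (fun _ => b) = b := by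
  have := hτ.choquet_affine hc (h := fun _ => 0) ⟨measurable_const, 0, by simp⟩ le_rfl b
  simpa using this

/-- The Choquet integral with respect to a continuous capacity is additive on comonotonic acts. -/
lemma IsCapacity.choquet_add (hτ : IsCapacity τ) (hc : IsContinuousSetFun τ) (hf : IsAct f)
    (hh : IsAct h) (hcom : ∀ ω ω', 0 ≤ (f ω - f ω') * (h ω - h ω')) :
    choquet τ (fun ω => f ω + h ω) = choquet τ f + choquet τ h := by
  rcases isEmpty_or_nonempty Ω with he | hne
  · have h0 : (Set.univ : Set Ω) = ∅ := Set.univ_eq_empty_iff.2 he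
    have := hτ.univ
    rw [h0, hτ.empty] at this
    exact absurd this (by norm_num)
  obtain ⟨M, hM0, hM⟩ := hf.exists_bound
  obtain ⟨N, hN0, hN⟩ := hh.exists_bound
  have hs : IsAct fun ω => f ω + h ω := ⟨hf.1.add hh.1, M + N, fun ω =>
    (abs_add_le _ _).trans (add_le_add (hM ω) (hN ω))⟩
  obtain ⟨μ, hμ, hK⟩ := exists_law_choquet_comp hτ hc hs
  -- Comonotonic `f` and `h` are both increasing functions of `f + h`; this infimum is a formula for
  -- the first, and `x - φ x` gives the second. At `x = f ω + h ω` the term of `ω` equals `f ω`. It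
  -- is minimal: if `f ω' < f ω`, then `h ω' ≤ h ω`, and the positive part makes up for the deficit.
  let φ : ℝ → ℝ := fun x => ⨅ ω, (f ω + max (x - (f ω + h ω)) 0)
  have hbdd : ∀ x, BddBelow (Set.range fun ω => f ω + max (x - (f ω + h ω)) 0) := fun x =>
    ⟨-M, by
      rintro _ ⟨ω, rfl⟩
      have := (abs_le.1 (hM ω)).1
      have := le_max_right (x - (f ω + h ω)) 0
      simp only
      linarith⟩
  have hφ : Monotone φ := fun x y hxy => ciInf_mono (hbdd x) fun ω => by gcongr
  have hφ1 : Monotone fun x => x - φ x := fun x y hxy => by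
    have : φ y - (y - x) ≤ φ x := by
      refine le_ciInf fun ω => ?_
      have h1 := ciInf_le (hbdd y) ω
      have h2 : max (y - (f ω + h ω)) 0 ≤ max (x - (f ω + h ω)) 0 + (y - x) := by
        refine max_le ?_ ?_
        · linarith [le_max_left (x - (f ω + h ω)) 0]
        · linarith [le_max_right (x - (f ω + h ω)) 0]
      have h3 : φ y ≤ f ω + max (y - (f ω + h ω)) 0 := h1
      linarith
    simp only
    linarith
  have hval : ∀ ω, φ (f ω + h ω) = f ω := fun ω => by
    refine le_antisymm ?_ (le_ciInf fun ω' => ?_)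
    · have := ciInf_le (hbdd (f ω + h ω)) ω
      simpa using this
    · have h1 := le_max_left (f ω + h ω - (f ω' + h ω')) 0
      have h2 := le_max_right (f ω + h ω - (f ω' + h ω')) 0
      have h3 := hcom ω ω'
      by_contra hlt
      have h4 : 0 < f ω - f ω' := by linarith
      have h5 : 0 ≤ h ω - h ω' := nonneg_of_mul_nonneg_right h3 h4
      linarith
  have h1 := hK φ hφ
  have h2 := hK _ hφ1
  have h3 := hK id monotone_id
  simp only [hval, id, add_sub_cancel_left] at h1 h2 h3
  rw [h1.2, h2.2, h3.2, ← integral_add h1.1 h2.1]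
  simp

lemma IsCapacity.choquet_indicator (hτ : IsCapacity τ) {A : Set Ω} :
    choquet τ (A.indicator 1) = τ A := by
  have hd : tailDefect τ (A.indicator 1) = (Set.Ico (0 : ℝ) 1).indicator fun _ => τ A := by
    funext x
    unfold tailDefect
    rcases lt_or_ge x 0 with h0 | h0
    · rw [hτ.tail_of_lt fun ω => lt_of_lt_of_le h0 (Set.indicator_nonneg (by simp) ω),
        Set.indicator_of_mem (by simpa using h0), Set.indicator_of_notMem (by simp [h0])]
      simp
    · rw [Set.indicator_of_notMem (s := Set.Iio (0 : ℝ)) (by simpa using h0), sub_zero]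
      rcases lt_or_ge x 1 with h1 | h1
      · rw [Set.indicator_of_mem (show x ∈ Set.Ico (0 : ℝ) 1 from ⟨h0, h1⟩)]
        congr 1
        ext ω
        by_cases hω : ω ∈ A
        · simp [hω, h1]
        · simp [hω, h0]
      · rw [Set.indicator_of_notMem (s := Set.Ico (0 : ℝ) 1) (by simp [h1]), hτ.tail_of_le]
        exact fun ω => (Set.indicator_le_self' (by simp) ω).trans h1
  have hi : Integrable (tailDefect τ (A.indicator 1)) := by
    rw [hd, integrable_indicator_iff measurableSet_Ico]
    exact integrableOn_const (by simp) (by simp)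
  rw [choquet_eq_integral_tailDefect hi, hd, integral_indicator measurableSet_Ico]
  simp

end Pushforward

/-! ### Bisymmetric means: uniqueness and regularity of midpoint functions. -/

section Mean

/-- A continuous, symmetric, bisymmetric, strictly increasing mean on the real line. -/
structure IsBisymmetricMean (m : ℝ → ℝ → ℝ) : Prop where
  cont : ∀ x, Continuous (m x)
  symm : ∀ x y, m x y = m y x
  idem : ∀ x, m x x = x
  strict : ∀ x, StrictMono (m x)
  bisymm : ∀ a b c d, m (m a b) (m c d) = m (m a c) (m b d)

/-- `u` maps the mean `m` to the arithmetic mean, for arguments in `s`. -/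
def IsMidpointOn (m : ℝ → ℝ → ℝ) (s : Set ℝ) (u : ℝ → ℝ) : Prop :=
  ∀ x ∈ s, ∀ y ∈ s, u (m x y) = (u x + u y) / 2

/-- A bounded function whose value at any point is half its value at some other point vanishes. -/
lemma eq_zero_of_forall_exists_half {α : Type*} {s : Set α} {w : α → ℝ} {K : ℝ}
    (hK : ∀ z ∈ s, |w z| ≤ K) (h : ∀ z ∈ s, ∃ z' ∈ s, w z = w z' / 2) :
    ∀ z ∈ s, w z = 0 := by
  have key : ∀ n : ℕ, ∀ z ∈ s, |w z| ≤ K * (1 / 2) ^ n := by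
    intro n
    induction n with
    | zero => simpa using hK
    | succ n ih =>
      intro z hz
      obtain ⟨z', hz', he⟩ := h z hz
      have := ih z' hz'
      rw [he, abs_div, abs_two, pow_succ]
      linarith
  intro z hz
  have hlim : Tendsto (fun n : ℕ => K * (1 / 2 : ℝ) ^ n) atTop (𝓝 (K * 0)) :=
    (tendsto_pow_atTop_nhds_zero_of_lt_one (by norm_num) (by norm_num)).const_mul K
  rw [mul_zero] at hlim
  exact abs_eq_zero.1 (le_antisymm (ge_of_tendsto' hlim fun n => key n z hz) (abs_nonneg _))

variable {m : ℝ → ℝ → ℝ} {a b : ℝ}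

namespace IsBisymmetricMean

lemma strict_left (hm : IsBisymmetricMean m) (y : ℝ) : StrictMono fun x => m x y := fun x x' h => by
  simp only [hm.symm _ y]
  exact hm.strict y h

lemma mono₂ (hm : IsBisymmetricMean m) {x x' y y' : ℝ} (h : x ≤ x') (h' : y ≤ y') :
    m x y ≤ m x' y' :=
  ((hm.strict_left y).monotone h).trans ((hm.strict x').monotone h')

lemma lt_left (hm : IsBisymmetricMean m) {x y : ℝ} (h : x < y) : x < m x y := by
  conv_lhs => rw [← hm.idem x]
  exact hm.strict x h

lemma lt_right (hm : IsBisymmetricMean m) {x y : ℝ} (h : x < y) : m x y < y := by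
  conv_rhs => rw [← hm.idem y]
  exact hm.strict_left y h

lemma mem_Icc (hm : IsBisymmetricMean m) {x y : ℝ} (hx : x ∈ Set.Icc a b) (hy : y ∈ Set.Icc a b) :
    m x y ∈ Set.Icc a b := by
  constructor
  · rw [← hm.idem a]
    exact hm.mono₂ hx.1 hy.1
  · rw [← hm.idem b]
    exact hm.mono₂ hx.2 hy.2

lemma exists_left (hm : IsBisymmetricMean m) (hab : a ≤ b) {z : ℝ} (hz : z ∈ Set.Icc a (m a b)) :
    ∃ z' ∈ Set.Icc a b, m a z' = z :=
  intermediate_value_Icc hab (hm.cont a).continuousOn (by rwa [hm.idem])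

lemma exists_right (hm : IsBisymmetricMean m) (hab : a ≤ b) {z : ℝ} (hz : z ∈ Set.Icc (m a b) b) :
    ∃ z' ∈ Set.Icc a b, m b z' = z :=
  intermediate_value_Icc hab (hm.cont b).continuousOn (by rwa [hm.idem, hm.symm b a])

lemma exists_half (hm : IsBisymmetricMean m) (hab : a ≤ b) {z : ℝ} (hz : z ∈ Set.Icc a b) :
    ∃ z' ∈ Set.Icc a b, m a z' = z ∨ m b z' = z := by
  rcases le_total z (m a b) with h | h
  · obtain ⟨z', hz', he⟩ := hm.exists_left hab ⟨hz.1, h⟩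
    exact ⟨z', hz', Or.inl he⟩
  · obtain ⟨z', hz', he⟩ := hm.exists_right hab ⟨h, hz.2⟩
    exact ⟨z', hz', Or.inr he⟩

/-- A bounded function turning `m` into the arithmetic mean and vanishing at the endpoints
vanishes. -/
lemma eq_zero_of_midpoint (hm : IsBisymmetricMean m) (hab : a ≤ b) {w : ℝ → ℝ} {K : ℝ}
    (hK : ∀ z ∈ Set.Icc a b, |w z| ≤ K) (hw : IsMidpointOn m (Set.Icc a b) w)
    (ha : w a = 0) (hb : w b = 0) : ∀ z ∈ Set.Icc a b, w z = 0 := by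
  refine eq_zero_of_forall_exists_half hK fun z hz => ?_
  obtain ⟨z', hz', he | he⟩ := hm.exists_half hab hz
  · exact ⟨z', hz', by rw [← he, hw a ⟨le_rfl, hab⟩ z' hz', ha]; ring⟩
  · exact ⟨z', hz', by rw [← he, hw b ⟨hab, le_rfl⟩ z' hz', hb]; ring⟩

/-- Two increasing functions turning `m` into the arithmetic mean are affinely related. -/
lemma exists_affine (hm : IsBisymmetricMean m) (hab : a ≤ b) {u v : ℝ → ℝ}
    (hu : MonotoneOn u (Set.Icc a b)) (hv : MonotoneOn v (Set.Icc a b))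
    (hum : IsMidpointOn m (Set.Icc a b) u) (hvm : IsMidpointOn m (Set.Icc a b) v)
    (hlt : u a < u b) : ∃ α β : ℝ, ∀ z ∈ Set.Icc a b, v z = α * u z + β := by
  set α := (v b - v a) / (u b - u a) with hα
  have hne : u b - u a ≠ 0 := by linarith
  refine ⟨α, v a - α * u a, fun z hz => ?_⟩
  have ha : a ∈ Set.Icc a b := ⟨le_rfl, hab⟩
  have hb : b ∈ Set.Icc a b := ⟨hab, le_rfl⟩
  -- With this slope, `v` minus the affine image of `u` vanishes at both endpoints; it still turns
  -- `m` into the arithmetic mean, and monotonicity of `u` and `v` bounds it by `K`.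
  have key := hm.eq_zero_of_midpoint hab (w := fun z => (v z - v a) - α * (u z - u a))
    (K := (v b - v a) + |α| * (u b - u a)) (fun z hz => ?_) (fun x hx y hy => ?_)
    (by simp) (by simp only [hα]; field_simp; ring) z hz
  · linarith
  · have h1 := hv ha hz hz.1
    have h2 := hv hz hb hz.2
    have h3 := hu ha hz hz.1
    have h4 := hu hz hb hz.2
    refine (abs_sub _ _).trans (add_le_add ?_ ?_)
    · rw [abs_of_nonneg (by linarith)]; linarith
    · rw [abs_mul, abs_of_nonneg (show 0 ≤ u z - u a by linarith)]
      exact mul_le_mul_of_nonneg_left (by linarith) (abs_nonneg _)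
  · simp only [hum x hx y hy, hvm x hx y hy]
    ring

/-- Iterated averaging with `x` converges to `x`. -/
lemma tendsto_iterate (hm : IsBisymmetricMean m) (x z : ℝ) :
    Tendsto (fun n => (m x)^[n] z) atTop (𝓝 x) := by
  -- A limit of the orbit is a fixed point of `m x`, and strictness leaves `x` as the only one.
  -- Convergence itself comes from the orbit being monotone and bounded by `x`.
  have hfix : ∀ ℓ, Tendsto (fun n => (m x)^[n] z) atTop (𝓝 ℓ) → ℓ = x := fun ℓ hℓ => by
    have hf : m x ℓ = ℓ := isFixedPt_of_tendsto_iterate hℓ (hm.cont x).continuousAt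
    rcases lt_trichotomy ℓ x with h | h | h
    · have := hm.lt_left h
      rw [hm.symm, hf] at this
      exact absurd this (lt_irrefl _)
    · exact h
    · have := hm.lt_right h
      rw [hf] at this
      exact absurd this (lt_irrefl _)
  rcases le_total z x with h | h
  · have hle : ∀ n, (m x)^[n] z ≤ x := fun n => by
      induction n with
      | zero => simpa using h
      | succ n ih =>
        rw [Function.iterate_succ_apply']
        conv_rhs => rw [← hm.idem x]
        exact (hm.strict x).monotone ih
    have hmono : Monotone fun n => (m x)^[n] z := monotone_nat_of_le_succ fun n => by
      rw [Function.iterate_succ_apply']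
      conv_lhs => rw [← hm.idem ((m x)^[n] z)]
      exact (hm.strict_left _).monotone (hle n)
    have := tendsto_atTop_ciSup hmono ⟨x, by rintro _ ⟨n, rfl⟩; exact hle n⟩
    rwa [hfix _ this] at this
  · have hle : ∀ n, x ≤ (m x)^[n] z := fun n => by
      induction n with
      | zero => simpa using h
      | succ n ih =>
        rw [Function.iterate_succ_apply']
        conv_lhs => rw [← hm.idem x]
        exact (hm.strict x).monotone ih
    have hanti : Antitone fun n => (m x)^[n] z := antitone_nat_of_succ_le fun n => by
      rw [Function.iterate_succ_apply']
      conv_rhs => rw [← hm.idem ((m x)^[n] z)]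
      exact (hm.strict_left _).monotone (hle n)
    have := tendsto_atTop_ciInf hanti ⟨x, by rintro _ ⟨n, rfl⟩; exact hle n⟩
    rwa [hfix _ this] at this

lemma iterate_mem_Icc (hm : IsBisymmetricMean m) {x z : ℝ} (hx : x ∈ Set.Icc a b)
    (hz : z ∈ Set.Icc a b) (n : ℕ) : (m x)^[n] z ∈ Set.Icc a b := by
  induction n with
  | zero => simpa using hz
  | succ n ih =>
    rw [Function.iterate_succ_apply']
    exact hm.mem_Icc hx ih

lemma midpoint_iterate (hm : IsBisymmetricMean m) {u : ℝ → ℝ}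
    (hu : IsMidpointOn m (Set.Icc a b) u) {x z : ℝ} (hx : x ∈ Set.Icc a b)
    (hz : z ∈ Set.Icc a b) (n : ℕ) :
    u ((m x)^[n] z) = u x + (1 / 2) ^ n * (u z - u x) := by
  induction n with
  | zero => simp
  | succ n ih =>
    rw [Function.iterate_succ_apply', hu x hx _ (hm.iterate_mem_Icc hx hz n), ih, pow_succ]
    ring

/-- Suppose `u x = u y` with `x < y`. Averaging `b` repeatedly with `x` eventually lands below `y`,
while it only rescales the excess `u b - u x` by a power of 1/2; hence `u b ≤ u x`. Symmetrically `u
y ≤ u a`, so `u b ≤ u a`. -/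
lemma strictMonoOn_of_midpoint (hm : IsBisymmetricMean m) {u : ℝ → ℝ}
    (hu : MonotoneOn u (Set.Icc a b)) (hum : IsMidpointOn m (Set.Icc a b) u) (hlt : u a < u b) :
    StrictMonoOn u (Set.Icc a b) := by
  intro x hx y hy hxy
  refine lt_of_le_of_ne (hu hx hy hxy.le) fun he => ?_
  have hab : a ≤ b := hx.1.trans hx.2
  have ha : a ∈ Set.Icc a b := ⟨le_rfl, hab⟩
  have hb : b ∈ Set.Icc a b := ⟨hab, le_rfl⟩
  obtain ⟨n, hn⟩ := ((hm.tendsto_iterate x b).eventually_lt_const hxy).exists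
  obtain ⟨k, hk⟩ := ((hm.tendsto_iterate y a).eventually_const_lt hxy).exists
  have h1 := hu (hm.iterate_mem_Icc hx hb n) hy hn.le
  have h2 := hu hx (hm.iterate_mem_Icc hy ha k) hk.le
  rw [hm.midpoint_iterate hum hx hb] at h1
  rw [hm.midpoint_iterate hum hy ha] at h2
  have p1 : (0 : ℝ) < (1 / 2) ^ n := by positivity
  have p2 : (0 : ℝ) < (1 / 2) ^ k := by positivity
  have h3 : u b ≤ u x := by
    by_contra hc
    nlinarith [mul_pos p1 (sub_pos.2 (not_le.1 hc))]
  have h4 : u y ≤ u a := by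
    by_contra hc
    nlinarith [mul_pos p2 (sub_pos.2 (not_le.1 hc))]
  linarith

/-- Averaging `x - 1` and `x + 1` repeatedly with `x` gives points strictly on either side of `x`
whose `u`-values converge to `u x`; monotonicity squeezes `u` in between. -/
lemma continuous_of_midpoint (hm : IsBisymmetricMean m) {u : ℝ → ℝ} (hu : Monotone u)
    (hum : IsMidpointOn m Set.univ u) : Continuous u := by
  have hit : ∀ x z, Tendsto (fun n => u ((m x)^[n] z)) atTop (𝓝 (u x)) := fun x z => by
    have h1 : ∀ n, u ((m x)^[n] z) = u x + (1 / 2) ^ n * (u z - u x) := fun n =>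
      hm.midpoint_iterate (a := min x z) (b := max x z) (fun x _ y _ => hum x trivial y trivial)
        ⟨min_le_left _ _, le_max_left _ _⟩ ⟨min_le_right _ _, le_max_right _ _⟩ n
    simp_rw [h1]
    have := ((tendsto_pow_atTop_nhds_zero_of_lt_one (r := (1 / 2 : ℝ)) (by norm_num)
      (by norm_num)).mul_const (u z - u x)).const_add (u x)
    simpa using this
  rw [continuous_iff_continuousAt]
  intro x
  refine tendsto_order.2 ⟨fun c hc => ?_, fun c hc => ?_⟩
  · obtain ⟨n, hn⟩ := ((hit x (x - 1)).eventually_const_lt hc).exists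
    have hlt : (m x)^[n] (x - 1) < x := by
      clear hn
      induction n with
      | zero => simp
      | succ n ih =>
        rw [Function.iterate_succ_apply']
        conv_rhs => rw [← hm.idem x]
        exact hm.strict x ih
    filter_upwards [eventually_gt_nhds hlt] with y hy
    exact lt_of_lt_of_le hn (hu hy.le)
  · obtain ⟨n, hn⟩ := ((hit x (x + 1)).eventually_lt_const hc).exists
    have hlt : x < (m x)^[n] (x + 1) := by
      clear hn
      induction n with
      | zero => simp
      | succ n ih =>
        rw [Function.iterate_succ_apply']
        conv_lhs => rw [← hm.idem x]
        exact hm.strict x ih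
    filter_upwards [eventually_lt_nhds hlt] with y hy
    exact lt_of_le_of_lt (hu hy.le) hn

end IsBisymmetricMean

end Mean

/-! ### Existence of a quasi-arithmetic utility for a bisymmetric mean. -/

section MeanUtility

variable {m : ℝ → ℝ → ℝ} {a b : ℝ}

namespace IsBisymmetricMean

/-- The binary expansion of a point of `[a, b]` with respect to iterated bisection by `m`. -/
lemma exists_binary_expansion (hm : IsBisymmetricMean m) (hab : a < b) :
    ∃ U : ℝ → ℝ, (∀ z, U z ∈ Set.Icc (0 : ℝ) 1) ∧ U a = 0 ∧ U b = 1 ∧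
      (∀ w ∈ Set.Icc a b, U (m a w) = U w / 2) ∧
      ∀ w ∈ Set.Icc a b, U (m b w) = 1 / 2 + U w / 2 := by
  have ha : a ∈ Set.Icc a b := ⟨le_rfl, hab.le⟩
  have hb : b ∈ Set.Icc a b := ⟨hab.le, le_rfl⟩
  -- `S` undoes a bisection: it blows up the half of `[a, b]` containing `z` to the whole interval,
  -- and `d` below records which half it was. The midpoint itself is assigned to the left half; the
  -- value of `S` outside `[a, b]` is irrelevant.
  have hS : ∀ z, ∃ z', z ∈ Set.Icc a b → (z ≤ m a b → m a z' = z) ∧ (m a b < z → m b z' = z) := by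
    intro z
    by_cases hz : z ∈ Set.Icc a b
    · rcases le_or_gt z (m a b) with h | h
      · obtain ⟨z', -, he⟩ := hm.exists_left hab.le ⟨hz.1, h⟩
        exact ⟨z', fun _ => ⟨fun _ => he, fun h' => absurd h (not_le.2 h')⟩⟩
      · obtain ⟨z', -, he⟩ := hm.exists_right hab.le ⟨h.le, hz.2⟩
        exact ⟨z', fun _ => ⟨fun h' => absurd h (not_lt.2 h'), fun _ => he⟩⟩
    · exact ⟨a, fun h => absurd h hz⟩
  choose S hS using hS
  let d : ℝ → ℝ := fun z => if z ≤ m a b then 0 else 1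
  have hd0 : ∀ z, 0 ≤ d z := fun z => by simp only [d]; split_ifs <;> norm_num
  have hd1 : ∀ z, d z ≤ 1 := fun z => by simp only [d]; split_ifs <;> norm_num
  let t : ℝ → ℕ → ℝ := fun z n => d (S^[n] z) * (1 / 2 / 2 ^ n)
  have ht0 : ∀ z n, 0 ≤ t z n := fun z n => mul_nonneg (hd0 _) (by positivity)
  have ht1 : ∀ z n, t z n ≤ 1 / 2 / 2 ^ n := fun z n =>
    mul_le_of_le_one_left (by positivity) (hd1 _)
  have hgeo := hasSum_geometric_two' (1 : ℝ)
  have hsum : ∀ z, Summable (t z) := fun z =>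
    Summable.of_nonneg_of_le (ht0 z) (ht1 z) hgeo.summable
  let U : ℝ → ℝ := fun z => ∑' n, t z n
  have hrec : ∀ z, U z = d z / 2 + U (S z) / 2 := fun z => by
    simp only [U]
    rw [(hsum z).tsum_eq_zero_add, ← tsum_div_const]
    congr 1
    · simp [t]; ring
    · refine tsum_congr fun n => ?_
      simp only [t, Function.iterate_succ_apply]
      field_simp
      ring
  have hU : ∀ z, U z ∈ Set.Icc (0 : ℝ) 1 := fun z =>
    ⟨tsum_nonneg (ht0 z), ((hsum z).tsum_le_tsum (ht1 z) hgeo.summable).trans_eq hgeo.tsum_eq⟩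
  have hUl : ∀ w ∈ Set.Icc a b, U (m a w) = U w / 2 := fun w hw => by
    have hle : m a w ≤ m a b := (hm.strict a).monotone hw.2
    have hSw : S (m a w) = w := (hm.strict a).injective ((hS _ (hm.mem_Icc ha hw)).1 hle)
    rw [hrec, hSw]
    simp [d, hle]
  have hUa : U a = 0 := by
    have := hUl a ha
    rw [hm.idem] at this
    linarith
  have hUr : ∀ w ∈ Set.Icc a b, m a b < m b w → U (m b w) = 1 / 2 + U w / 2 := fun w hw hlt => by
    have hSw : S (m b w) = w := (hm.strict b).injective ((hS _ (hm.mem_Icc hb hw)).2 hlt)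
    rw [hrec, hSw]
    simp [d, not_le.2 hlt]
  have hUb : U b = 1 := by
    have := hUr b hb (by rw [hm.idem]; exact hm.lt_right hab)
    rw [hm.idem] at this
    linarith
  refine ⟨U, hU, hUa, hUb, hUl, fun w hw => ?_⟩
  -- For `w = a` the point is the midpoint, treated as a left-half point with expansion 0.111…; its
  -- value 1/2 agrees with that of 0.1000….
  rcases hw.1.eq_or_lt with h | h
  · rw [← h, hm.symm b a, hUl b hb, hUa, hUb]
    norm_num
  · exact hUr w hw (by rw [hm.symm a b]; exact hm.strict b h)

lemma le_of_forall_le_add_half_pow {x y : ℝ} (h : ∀ n : ℕ, x ≤ y + (1 / 2) ^ n) : x ≤ y := by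
  have hlim : Tendsto (fun n : ℕ => y + (1 / 2 : ℝ) ^ n) atTop (𝓝 (y + 0)) :=
    (tendsto_pow_atTop_nhds_zero_of_lt_one (by norm_num) (by norm_num)).const_add y
  rw [add_zero] at hlim
  exact ge_of_tendsto' hlim h

/-- The binary expansion has both properties. Comparing digits one at a time shows that it is
increasing up to an error `(1/2)^n`. By bisymmetry, its midpoint defect at two points is half the
defect at their preimages under bisection, and a bounded function with this property vanishes. -/
lemma exists_midpointOn_Icc (hm : IsBisymmetricMean m) (hab : a < b) :
    ∃ U : ℝ → ℝ, MonotoneOn U (Set.Icc a b) ∧ IsMidpointOn m (Set.Icc a b) U ∧ U a < U b := by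
  obtain ⟨U, hU, hUa, hUb, hl, hr⟩ := hm.exists_binary_expansion hab
  have ha : a ∈ Set.Icc a b := ⟨le_rfl, hab.le⟩
  have hb : b ∈ Set.Icc a b := ⟨hab.le, le_rfl⟩
  refine ⟨U, ?_, ?_, by rw [hUa, hUb]; norm_num⟩
  · have key : ∀ n : ℕ, ∀ x ∈ Set.Icc a b, ∀ y ∈ Set.Icc a b, x ≤ y → U x ≤ U y + (1 / 2) ^ n := by
      intro n
      induction n with
      | zero =>
        intro x _ y _ _
        have := (hU x).2
        have := (hU y).1
        simp only [pow_zero]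
        linarith
      | succ n ih =>
        intro x hx y hy hxy
        rcases le_or_gt y (m a b) with h | h
        · obtain ⟨x', hx', rfl⟩ := hm.exists_left hab.le ⟨hx.1, hxy.trans h⟩
          obtain ⟨y', hy', rfl⟩ := hm.exists_left hab.le ⟨hy.1, h⟩
          have := ih x' hx' y' hy' ((hm.strict a).le_iff_le.1 hxy)
          rw [hl x' hx', hl y' hy', pow_succ]
          linarith
        · obtain ⟨y', hy', rfl⟩ := hm.exists_right hab.le ⟨h.le, hy.2⟩
          rcases le_or_gt x (m a b) with h' | h'
          · obtain ⟨x', hx', rfl⟩ := hm.exists_left hab.le ⟨hx.1, h'⟩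
            rw [hl x' hx', hr y' hy']
            have := (hU x').2
            have := (hU y').1
            have : (0 : ℝ) < (1 / 2) ^ (n + 1) := by positivity
            linarith
          · obtain ⟨x', hx', rfl⟩ := hm.exists_right hab.le ⟨h'.le, hx.2⟩
            have := ih x' hx' y' hy' ((hm.strict b).le_iff_le.1 hxy)
            rw [hr x' hx', hr y' hy', pow_succ]
            linarith
    exact fun x hx y hy hxy => le_of_forall_le_add_half_pow fun n => key n x hx y hy hxy
  -- When the two points lie in different halves, bisymmetry produces an average with the central
  -- point `m a b`, which is covered by neither recursion for `U`.
  · have hmid : ∀ w ∈ Set.Icc a b, U (m (m a b) w) = 1 / 4 + U w / 2 := fun w hw => by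
      obtain ⟨w', hw', rfl | rfl⟩ := hm.exists_half hab.le hw
      · rw [hm.bisymm, hm.idem, hl _ (hm.mem_Icc hb hw'), hr w' hw', hl w' hw']
        ring
      · rw [hm.symm a b, hm.bisymm, hm.idem, hr _ (hm.mem_Icc ha hw'), hl w' hw', hr w' hw']
        ring
    have key := eq_zero_of_forall_exists_half (s := Set.Icc a b ×ˢ Set.Icc a b)
      (w := fun p : ℝ × ℝ => U (m p.1 p.2) - (U p.1 + U p.2) / 2) (K := 1)
      (fun p _ => by
        have h1 := hU (m p.1 p.2)
        have h2 := hU p.1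
        have h3 := hU p.2
        rw [abs_le]
        constructor <;> linarith [h1.1, h1.2, h2.1, h2.2, h3.1, h3.2])
      (fun p hp => by
        obtain ⟨x, y⟩ := p
        obtain ⟨x', hx', hx⟩ := hm.exists_half hab.le hp.1
        obtain ⟨y', hy', hy⟩ := hm.exists_half hab.le hp.2
        refine ⟨(x', y'), ⟨hx', hy'⟩, ?_⟩
        have hxy := hm.mem_Icc hx' hy'
        simp only at hx hy ⊢
        rcases hx with rfl | rfl <;> rcases hy with rfl | rfl
        · rw [hm.bisymm, hm.idem, hl _ hxy, hl x' hx', hl y' hy']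
          ring
        · rw [hm.bisymm, hmid _ hxy, hl x' hx', hr y' hy']
          ring
        · rw [hm.bisymm, hm.symm b a, hmid _ hxy, hr x' hx', hl y' hy']
          ring
        · rw [hm.bisymm, hm.idem, hr _ hxy, hr x' hx', hr y' hy']
          ring)
    intro x hx y hy
    have := key (x, y) ⟨hx, hy⟩
    simp only at this
    linarith

lemma isMidpointOn_affine {s : Set ℝ} {u : ℝ → ℝ} (hu : IsMidpointOn m s u) (α β : ℝ) :
    IsMidpointOn m s fun z => α * u z + β := fun x hx y hy => by
  simp only [hu x hx y hy]
  ring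

/-- Bisymmetric means are quasi-arithmetic. -/
theorem exists_utility (hm : IsBisymmetricMean m) :
    ∃ u : ℝ → ℝ, StrictMono u ∧ Continuous u ∧ u 0 = 0 ∧ u 1 = 1 ∧
      IsMidpointOn m Set.univ u := by
  -- Using `n + 1` rather than `n` keeps 0 and 1 inside every interval. Normalizing at these two
  -- points turns affine uniqueness into equality, so the local utilities are restrictions of one
  -- another and can be glued.
  have hex : ∀ n : ℕ, ∃ U : ℝ → ℝ, StrictMonoOn U (Set.Icc (-(n + 1 : ℝ)) (n + 1)) ∧
      IsMidpointOn m (Set.Icc (-(n + 1 : ℝ)) (n + 1)) U ∧ U 0 = 0 ∧ U 1 = 1 := fun n => by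
    have hn : (0 : ℝ) ≤ n := n.cast_nonneg
    obtain ⟨U, hU, hUm, hlt⟩ := hm.exists_midpointOn_Icc (show -(n + 1 : ℝ) < n + 1 by linarith)
    have hs := hm.strictMonoOn_of_midpoint hU hUm hlt
    have h01 : U 0 < U 1 := hs ⟨by linarith, by linarith⟩ ⟨by linarith, by linarith⟩ one_pos
    have hpos : 0 < (U 1 - U 0)⁻¹ := inv_pos.2 (sub_pos.2 h01)
    refine ⟨fun z => (U 1 - U 0)⁻¹ * U z + -((U 1 - U 0)⁻¹ * U 0), fun x hx y hy hxy => ?_,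
      isMidpointOn_affine hUm _ _, by ring, ?_⟩
    · have := mul_lt_mul_of_pos_left (hs hx hy hxy) hpos
      simp only
      linarith
    · have : U 1 - U 0 ≠ 0 := by linarith
      field_simp
      ring
  choose U hs hmid h0 h1 using hex
  have hcons : ∀ n k : ℕ, n ≤ k → ∀ z ∈ Set.Icc (-(n + 1 : ℝ)) (n + 1), U k z = U n z := by
    intro n k hnk z hz
    have hn : (0 : ℝ) ≤ n := n.cast_nonneg
    have hnk' : (n : ℝ) ≤ k := Nat.cast_le.2 hnk
    have hsub : Set.Icc (-(n + 1 : ℝ)) (n + 1) ⊆ Set.Icc (-(k + 1 : ℝ)) (k + 1) :=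
      Set.Icc_subset_Icc (by linarith) (by linarith)
    obtain ⟨α, β, h⟩ := hm.exists_affine (show -(n + 1 : ℝ) ≤ n + 1 by linarith)
      (hs n).monotoneOn ((hs k).monotoneOn.mono hsub) (hmid n)
      (fun x hx y hy => hmid k x (hsub hx) y (hsub hy))
      (hs n ⟨le_rfl, by linarith⟩ ⟨by linarith, le_rfl⟩ (by linarith))
    have e0 := h 0 ⟨by linarith, by linarith⟩
    have e1 := h 1 ⟨by linarith, by linarith⟩
    rw [h0, h0] at e0
    rw [h1, h1] at e1
    have hβ : β = 0 := by linarith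
    have hα : α = 1 := by linarith
    rw [h z hz, hα, hβ]
    ring
  let N : ℝ → ℕ := fun z => ⌈|z|⌉₊
  have hN : ∀ z n, N z ≤ n → z ∈ Set.Icc (-(n + 1 : ℝ)) (n + 1) := fun z n h => by
    have h2 : |z| ≤ n := (Nat.le_ceil _).trans (Nat.cast_le.2 h)
    have := abs_le.1 h2
    constructor <;> linarith [this.1, this.2]
  let u : ℝ → ℝ := fun z => U (N z) z
  have hu : ∀ z n, N z ≤ n → u z = U n z := fun z n h => (hcons _ _ h z (hN z _ le_rfl)).symm
  have hustrict : StrictMono u := fun x y hxy => by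
    rw [hu x (max (N x) (N y)) (le_max_left _ _), hu y (max (N x) (N y)) (le_max_right _ _)]
    exact hs _ (hN _ _ (le_max_left _ _)) (hN _ _ (le_max_right _ _)) hxy
  have humid : IsMidpointOn m Set.univ u := fun x _ y _ => by
    set n := max (N (m x y)) (max (N x) (N y)) with hn
    have hx : N x ≤ n := (le_max_left _ _).trans (le_max_right _ _)
    have hy : N y ≤ n := (le_max_right _ _).trans (le_max_right _ _)
    rw [hu (m x y) n (le_max_left _ _), hu x n hx, hu y n hy]
    exact hmid n x (hN _ _ hx) y (hN _ _ hy)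
  exact ⟨u, hustrict, hm.continuous_of_midpoint hustrict.monotone humid, h0 _, h1 _, humid⟩

/-- The utility of a quasi-arithmetic mean is unique up to positive affine transformations. -/
theorem utility_unique (hm : IsBisymmetricMean m) {u v : ℝ → ℝ} (hu : StrictMono u)
    (hv : StrictMono v) (hum : IsMidpointOn m Set.univ u) (hvm : IsMidpointOn m Set.univ v) :
    ∃ α β : ℝ, 0 < α ∧ ∀ z, v z = α * u z + β := by
  set α := (v 1 - v 0) / (u 1 - u 0) with hα
  have hu01 := hu one_pos
  have hv01 := hv one_pos
  refine ⟨α, v 0 - α * u 0, div_pos (by linarith) (by linarith), fun z => ?_⟩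
  have hz0 : 0 ≤ |z| := abs_nonneg z
  obtain ⟨α', β', h⟩ := hm.exists_affine (a := -(|z| + 1)) (b := |z| + 1) (by linarith)
    (hu.monotone.monotoneOn _) (hv.monotone.monotoneOn _)
    (fun x _ y _ => hum x trivial y trivial) (fun x _ y _ => hvm x trivial y trivial)
    (hu (by linarith))
  have e0 := h 0 ⟨by linarith, by linarith⟩
  have e1 := h 1 ⟨by linarith, by linarith⟩
  have ez := h z ⟨by linarith [neg_abs_le z], by linarith [le_abs_self z]⟩
  have : α = α' := by
    rw [hα, e0, e1]
    have : u 1 - u 0 ≠ 0 := by linarith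
    field_simp
    ring
  rw [ez, e0, this]
  ring

end IsBisymmetricMean

end MeanUtility

/-! ### Functionals preserving midpoints of comonotonic functions. -/

section Functional

variable {Ω : Type*} [MeasurableSpace Ω] {α β : ℝ} {I J : (Ω → ℝ) → ℝ}

/-- Measurable functions with values in `[α, β]`. -/
def boundedFunctions (Ω : Type*) [MeasurableSpace Ω] (α β : ℝ) : Set (Ω → ℝ) :=
  {φ | Measurable φ ∧ ∀ ω, φ ω ∈ Set.Icc α β}

/-- A monotone functional on the measurable functions with values in `[α, β]` which is normalized on
constants and preserves midpoints of comonotonic functions. -/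
structure IsComonotoneMidpoint (α β : ℝ) (I : (Ω → ℝ) → ℝ) : Prop where
  mono : ∀ φ ∈ boundedFunctions Ω α β, ∀ ψ ∈ boundedFunctions Ω α β,
    (∀ ω, φ ω ≤ ψ ω) → I φ ≤ I ψ
  const : ∀ c ∈ Set.Icc α β, I (fun _ => c) = c
  midpoint : ∀ φ ∈ boundedFunctions Ω α β, ∀ ψ ∈ boundedFunctions Ω α β,
    (∀ ω ω', 0 ≤ (φ ω - φ ω') * (ψ ω - ψ ω')) →
    I (fun ω => (φ ω + ψ ω) / 2) = (I φ + I ψ) / 2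

lemma convex_comb_mem_boundedFunctions {φ ψ : Ω → ℝ} (hφ : φ ∈ boundedFunctions Ω α β)
    (hψ : ψ ∈ boundedFunctions Ω α β) {l : ℝ} (hl : l ∈ Set.Icc (0 : ℝ) 1) :
    (fun ω => l * φ ω + (1 - l) * ψ ω) ∈ boundedFunctions Ω α β :=
  ⟨(hφ.1.const_mul l).add (hψ.1.const_mul (1 - l)), fun ω =>
    (convex_Icc α β) (hφ.2 ω) (hψ.2 ω) hl.1 (sub_nonneg.2 hl.2) (by ring)⟩

namespace IsComonotoneMidpoint

lemma mem_Icc (hI : IsComonotoneMidpoint α β I) (hαβ : α ≤ β) {φ : Ω → ℝ}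
    (hφ : φ ∈ boundedFunctions Ω α β) : I φ ∈ Set.Icc α β := by
  constructor
  · conv_lhs => rw [← hI.const α ⟨le_rfl, hαβ⟩]
    exact hI.mono _ ⟨measurable_const, fun _ => ⟨le_rfl, hαβ⟩⟩ _ hφ fun ω => (hφ.2 ω).1
  · conv_rhs => rw [← hI.const β ⟨hαβ, le_rfl⟩]
    exact hI.mono _ hφ _ ⟨measurable_const, fun _ => ⟨hαβ, le_rfl⟩⟩ fun ω => (hφ.2 ω).2

/-- Preservation of comonotonic midpoints implies affinity along comonotonic segments. -/
lemma affine (hI : IsComonotoneMidpoint α β I) (hαβ : α ≤ β) {φ ψ : Ω → ℝ}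
    (hφ : φ ∈ boundedFunctions Ω α β) (hψ : ψ ∈ boundedFunctions Ω α β)
    (hcom : ∀ ω ω', 0 ≤ (φ ω - φ ω') * (ψ ω - ψ ω')) {l : ℝ} (hl : l ∈ Set.Icc (0 : ℝ) 1) :
    I (fun ω => l * φ ω + (1 - l) * ψ ω) = l * I φ + (1 - l) * I ψ := by
  have hIφ := hI.mem_Icc hαβ hφ
  have hIψ := hI.mem_Icc hαβ hψ
  -- The point with parameter `l` is the midpoint of an endpoint and the point with parameter `2l`
  -- or `2l - 1`, so the defect from affinity halves at each step. An endpoint is comonotonic with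
  -- every point of the segment.
  have key := eq_zero_of_forall_exists_half (s := Set.Icc (0 : ℝ) 1)
    (w := fun l => I (fun ω => l * φ ω + (1 - l) * ψ ω) - (l * I φ + (1 - l) * I ψ))
    (K := β - α) (fun l hl => ?_) (fun l hl => ?_) l hl
  · linarith
  · have h1 := hI.mem_Icc hαβ (convex_comb_mem_boundedFunctions hφ hψ hl)
    have h2 := (convex_Icc α β) hIφ hIψ hl.1 (sub_nonneg.2 hl.2) (by ring)
    simp only [smul_eq_mul] at h2
    rw [abs_le]
    constructor <;> linarith [h1.1, h1.2, h2.1, h2.2]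
  · have comb : ∀ t ∈ Set.Icc (0 : ℝ) 1, ∀ χ : Ω → ℝ, (χ = φ ∨ χ = ψ) → ∀ ω ω',
        0 ≤ (χ ω - χ ω') * ((t * φ ω + (1 - t) * ψ ω) - (t * φ ω' + (1 - t) * ψ ω')) := by
      rintro t ht χ (rfl | rfl) ω ω'
      · have h1 := mul_nonneg ht.1 (mul_self_nonneg (χ ω - χ ω'))
        have h2 := mul_nonneg (sub_nonneg.2 ht.2) (hcom ω ω')
        nlinarith
      · have h1 := mul_nonneg (sub_nonneg.2 ht.2) (mul_self_nonneg (χ ω - χ ω'))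
        have h2 := mul_nonneg ht.1 (hcom ω ω')
        nlinarith
    rcases le_total l (1 / 2) with h | h
    · have ht : 2 * l ∈ Set.Icc (0 : ℝ) 1 := ⟨by linarith [hl.1], by linarith⟩
      refine ⟨2 * l, ht, ?_⟩
      have := hI.midpoint ψ hψ _ (convex_comb_mem_boundedFunctions hφ hψ ht)
        (comb _ ht ψ (Or.inr rfl))
      have he : (fun ω => l * φ ω + (1 - l) * ψ ω) =
          fun ω => (ψ ω + (2 * l * φ ω + (1 - 2 * l) * ψ ω)) / 2 := by
        funext ω
        ring
      rw [he, this]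
      ring
    · have ht : 2 * l - 1 ∈ Set.Icc (0 : ℝ) 1 := ⟨by linarith, by linarith [hl.2]⟩
      refine ⟨2 * l - 1, ht, ?_⟩
      have := hI.midpoint φ hφ _ (convex_comb_mem_boundedFunctions hφ hψ ht)
        (comb _ ht φ (Or.inl rfl))
      have he : (fun ω => l * φ ω + (1 - l) * ψ ω) =
          fun ω => (φ ω + ((2 * l - 1) * φ ω + (1 - (2 * l - 1)) * ψ ω)) / 2 := by
        funext ω
        ring
      rw [he, this]
      ring

/-- The two-valued function equal to `β` on `A` and to `α` off `A`. -/
noncomputable def twoValued (α β : ℝ) (A : Set Ω) (ω : Ω) : ℝ := α + (β - α) * A.indicator 1 ω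

omit [MeasurableSpace Ω] in
lemma indicator_one_mem (A : Set Ω) (ω : Ω) :
    A.indicator (1 : Ω → ℝ) ω ∈ Set.Icc (0 : ℝ) 1 :=
  ⟨Set.indicator_nonneg (by simp) ω, Set.indicator_le_self' (by simp) ω⟩

lemma twoValued_mem (hαβ : α ≤ β) {A : Set Ω} (hA : MeasurableSet A) :
    twoValued α β A ∈ boundedFunctions Ω α β :=
  ⟨((measurable_one.indicator hA).const_mul _).const_add _, fun ω => by
    have h := indicator_one_mem A ω
    have h1 := mul_nonneg (sub_nonneg.2 hαβ) h.1
    have h2 := mul_le_of_le_one_right (sub_nonneg.2 hαβ) h.2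
    unfold twoValued
    constructor <;> linarith⟩

/-- The functional is controlled only for values in `[α, β]`, so homogeneity cannot be used
directly. Instead, for `k = 1/(1 + β - α)` the function `k · twoValued + (1 - k) · 0` equals `k · α
+ (1 - k) · 1_A`. Each side is a convex combination with a constant, hence comonotonic, and affinity
evaluates both. -/
lemma map_twoValued (hI : IsComonotoneMidpoint α β I) (hα : α ≤ 0) (hβ : 1 ≤ β) {A : Set Ω}
    (hA : MeasurableSet A) : I (twoValued α β A) = α + (β - α) * I (A.indicator 1) := by
  have hαβ : α ≤ β := by linarith
  have hpos : 0 < 1 + (β - α) := by linarith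
  set k := 1 / (1 + (β - α)) with hk
  have hk01 : k ∈ Set.Icc (0 : ℝ) 1 := by
    refine ⟨by positivity, ?_⟩
    rw [hk, div_le_one hpos]
    linarith
  have hkk : k * (1 + (β - α)) = 1 := by rw [hk]; field_simp
  have hkpos : 0 < k := by positivity
  have h1 := hI.affine hαβ (φ := twoValued α β A) (ψ := fun _ => 0) (twoValued_mem hαβ hA)
    ⟨measurable_const, fun _ => ⟨hα, by linarith⟩⟩ (by simp) hk01
  have h2 := hI.affine hαβ (φ := fun _ => α) (ψ := A.indicator 1)
    ⟨measurable_const, fun _ => ⟨le_rfl, hαβ⟩⟩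
    ⟨measurable_one.indicator hA, fun ω => ⟨hα.trans (indicator_one_mem A ω).1,
      (indicator_one_mem A ω).2.trans hβ⟩⟩ (by simp) hk01
  rw [hI.const 0 ⟨hα, by linarith⟩] at h1
  rw [hI.const α ⟨le_rfl, hαβ⟩] at h2
  have he : (fun ω => k * twoValued α β A ω + (1 - k) * 0) =
      fun ω => k * α + (1 - k) * A.indicator 1 ω := by
    funext ω
    have : 1 - k = k * (β - α) := by linarith
    rw [this, twoValued]
    ring
  rw [he, h2] at h1
  have : 1 - k = k * (β - α) := by linarith
  rw [this] at h1
  have h3 : k * (I (twoValued α β A)) = k * (α + (β - α) * I (A.indicator 1)) := by linarith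
  exact mul_left_cancel₀ hkpos.ne' h3

/-- The average of the first `n + 1` two-valued functions of a decreasing sequence of sets. -/
lemma map_average (hI : IsComonotoneMidpoint α β I) (hαβ : α ≤ β) {A : ℕ → Set Ω}
    (hA : ∀ i, MeasurableSet (A i)) (hanti : Antitone A) (n : ℕ) :
    (fun ω => (∑ i ∈ Finset.range (n + 1), twoValued α β (A i) ω) / (n + 1 : ℝ)) ∈
        boundedFunctions Ω α β ∧
      I (fun ω => (∑ i ∈ Finset.range (n + 1), twoValued α β (A i) ω) / (n + 1 : ℝ)) =
        (∑ i ∈ Finset.range (n + 1), I (twoValued α β (A i))) / (n + 1 : ℝ) := by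
  induction n with
  | zero => simpa using twoValued_mem hαβ (hA 0)
  | succ n ih =>
    set φ : Ω → ℝ :=
      fun ω => (∑ i ∈ Finset.range (n + 1), twoValued α β (A i) ω) / (n + 1 : ℝ) with hφ
    have hn : (0 : ℝ) < n + 1 := by positivity
    have hn2 : (0 : ℝ) < n + 1 + 1 := by positivity
    set l : ℝ := (n + 1) / (n + 1 + 1) with hl
    have hl01 : l ∈ Set.Icc (0 : ℝ) 1 := by
      refine ⟨by positivity, ?_⟩
      rw [hl, div_le_one hn2]
      linarith
    have hfun : (fun ω => (∑ i ∈ Finset.range (n + 1 + 1), twoValued α β (A i) ω) /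
        ((n + 1 : ℕ) + 1 : ℝ)) = fun ω => l * φ ω + (1 - l) * twoValued α β (A (n + 1)) ω := by
      funext ω
      rw [Finset.sum_range_succ, hφ, hl]
      push_cast
      field_simp
      ring
    -- A larger value of the new function means `ω ∈ A (n + 1)`, hence `ω ∈ A i` for all earlier
    -- `i`, where every summand of `φ` takes its maximum.
    have hmono : ∀ ω ω', twoValued α β (A (n + 1)) ω' < twoValued α β (A (n + 1)) ω →
        φ ω' ≤ φ ω := fun ω ω' hlt => by
      have hmem : ω ∈ A (n + 1) := by
        by_contra hc
        unfold twoValued at hlt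
        rw [Set.indicator_of_notMem hc] at hlt
        have := mul_nonneg (sub_nonneg.2 hαβ) (indicator_one_mem (A (n + 1)) ω').1
        linarith
      simp only [hφ]
      gcongr with i hi
      unfold twoValued
      rw [Set.indicator_of_mem (hanti (Finset.mem_range.1 hi).le hmem)]
      have := mul_le_of_le_one_right (sub_nonneg.2 hαβ) (indicator_one_mem (A i) ω').2
      simp only [Pi.one_apply]
      linarith
    have hcom : ∀ ω ω', 0 ≤ (φ ω - φ ω') *
        (twoValued α β (A (n + 1)) ω - twoValued α β (A (n + 1)) ω') := fun ω ω' => by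
      rcases lt_trichotomy (twoValued α β (A (n + 1)) ω') (twoValued α β (A (n + 1)) ω)
        with h | h | h
      · exact mul_nonneg (sub_nonneg.2 (hmono _ _ h)) (sub_nonneg.2 h.le)
      · rw [h]; simp
      · exact mul_nonneg_of_nonpos_of_nonpos (sub_nonpos.2 (hmono _ _ h)) (sub_nonpos.2 h.le)
    rw [hfun]
    refine ⟨convex_comb_mem_boundedFunctions ih.1 (twoValued_mem hαβ (hA _)) hl01, ?_⟩
    rw [hI.affine hαβ ih.1 (twoValued_mem hαβ (hA _)) hcom hl01, ih.2,
      Finset.sum_range_succ _ (n + 1), hl]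
    push_cast
    field_simp
    ring

lemma sum_min_sub_min {x : ℝ} (hx : 0 ≤ x) (n : ℕ) :
    ∑ i ∈ Finset.range n, (min x (i + 1 : ℝ) - min x i) = min x n := by
  have := Finset.sum_range_sub (fun i : ℕ => min x (i : ℝ)) n
  push_cast at this
  rw [this, min_eq_right hx, sub_zero]

/-- Two comonotonic midpoint functionals which agree on indicators are equal. -/
theorem eq_of_indicator (hI : IsComonotoneMidpoint α β I) (hJ : IsComonotoneMidpoint α β J)
    (hα : α ≤ 0) (hβ : 1 ≤ β)
    (h : ∀ A : Set Ω, MeasurableSet A → I (A.indicator 1) = J (A.indicator 1))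
    {φ : Ω → ℝ} (hφ : φ ∈ boundedFunctions Ω α β) : I φ = J φ := by
  have hαβ : α < β := by linarith
  have hpos : 0 < β - α := by linarith
  have htwo : ∀ A : Set Ω, MeasurableSet A → I (twoValued α β A) = J (twoValued α β A) :=
    fun A hA => by rw [hI.map_twoValued hα hβ hA, hJ.map_twoValued hα hβ hA, h A hA]
  have key : ∀ n : ℕ, |I φ - J φ| ≤ (β - α) * (1 / ((n : ℝ) + 1)) := fun n => by
    have hn : (0 : ℝ) < n + 1 := by positivity
    -- Rescale `φ` to take values in `[0, n + 1]` and cut it into unit slices. The slice between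
    -- levels `i` and `i + 1` lies between the indicators of `A (i + 1)` and `A i`, which gives
    -- lower and upper averages of two-valued functions.
    let A : ℕ → Set Ω := fun i => {ω | (i : ℝ) ≤ (n + 1) * (φ ω - α) / (β - α)}
    have hA : ∀ i, MeasurableSet (A i) := fun i =>
      measurableSet_le measurable_const (((hφ.1.sub_const α).const_mul _).div_const _)
    have hanti : Antitone A := fun i j hij ω hω =>
      (Nat.cast_le.2 hij : (i : ℝ) ≤ j).trans hω
    have hA' : ∀ i, MeasurableSet (A (i + 1)) := fun i => hA _
    have hanti' : Antitone fun i => A (i + 1) := fun i j hij => hanti (Nat.succ_le_succ hij)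
    have hx : ∀ ω, 0 ≤ (n + 1) * (φ ω - α) / (β - α) := fun ω =>
      div_nonneg (mul_nonneg hn.le (sub_nonneg.2 (hφ.2 ω).1)) hpos.le
    have hφeq : ∀ ω, φ ω = (∑ i ∈ Finset.range (n + 1), (α + (β - α) *
        (min ((n + 1) * (φ ω - α) / (β - α)) (i + 1 : ℝ) -
          min ((n + 1) * (φ ω - α) / (β - α)) i))) / (n + 1 : ℝ) := fun ω => by
      rw [Finset.sum_add_distrib, ← Finset.mul_sum, sum_min_sub_min (hx ω), min_eq_left]
      · simp only [Finset.sum_const, Finset.card_range, nsmul_eq_mul]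
        push_cast
        field_simp
        ring
      · push_cast
        rw [div_le_iff₀ hpos]
        exact mul_le_mul_of_nonneg_left (by linarith [(hφ.2 ω).2]) hn.le
    have hlow : ∀ ω, (∑ i ∈ Finset.range (n + 1), twoValued α β (A (i + 1)) ω) / (n + 1 : ℝ)
        ≤ φ ω := fun ω => by
      conv_rhs => rw [hφeq ω]
      gcongr with i hi
      unfold twoValued
      gcongr
      by_cases hω : ω ∈ A (i + 1)
      · rw [Set.indicator_of_mem hω]
        have h1 : ((i + 1 : ℕ) : ℝ) ≤ (n + 1) * (φ ω - α) / (β - α) := hω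
        push_cast at h1
        rw [min_eq_right h1, min_eq_right (by linarith)]
        simp
      · rw [Set.indicator_of_notMem hω, sub_nonneg]
        exact min_le_min_left _ (by linarith)
    have hhigh : ∀ ω, φ ω ≤ (∑ i ∈ Finset.range (n + 1), twoValued α β (A i) ω) / (n + 1 : ℝ) :=
      fun ω => by
        conv_lhs => rw [hφeq ω]
        gcongr with i hi
        unfold twoValued
        gcongr
        by_cases hω : ω ∈ A i
        · rw [Set.indicator_of_mem hω]
          have h1 : (i : ℝ) ≤ (n + 1) * (φ ω - α) / (β - α) := hω
          rw [min_eq_right h1]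
          have := min_le_right ((n + 1) * (φ ω - α) / (β - α)) (i + 1 : ℝ)
          simp only [Pi.one_apply]
          linarith
        · rw [Set.indicator_of_notMem hω]
          have h1 : (n + 1) * (φ ω - α) / (β - α) < i := not_le.1 hω
          rw [min_eq_left h1.le, min_eq_left (by linarith)]
          simp
    have Il := hI.map_average hαβ.le hA' hanti' n
    have Ih := hI.map_average hαβ.le hA hanti n
    have Jl := hJ.map_average hαβ.le hA' hanti' n
    have Jh := hJ.map_average hαβ.le hA hanti n
    have i1 := hI.mono _ Il.1 _ hφ hlow
    have i2 := hI.mono _ hφ _ Ih.1 hhigh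
    have j1 := hJ.mono _ Jl.1 _ hφ hlow
    have j2 := hJ.mono _ hφ _ Jh.1 hhigh
    rw [Il.2] at i1
    rw [Ih.2] at i2
    rw [Jl.2] at j1
    rw [Jh.2] at j2
    simp only [fun i => htwo _ (hA i)] at i1 i2
    -- Lower and upper sums differ by a shift of the index, so their difference telescopes to two
    -- boundary terms, each in `[α, β]`, divided by `n + 1`.
    have hdiff : (∑ i ∈ Finset.range (n + 1), J (twoValued α β (A i))) / (n + 1 : ℝ) -
        (∑ i ∈ Finset.range (n + 1), J (twoValued α β (A (i + 1)))) / (n + 1 : ℝ) ≤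
        (β - α) * (1 / ((n : ℝ) + 1)) := by
      rw [← sub_div, ← Finset.sum_sub_distrib,
        Finset.sum_range_sub' (fun i => J (twoValued α β (A i))), mul_one_div]
      have h1 := hJ.mem_Icc hαβ.le (twoValued_mem hαβ.le (hA 0))
      have h2 := hJ.mem_Icc hαβ.le (twoValued_mem hαβ.le (hA (n + 1)))
      gcongr
      · exact h1.2
      · exact h2.1
    rw [abs_le]
    constructor <;> linarith
  have hlim : Tendsto (fun n : ℕ => (β - α) * (1 / ((n : ℝ) + 1))) atTop (𝓝 ((β - α) * 0)) :=
    tendsto_one_div_add_atTop_nhds_zero_nat.const_mul _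
  rw [mul_zero] at hlim
  exact sub_eq_zero.1 (abs_eq_zero.1 (le_antisymm (ge_of_tendsto' hlim key) (abs_nonneg _)))

end IsComonotoneMidpoint

/-- The Choquet integral with respect to a continuous capacity preserves comonotonic midpoints. -/
lemma IsCapacity.isComonotoneMidpoint {τ : Set Ω → ℝ} (hτ : IsCapacity τ)
    (hc : IsContinuousSetFun τ) (α β : ℝ) : IsComonotoneMidpoint α β (choquet τ) := by
  have hact : ∀ φ ∈ boundedFunctions Ω α β, IsAct φ := fun φ hφ =>
    ⟨hφ.1, max |α| |β|, fun ω => abs_le_max_abs_abs (hφ.2 ω).1 (hφ.2 ω).2⟩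
  refine ⟨fun φ hφ ψ hψ hle => hτ.choquet_mono (hact φ hφ) (hact ψ hψ) hle,
    fun c _ => hτ.choquet_const hc c, fun φ hφ ψ hψ hcom => ?_⟩
  have h1 := hτ.choquet_add hc (hact φ hφ) (hact ψ hψ) hcom
  have hs : IsAct fun ω => φ ω + ψ ω := by
    obtain ⟨M, hM⟩ := (hact φ hφ).2
    obtain ⟨N, hN⟩ := (hact ψ hψ).2
    exact ⟨hφ.1.add hψ.1, M + N, fun ω => (abs_add_le _ _).trans (add_le_add (hM ω) (hN ω))⟩
  have h2 := hτ.choquet_affine hc hs (a := 1 / 2) (by norm_num) 0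
  rw [h1] at h2
  have he : (fun ω => (φ ω + ψ ω) / 2) = fun ω => 1 / 2 * (φ ω + ψ ω) + 0 := by
    funext ω
    ring
  rw [he, h2]
  ring

end Functional

/-! ### Atomless risk, certainty equivalents and values of bets. -/

section Basic

variable {Ω : Type*} {G : MeasurableSpace Ω} [F : MeasurableSpace Ω] {hG : G ≤ F}
  {P : Measure Ω} [IsProbabilityMeasure P] {pref : Act Ω → Act Ω → Prop}

omit [IsProbabilityMeasure P] in
/-- On an atomless space every event can be halved indefinitely. -/
lemma IsAtomlessOn.exists_halving (hP : IsAtomlessOn G P) {A : Set Ω} (hA : MeasurableSet[G] A) :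
    ∃ D : ℕ → Set Ω, (∀ n, MeasurableSet[G] (D n)) ∧ (∀ n, D n ⊆ A) ∧ (∀ n, D (n + 1) ⊆ D n) ∧
      ∀ n, P.real (D n) = P.real A / 2 ^ n := by
  have step : ∀ B : {B : Set Ω // MeasurableSet[G] B},
      ∃ C : {B : Set Ω // MeasurableSet[G] B}, C.1 ⊆ B.1 ∧ P.real C.1 = P.real B.1 / 2 := by
    rintro ⟨B, hB⟩
    have h0 : 0 ≤ P.real B := measureReal_nonneg
    have : P.real B / 2 ∈ Set.Icc 0 (P.real B) := ⟨by positivity, by linarith⟩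
    rw [← hP B hB] at this
    obtain ⟨C, hC, hCB, hPC⟩ := this
    exact ⟨⟨C, hC⟩, hCB, hPC⟩
  choose s hs1 hs2 using step
  have hsucc : ∀ n, (s^[n + 1] ⟨A, hA⟩).1 ⊆ (s^[n] ⟨A, hA⟩).1 := fun n => by
    rw [Function.iterate_succ_apply']
    exact hs1 _
  refine ⟨fun n => (s^[n] ⟨A, hA⟩).1, fun n => (s^[n] ⟨A, hA⟩).2, fun n => ?_, hsucc, fun n => ?_⟩
  · exact antitone_nat_of_succ_le (f := fun n => (s^[n] ⟨A, hA⟩).1) hsucc (Nat.zero_le n)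
  · induction n with
    | zero => simp
    | succ n ih =>
      simp only [Function.iterate_succ_apply', hs2] at ih ⊢
      rw [ih, pow_succ, div_div]

lemma IsAtomlessOn.exists_measure_eq (hP : IsAtomlessOn G P) {p : ℝ} (hp : p ∈ Set.Icc (0 : ℝ) 1) :
    ∃ R, MeasurableSet[G] R ∧ P.real R = p := by
  have h1 := hP Set.univ MeasurableSet.univ
  rw [probReal_univ] at h1
  rw [← h1] at hp
  obtain ⟨R, hR, -, hPR⟩ := hp
  exact ⟨R, hR, hPR⟩

lemma tendsto_div_two_pow (c : ℝ) : Tendsto (fun n : ℕ => c / 2 ^ n) atTop (𝓝 0) := by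
  have := (tendsto_pow_atTop_nhds_zero_of_lt_one (r := (1 / 2 : ℝ)) (by norm_num)
    (by norm_num)).const_mul c
  simpa [div_eq_mul_inv] using this

/-- A monotone, continuous set function on an atomless space which depends on the probability of an
event only is a continuous increasing function of this probability. -/
lemma IsAtomlessOn.exists_distortion (hG : G ≤ F) (hP : IsAtomlessOn G P) {Φ : Set Ω → ℝ}
    (hc : @IsContinuousSetFun Ω G Φ)
    (hmono : ∀ A B, MeasurableSet[G] A → MeasurableSet[G] B → A ⊆ B → Φ A ≤ Φ B)
    (hlaw : ∀ A B, MeasurableSet[G] A → MeasurableSet[G] B → P.real A = P.real B → Φ A = Φ B) :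
    ∃ γ : ℝ → ℝ, (∀ A, MeasurableSet[G] A → Φ A = γ (P.real A)) ∧
      MonotoneOn γ (Set.Icc 0 1) ∧ ContinuousOn γ (Set.Icc 0 1) := by
  have hex : ∀ p, ∃ R, p ∈ Set.Icc (0 : ℝ) 1 → MeasurableSet[G] R ∧ P.real R = p := fun p => by
    by_cases hp : p ∈ Set.Icc (0 : ℝ) 1
    · obtain ⟨R, hR⟩ := hP.exists_measure_eq hp
      exact ⟨R, fun _ => hR⟩
    · exact ⟨∅, fun h => absurd h hp⟩
  choose R hR using hex
  have hγ : ∀ A, MeasurableSet[G] A → Φ A = Φ (R (P.real A)) := fun A hA => by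
    obtain ⟨h1, h2⟩ := hR (P.real A) ⟨measureReal_nonneg, measureReal_le_one⟩
    exact hlaw _ _ hA h1 h2.symm
  have hγmono : MonotoneOn (fun p => Φ (R p)) (Set.Icc 0 1) := fun p hp q hq hpq => by
    obtain ⟨hq1, hq2⟩ := hR q hq
    have hmem : p ∈ Set.Icc 0 (P.real (R q)) := ⟨hp.1, hq2.symm ▸ hpq⟩
    rw [← hP _ hq1] at hmem
    obtain ⟨B, hB, hBR, rfl⟩ := hmem
    simp only
    rw [← hγ B hB]
    exact hmono _ _ hB hq1 hBR
  refine ⟨fun p => Φ (R p), hγ, hγmono, fun p hp => ?_⟩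
  have hRp : MeasurableSet[G] (R p) := (hR p hp).1
  have hPR := (hR p hp).2
  -- Continuity of `Φ` speaks only of nested events. Removing from `R p` a subset halved repeatedly
  -- gives risky events increasing to one of probability `p`; adding such a subset of the complement
  -- handles the other side. The geometric steps stay in `[0, 1]`, and one sequence on each side
  -- suffices because the function is monotone.
  have hleft : Tendsto (fun n : ℕ => Φ (R (p - p / 2 ^ n))) atTop (𝓝 (Φ (R p))) := by
    obtain ⟨D, hD, hDR, hDs, hPD⟩ := hP.exists_halving hRp
    have hA : ∀ n, MeasurableSet[G] (R p \ D n) := fun n =>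
      @MeasurableSet.diff Ω G _ _ hRp (hD n)
    have hA1 : ∀ n, R p \ D n ⊆ R p \ D (n + 1) := fun n => Set.sdiff_subset_sdiff_right (hDs n)
    have hPA : ∀ n, P.real (R p \ D n) = p - p / 2 ^ n := fun n => by
      rw [measureReal_sdiff (hDR n) (hG _ (hD n)), hPD, hPR]
    have h1 := @IsContinuousSetFun.upward Ω G Φ hc _ hA hA1
    have h2 : Tendsto (fun n => P.real (R p \ D n)) atTop (𝓝 (P.real (⋃ n, R p \ D n))) :=
      (ENNReal.tendsto_toReal (measure_ne_top _ _)).comp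
        (tendsto_measure_iUnion_atTop (monotone_nat_of_le_succ hA1))
    have h3 : P.real (⋃ n, R p \ D n) = p := by
      refine tendsto_nhds_unique h2 ?_
      simp only [hPA]
      simpa using (tendsto_div_two_pow p).const_sub p
    rw [hγ _ (@MeasurableSet.iUnion Ω ℕ G _ _ hA), h3] at h1
    refine h1.congr fun n => ?_
    rw [hγ _ (hA n), hPA]
  have hright : Tendsto (fun n : ℕ => Φ (R (p + (1 - p) / 2 ^ n))) atTop (𝓝 (Φ (R p))) := by
    obtain ⟨D, hD, hDR, hDs, hPD⟩ := hP.exists_halving (@MeasurableSet.compl Ω _ G hRp)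
    have hA : ∀ n, MeasurableSet[G] (R p ∪ D n) := fun n =>
      @MeasurableSet.union Ω G _ _ hRp (hD n)
    have hA1 : ∀ n, R p ∪ D (n + 1) ⊆ R p ∪ D n := fun n => Set.union_subset_union_right _ (hDs n)
    have hPA : ∀ n, P.real (R p ∪ D n) = p + (1 - p) / 2 ^ n := fun n => by
      rw [measureReal_union (Set.disjoint_left.2 fun ω h1 h2 => hDR n h2 h1) (hG _ (hD n)), hPD,
        probReal_compl_eq_one_sub (hG _ hRp), hPR]
    have h1 := @IsContinuousSetFun.downward Ω G Φ hc _ hA hA1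
    have h2 : Tendsto (fun n => P.real (R p ∪ D n)) atTop (𝓝 (P.real (⋂ n, R p ∪ D n))) :=
      (ENNReal.tendsto_toReal (measure_ne_top _ _)).comp
        (tendsto_measure_iInter_atTop (fun n => (hG _ (hA n)).nullMeasurableSet)
          (antitone_nat_of_succ_le hA1) ⟨0, measure_ne_top _ _⟩)
    have h3 : P.real (⋂ n, R p ∪ D n) = p := by
      refine tendsto_nhds_unique h2 ?_
      simp only [hPA]
      simpa using (tendsto_div_two_pow (1 - p)).const_add p
    rw [hγ _ (@MeasurableSet.iInter Ω ℕ G _ _ hA), h3] at h1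
    refine h1.congr fun n => ?_
    rw [hγ _ (hA n), hPA]
  have hpow : ∀ n : ℕ, (1 : ℝ) ≤ 2 ^ n := fun n => one_le_pow₀ (by norm_num)
  refine tendsto_order.2 ⟨fun c hcp => ?_, fun c hcp => ?_⟩
  · obtain ⟨n, hn⟩ := (hleft.eventually_const_lt hcp).exists
    have hdiv : p / 2 ^ n ≤ p := div_le_self hp.1 (hpow n)
    have hdiv0 : 0 ≤ p / 2 ^ n := div_nonneg hp.1 (by positivity)
    rcases hp.1.eq_or_lt with h0 | h0
    · filter_upwards [self_mem_nhdsWithin] with q hq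
      exact lt_of_lt_of_le hcp (hγmono hp hq (h0 ▸ hq.1))
    · have hlt : p - p / 2 ^ n < p := by
        have : 0 < p / 2 ^ n := by positivity
        linarith
      filter_upwards [self_mem_nhdsWithin, mem_nhdsWithin_of_mem_nhds (eventually_gt_nhds hlt)]
        with q hq hq'
      exact lt_of_lt_of_le hn (hγmono ⟨by linarith, by linarith [hp.2]⟩ hq (le_of_lt hq'))
  · obtain ⟨n, hn⟩ := (hright.eventually_lt_const hcp).exists
    have h1p : 0 ≤ 1 - p := sub_nonneg.2 hp.2
    have hdiv : (1 - p) / 2 ^ n ≤ 1 - p := div_le_self h1p (hpow n)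
    have hdiv0 : 0 ≤ (1 - p) / 2 ^ n := div_nonneg h1p (by positivity)
    rcases hp.2.eq_or_lt with h0 | h0
    · filter_upwards [self_mem_nhdsWithin] with q hq
      exact lt_of_le_of_lt (hγmono hq hp (h0 ▸ hq.2)) hcp
    · have hlt : p < p + (1 - p) / 2 ^ n := by
        have : 0 < (1 - p) / 2 ^ n := div_pos (by linarith) (by positivity)
        linarith
      filter_upwards [self_mem_nhdsWithin, mem_nhdsWithin_of_mem_nhds (eventually_lt_nhds hlt)]
        with q hq hq'
      exact lt_of_le_of_lt (hγmono hq ⟨by linarith [hp.1], by linarith⟩ (le_of_lt hq')) hn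

/-- The preferences satisfying the axioms under which certainty equivalents and subjective mixtures
are well defined. -/
structure IsRegularPreference {Ω : Type*} (G : MeasurableSpace Ω) [F : MeasurableSpace Ω]
    (P : Measure Ω) (pref : Act Ω → Act Ω → Prop) : Prop where
  atomless : IsAtomlessOn G P
  preference : IsPreference pref
  riskConformity : RiskConformity G P pref
  monotonicity : Monotonicity pref
  strictRiskMonotonicity : StrictRiskMonotonicity G P pref
  continuity : ContinuityAxiom pref

/-- Convergent real sequences are bounded, so B-closedness applies to the corresponding constant
acts. -/
lemma isClosed_setOf_constAct {S : Set (Act Ω)} (hS : BClosed S) :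
    IsClosed {c : ℝ | constAct Ω c ∈ S} := by
  refine IsSeqClosed.isClosed fun c c₀ hc hlim => ?_
  obtain ⟨M, hM⟩ := (Metric.isBounded_range_of_tendsto c hlim).exists_norm_le
  exact hS (fun n => constAct Ω (c n)) (constAct Ω c₀) hc
    ⟨M, fun n _ => hM _ (Set.mem_range_self n)⟩ fun _ => hlim

lemma binAct_apply_mem {x y : ℝ} {A : Set Ω} {hA : MeasurableSet A} {ω : Ω} (hω : ω ∈ A) :
    binAct x A hA y ω = x := if_pos hω

lemma binAct_apply_notMem {x y : ℝ} {A : Set Ω} {hA : MeasurableSet A} {ω : Ω} (hω : ω ∉ A) :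
    binAct x A hA y ω = y := if_neg hω

lemma measurable_binAct (hG : G ≤ F) (x y : ℝ) {A : Set Ω} (hA : MeasurableSet[G] A) :
    Measurable[G] (binAct x A (hG A hA) y) := by
  classical
  exact @Measurable.ite Ω ℝ _ _ G _ _ _ hA measurable_const measurable_const

lemma binAct_self (x : ℝ) {A : Set Ω} (hA : MeasurableSet A) : binAct x A hA x = constAct Ω x := by
  refine Subtype.ext (funext fun ω => ?_)
  by_cases hω : ω ∈ A
  · exact binAct_apply_mem hω
  · exact binAct_apply_notMem hω

lemma geSD_binAct (hG : G ≤ F) (x y : ℝ) {A B : Set Ω} (hA : MeasurableSet[G] A)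
    (hB : MeasurableSet[G] B) (h : P.real A = P.real B) :
    GeSD P (binAct x A (hG A hA) y) (binAct x B (hG B hB) y) := by
  have hAB : P A = P B := (measureReal_eq_measureReal_iff).1 h
  have hc : P Aᶜ = P Bᶜ := by
    rw [prob_compl_eq_one_sub (hG A hA), prob_compl_eq_one_sub (hG B hB), hAB]
  have key : ∀ (A : Set Ω) (hA : MeasurableSet A) (t : ℝ), {ω | t < binAct x A hA y ω} =
      if t < x then (if t < y then Set.univ else A) else (if t < y then Aᶜ else ∅) := by
    intro A hA t
    ext ω
    by_cases hω : ω ∈ A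
    · simp only [Set.mem_ofPred_eq, binAct_apply_mem hω]
      split_ifs <;> simp_all
    · simp only [Set.mem_ofPred_eq, binAct_apply_notMem hω]
      split_ifs <;> simp_all
  intro t
  rw [key, key]
  split_ifs
  · exact le_rfl
  · exact hAB.ge
  · exact hc.ge
  · exact le_rfl

namespace IsRegularPreference

lemma exists_coinFlip (h : IsRegularPreference G P pref) : ∃ R, IsCoinFlip G P R :=
  h.atomless.exists_measure_eq (by norm_num)

lemma pref_constAct_iff (h : IsRegularPreference G P pref) {c d : ℝ} :
    pref (constAct Ω c) (constAct Ω d) ↔ d ≤ c := by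
  refine ⟨fun hp => ?_, fun hp => h.monotonicity _ _ fun _ => hp⟩
  by_contra hlt
  rw [not_le] at hlt
  refine (h.strictRiskMonotonicity (constAct Ω d) (constAct Ω c) measurable_const measurable_const
    ⟨?_, fun hge => ?_⟩).2 hp
  · have : {ω : Ω | (constAct Ω c) ω ≤ (constAct Ω d) ω} = Set.univ :=
      Set.eq_univ_of_forall fun _ => hlt.le
    rw [GeAS, this, measure_univ]
  · have : {ω : Ω | (constAct Ω d) ω ≤ (constAct Ω c) ω} = ∅ :=
      Set.eq_empty_of_forall_notMem fun _ hω => absurd hlt (not_lt.2 hω)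
    rw [GeAS, this, measure_empty] at hge
    exact zero_ne_one hge

omit [IsProbabilityMeasure P] in
/-- Every act is indifferent to its certainty equivalent. -/
lemma indiff_certEq (h : IsRegularPreference G P pref) (X : Act Ω) :
    Indiff pref X (constAct Ω (certEq pref X)) := by
  refine Classical.epsilon_spec (p := fun c : ℝ => Indiff pref X (constAct Ω c)) ?_
  obtain ⟨M, hM0, hM⟩ := X.2.exists_bound
  have h1 := isClosed_setOf_constAct (h.continuity X).1
  have h2 := isClosed_setOf_constAct (h.continuity X).2
  -- The constants weakly below `X` and those weakly above it form two closed sets covering `[-M,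
  -- M]`, both nonempty there by monotonicity; connectedness makes them meet.
  have hconn := (isPreconnected_Icc (a := -M) (b := M))
  rw [isPreconnected_closed_iff] at hconn
  obtain ⟨c, -, hc⟩ := hconn _ _ h1 h2 (fun c _ => h.preference.total X (constAct Ω c))
    ⟨-M, ⟨le_rfl, by linarith⟩, h.monotonicity X (constAct Ω (-M)) fun ω => (abs_le.1 (hM ω)).1⟩
    ⟨M, ⟨by linarith, le_rfl⟩, h.monotonicity (constAct Ω M) X fun ω => (abs_le.1 (hM ω)).2⟩
  exact ⟨c, hc⟩

lemma pref_iff (h : IsRegularPreference G P pref) {X Y : Act Ω} :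
    pref X Y ↔ certEq pref Y ≤ certEq pref X := by
  have hX := h.indiff_certEq X
  have hY := h.indiff_certEq Y
  rw [← h.pref_constAct_iff]
  exact ⟨fun hp => h.preference.trans _ _ _ hX.2 (h.preference.trans _ _ _ hp hY.1),
    fun hp => h.preference.trans _ _ _ hX.1 (h.preference.trans _ _ _ hp hY.2)⟩

lemma indiff_iff (h : IsRegularPreference G P pref) {X Y : Act Ω} :
    Indiff pref X Y ↔ certEq pref X = certEq pref Y := by
  rw [Indiff, h.pref_iff, h.pref_iff, le_antisymm_iff, and_comm]

lemma certEq_constAct (h : IsRegularPreference G P pref) (c : ℝ) :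
    certEq pref (constAct Ω c) = c := by
  have := h.indiff_certEq (constAct Ω c)
  exact le_antisymm (h.pref_constAct_iff.1 this.1) (h.pref_constAct_iff.1 this.2)

lemma certEq_mono (h : IsRegularPreference G P pref) {X Y : Act Ω} (hle : ∀ ω, X ω ≤ Y ω) :
    certEq pref X ≤ certEq pref Y :=
  h.pref_iff.1 (h.monotonicity Y X hle)

lemma certEq_mem_Icc (h : IsRegularPreference G P pref) {X : Act Ω} {a b : ℝ}
    (hX : ∀ ω, X ω ∈ Set.Icc a b) : certEq pref X ∈ Set.Icc a b := by
  constructor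
  · rw [← h.certEq_constAct a]
    exact h.certEq_mono fun ω => (hX ω).1
  · rw [← h.certEq_constAct b]
    exact h.certEq_mono fun ω => (hX ω).2

/-- Certainty equivalents are continuous along bounded pointwise convergent sequences. -/
lemma tendsto_certEq (h : IsRegularPreference G P pref) {X : ℕ → Act Ω} {Y : Act Ω} {M : ℝ}
    (hM : ∀ n ω, |X n ω| ≤ M) (hlim : ∀ ω, Tendsto (fun n => X n ω) atTop (𝓝 (Y ω))) :
    Tendsto (fun n => certEq pref (X n)) atTop (𝓝 (certEq pref Y)) := by
  -- If the certainty equivalents did not stay eventually above some `c` below the limiting one, a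
  -- subsequence would lie in the B-closed set of acts weakly worse than `c`, and so would the
  -- limit. The upper bound is symmetric.
  refine tendsto_order.2 ⟨fun c hc => ?_, fun c hc => ?_⟩
  · by_contra hcon
    rw [not_eventually] at hcon
    obtain ⟨φ, hφ, hlow⟩ := extraction_of_frequently_atTop hcon
    have := (h.continuity (constAct Ω c)).1 (fun n => X (φ n)) Y (fun n => by
      change pref _ _
      rw [h.pref_iff, h.certEq_constAct]
      exact not_lt.1 (hlow n)) ⟨M, fun n => hM (φ n)⟩ fun ω => (hlim ω).comp hφ.tendsto_atTop
    change pref _ _ at this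
    rw [h.pref_iff, h.certEq_constAct] at this
    exact absurd hc (not_lt.2 this)
  · by_contra hcon
    rw [not_eventually] at hcon
    obtain ⟨φ, hφ, hlow⟩ := extraction_of_frequently_atTop hcon
    have := (h.continuity (constAct Ω c)).2 (fun n => X (φ n)) Y (fun n => by
      change pref _ _
      rw [h.pref_iff, h.certEq_constAct]
      exact not_lt.1 (hlow n)) ⟨M, fun n => hM (φ n)⟩ fun ω => (hlim ω).comp hφ.tendsto_atTop
    change pref _ _ at this
    rw [h.pref_iff, h.certEq_constAct] at this
    exact absurd hc (not_lt.2 this)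

lemma certEq_binAct_congr (h : IsRegularPreference G P pref) (hG : G ≤ F) (x y : ℝ) {A B : Set Ω}
    (hA : MeasurableSet[G] A) (hB : MeasurableSet[G] B) (hAB : P.real A = P.real B) :
    certEq pref (binAct x A (hG A hA) y) = certEq pref (binAct x B (hG B hB) y) :=
  h.indiff_iff.1 (h.riskConformity _ _ (measurable_binAct hG x y hA) (measurable_binAct hG x y hB)
    ⟨geSD_binAct hG x y hA hB hAB, geSD_binAct hG x y hB hA hAB.symm⟩)

/-- If the reverse inequality also held almost surely, the event on which the outcome strictly
improves would be null, contrary to the assumed bound on its probability. -/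
lemma certEq_binAct_lt (h : IsRegularPreference G P pref) (hG : G ≤ F) {x x' y y' : ℝ} {A : Set Ω}
    (hA : MeasurableSet[G] A) (hx : x ≤ x') (hy : y ≤ y')
    (hlt : (x < x' ∧ 0 < P.real A) ∨ (y < y' ∧ P.real A < 1)) :
    certEq pref (binAct x A (hG A hA) y) < certEq pref (binAct x' A (hG A hA) y') := by
  have hle : ∀ ω, binAct x A (hG A hA) y ω ≤ binAct x' A (hG A hA) y' ω := fun ω => by
    by_cases hω : ω ∈ A
    · simpa only [binAct_apply_mem hω] using hx
    · simpa only [binAct_apply_notMem hω] using hy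
  have hs := h.strictRiskMonotonicity (binAct x' A (hG A hA) y') (binAct x A (hG A hA) y)
    (measurable_binAct hG x' y' hA) (measurable_binAct hG x y hA) ⟨?_, fun hge => ?_⟩
  · exact not_le.1 fun hle => hs.2 (h.pref_iff.2 hle)
  · rw [GeAS, Set.eq_univ_of_forall (s := {ω | _ ≤ _}) hle, measure_univ]
  · rw [GeAS] at hge
    rcases hlt with ⟨hlt, hpos⟩ | ⟨hlt, hpos⟩
    · have hsub : {ω | binAct x' A (hG A hA) y' ω ≤ binAct x A (hG A hA) y ω} ⊆ Aᶜ :=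
        fun ω hω hωA => by
          simp only [Set.mem_ofPred_eq, binAct_apply_mem hωA] at hω
          exact absurd hlt (not_lt.2 hω)
      have h1 : P Aᶜ = 1 := le_antisymm prob_le_one (hge ▸ measure_mono hsub)
      rw [prob_compl_eq_one_iff (hG A hA)] at h1
      rw [measureReal_def, h1] at hpos
      simp at hpos
    · have hsub : {ω | binAct x' A (hG A hA) y' ω ≤ binAct x A (hG A hA) y ω} ⊆ A :=
        fun ω hω => by
          by_contra hωA
          simp only [Set.mem_ofPred_eq, binAct_apply_notMem hωA] at hω
          exact absurd hlt (not_lt.2 hω)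
      have h1 : P A = 1 := le_antisymm prob_le_one (hge ▸ measure_mono hsub)
      rw [measureReal_def, h1] at hpos
      simp at hpos

/-- The certainty equivalents of the bets `xA` versus `y` on the events of an increasing or
decreasing sequence converge. -/
lemma tendsto_certEq_binAct (h : IsRegularPreference G P pref) (x y : ℝ) {A : ℕ → Set Ω}
    {B : Set Ω} (hA : ∀ n, MeasurableSet (A n)) (hB : MeasurableSet B)
    (hlim : ∀ ω, ∀ᶠ n in atTop, (ω ∈ A n ↔ ω ∈ B)) :
    Tendsto (fun n => certEq pref (binAct x (A n) (hA n) y)) atTop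
      (𝓝 (certEq pref (binAct x B hB y))) := by
  refine h.tendsto_certEq (M := max |x| |y|) (fun n ω => ?_) fun ω => ?_
  · by_cases hω : ω ∈ A n
    · rw [binAct_apply_mem hω]; exact le_max_left _ _
    · rw [binAct_apply_notMem hω]; exact le_max_right _ _
  · refine tendsto_const_nhds.congr' ?_
    filter_upwards [hlim ω] with n hn
    by_cases hω : ω ∈ B
    · rw [binAct_apply_mem hω, binAct_apply_mem (hn.2 hω)]
    · rw [binAct_apply_notMem hω, binAct_apply_notMem fun h' => hω (hn.1 h')]

open Classical in
/-- The certainty equivalent of `xAy` as a set function of `A`. -/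
noncomputable def betValue (pref : Act Ω → Act Ω → Prop) (x y : ℝ) (A : Set Ω) : ℝ :=
  if hA : MeasurableSet A then certEq pref (binAct x A hA y) else 0

omit [IsProbabilityMeasure P] in
lemma betValue_eq (x y : ℝ) {A : Set Ω} (hA : MeasurableSet A) :
    betValue pref x y A = certEq pref (binAct x A hA y) := dif_pos hA

lemma betValue_mono (h : IsRegularPreference G P pref) {x y : ℝ} (hxy : y ≤ x) {A B : Set Ω}
    (hA : MeasurableSet A) (hB : MeasurableSet B) (hAB : A ⊆ B) :
    betValue pref x y A ≤ betValue pref x y B := by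
  rw [betValue_eq x y hA, betValue_eq x y hB]
  refine h.certEq_mono fun ω => ?_
  by_cases hω : ω ∈ A
  · rw [binAct_apply_mem hω, binAct_apply_mem (hAB hω)]
  · rw [binAct_apply_notMem hω]
    by_cases hω' : ω ∈ B
    · rwa [binAct_apply_mem hω']
    · rw [binAct_apply_notMem hω']

lemma betValue_continuous (h : IsRegularPreference G P pref) (x y : ℝ) :
    IsContinuousSetFun (betValue pref x y) := by
  constructor
  · intro A hA hmono
    simp only [fun n => betValue_eq (pref := pref) x y (hA n),
      betValue_eq (pref := pref) x y (MeasurableSet.iUnion hA)]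
    refine h.tendsto_certEq_binAct x y hA _ fun ω => ?_
    have hm := monotone_nat_of_le_succ hmono
    by_cases hω : ω ∈ ⋃ n, A n
    · obtain ⟨k, hk⟩ := Set.mem_iUnion.1 hω
      filter_upwards [eventually_ge_atTop k] with n hn
      exact ⟨fun _ => hω, fun _ => hm hn hk⟩
    · exact Eventually.of_forall fun n =>
        ⟨fun h' => Set.mem_iUnion.2 ⟨n, h'⟩, fun h' => absurd h' hω⟩
  · intro A hA hanti
    simp only [fun n => betValue_eq (pref := pref) x y (hA n),
      betValue_eq (pref := pref) x y (MeasurableSet.iInter hA)]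
    refine h.tendsto_certEq_binAct x y hA _ fun ω => ?_
    have hm := antitone_nat_of_succ_le hanti
    by_cases hω : ω ∈ ⋂ n, A n
    · exact Eventually.of_forall fun n => ⟨fun _ => hω, fun h' => Set.mem_iInter.1 h' n⟩
    · have : ∃ k, ω ∉ A k := by simpa using hω
      obtain ⟨k, hk⟩ := this
      filter_upwards [eventually_ge_atTop k] with n hn
      exact ⟨fun h' => absurd (hm hn h') hk, fun h' => absurd h' hω⟩

lemma betValue_univ (h : IsRegularPreference G P pref) (x y : ℝ) :
    betValue pref x y Set.univ = x := by
  rw [betValue_eq x y MeasurableSet.univ]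
  refine Eq.trans (congrArg _ ?_) (h.certEq_constAct x)
  exact Subtype.ext (funext fun ω => binAct_apply_mem (Set.mem_univ ω))

lemma betValue_empty (h : IsRegularPreference G P pref) (x y : ℝ) :
    betValue pref x y ∅ = y := by
  rw [betValue_eq x y MeasurableSet.empty]
  refine Eq.trans (congrArg _ ?_) (h.certEq_constAct y)
  exact Subtype.ext (funext fun ω => binAct_apply_notMem (Set.notMem_empty ω))

omit [IsProbabilityMeasure P] in
lemma _root_.CRDU.IsContinuousSetFun.trim (hG : G ≤ F) {Φ : Set Ω → ℝ}
    (hΦ : IsContinuousSetFun Φ) : @IsContinuousSetFun Ω G Φ :=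
  @IsContinuousSetFun.mk Ω G Φ (fun A hA => hΦ.upward A fun n => hG _ (hA n))
    fun A hA => hΦ.downward A fun n => hG _ (hA n)

/-- The value of a bet on a risky event is a continuous function of the probability. -/
lemma exists_betValue_eq (h : IsRegularPreference G P pref) (hG : G ≤ F) {x y : ℝ} (hxy : y ≤ x) :
    ∃ γ : ℝ → ℝ, (∀ A, MeasurableSet[G] A → betValue pref x y A = γ (P.real A)) ∧
      MonotoneOn γ (Set.Icc 0 1) ∧ ContinuousOn γ (Set.Icc 0 1) :=
  h.atomless.exists_distortion hG ((h.betValue_continuous x y).trim hG)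
    (fun A B hA hB => h.betValue_mono hxy (hG A hA) (hG B hB)) fun A B hA hB hAB => by
      rw [betValue_eq x y (hG A hA), betValue_eq x y (hG B hB)]
      exact h.certEq_binAct_congr hG x y hA hB hAB

/-- As the probability runs from 0 to 1, the value of the bet runs continuously from `y` to `x`, and
atomlessness realizes every probability. -/
lemma exists_certEq_binAct_eq (h : IsRegularPreference G P pref) (hG : G ≤ F) {x y t : ℝ}
    (hxy : y ≤ x) (ht : t ∈ Set.Icc y x) :
    ∃ (A : Set Ω) (hA : MeasurableSet[G] A), certEq pref (binAct x A (hG A hA) y) = t := by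
  obtain ⟨γ, hγ, -, hc⟩ := h.exists_betValue_eq hG hxy
  have h0 : γ 0 = y := by
    have := hγ ∅ (@MeasurableSet.empty _ G)
    rwa [h.betValue_empty, measureReal_empty, eq_comm] at this
  have h1 : γ 1 = x := by
    have := hγ Set.univ (@MeasurableSet.univ _ G)
    rwa [h.betValue_univ, probReal_univ, eq_comm] at this
  obtain ⟨p, hp, hpt⟩ := intermediate_value_Icc (zero_le_one' ℝ) hc (by rwa [h0, h1])
  obtain ⟨A, hA, rfl⟩ := h.atomless.exists_measure_eq hp
  exact ⟨A, hA, by rw [← betValue_eq x y (hG A hA), hγ A hA, hpt]⟩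

end IsRegularPreference

end Basic

/-! ### Coin-flip means and the equation defining the mixture. -/

section CoinMean

/-- The properties of the map sending `(x, y)` to the certainty equivalent of a coin flip between
`x` and `y`. -/
structure IsCoinMean (f : ℝ → ℝ → ℝ) : Prop where
  cont : Continuous fun p : ℝ × ℝ => f p.1 p.2
  left : ∀ y, StrictMono fun x => f x y
  right : ∀ x, StrictMono (f x)
  idem : ∀ x, f x x = x

namespace IsCoinMean

variable {f : ℝ → ℝ → ℝ}

/-- This makes the solution of the mixture equation unique. -/
lemma strictMono_comp (hf : IsCoinMean f) (x y : ℝ) :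
    StrictMono fun z => f (f x z) (f z y) := fun _ _ h =>
  (hf.left _ (hf.right x h)).trans (hf.right _ (hf.left y h))

lemma mono₂ (hf : IsCoinMean f) {x x' y y' : ℝ} (h : x ≤ x') (h' : y ≤ y') :
    f x y ≤ f x' y' :=
  ((hf.left y).monotone h).trans ((hf.right x').monotone h')

lemma le_left (hf : IsCoinMean f) {x y : ℝ} (h : y ≤ x) : f x y ≤ x :=
  (hf.mono₂ le_rfl h).trans_eq (hf.idem x)

lemma right_le (hf : IsCoinMean f) {x y : ℝ} (h : y ≤ x) : y ≤ f x y :=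
  (hf.idem y).symm.trans_le (hf.mono₂ h le_rfl)

lemma continuous_comp (hf : IsCoinMean f) :
    Continuous fun q : ℝ × ℝ × ℝ => f (f q.1 q.2.2) (f q.2.2 q.2.1) := by
  have h1 : Continuous fun q : ℝ × ℝ × ℝ => f q.1 q.2.2 :=
    hf.cont.comp (continuous_fst.prodMk (continuous_snd.comp continuous_snd))
  have h2 : Continuous fun q : ℝ × ℝ × ℝ => f q.2.2 q.2.1 :=
    hf.cont.comp ((continuous_snd.comp continuous_snd).prodMk (continuous_fst.comp continuous_snd))
  exact hf.cont.comp (h1.prodMk h2)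

/-- At `z = y` the left side is `f (f x y) y ≤ f x y`; at `z = x` it is `f x (f x y) ≥ f x y`. -/
lemma exists_mix (hf : IsCoinMean f) {x y : ℝ} (h : y ≤ x) :
    ∃ z ∈ Set.Icc y x, f (f x z) (f z y) = f x y := by
  have hc : Continuous fun z => f (f x z) (f z y) :=
    hf.continuous_comp.comp
      (continuous_const.prodMk (continuous_const.prodMk continuous_id))
  refine intermediate_value_Icc h hc.continuousOn ⟨?_, ?_⟩
  · simp only [hf.idem]
    exact hf.mono₂ (hf.le_left h) le_rfl
  · simp only [hf.idem]
    exact hf.mono₂ le_rfl (hf.right_le h)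

/-- The solution of the equation defining the subjective mixture depends continuously on the
outcomes. -/
lemma continuous_mix (hf : IsCoinMean f) {m : ℝ → ℝ → ℝ}
    (hm : ∀ x y, f (f (max x y) (m x y)) (f (m x y) (min x y)) = f (max x y) (min x y)) :
    Continuous fun p : ℝ × ℝ => m p.1 p.2 := by
  have hrhs : Continuous fun p : ℝ × ℝ => f (max p.1 p.2) (min p.1 p.2) :=
    hf.cont.comp ((continuous_fst.max continuous_snd).prodMk (continuous_fst.min continuous_snd))
  have hlhs : ∀ c, Continuous fun p : ℝ × ℝ => f (f (max p.1 p.2) c) (f c (min p.1 p.2)) :=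
    fun c => hf.continuous_comp.comp ((continuous_fst.max continuous_snd).prodMk
      ((continuous_fst.min continuous_snd).prodMk continuous_const))
  rw [continuous_iff_continuousAt]
  intro p
  -- For fixed `c`, lying above or below `c` is equivalent to a strict inequality between continuous
  -- functions of the outcomes, hence an open condition.
  have hlt : ∀ q : ℝ × ℝ, ∀ c, c < m q.1 q.2 ↔
      f (f (max q.1 q.2) c) (f c (min q.1 q.2)) < f (max q.1 q.2) (min q.1 q.2) := fun q c => by
    rw [← hm]
    exact (hf.strictMono_comp _ _).lt_iff_lt.symm
  have hgt : ∀ q : ℝ × ℝ, ∀ c, m q.1 q.2 < c ↔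
      f (max q.1 q.2) (min q.1 q.2) < f (f (max q.1 q.2) c) (f c (min q.1 q.2)) := fun q c => by
    rw [← hm q.1 q.2]
    exact (hf.strictMono_comp _ _).lt_iff_lt.symm
  refine tendsto_order.2 ⟨fun c hc => ?_, fun c hc => ?_⟩
  · simp only [hlt] at hc ⊢
    exact ((hlhs c).continuousAt.eventually_lt hrhs.continuousAt hc)
  · simp only [hgt] at hc ⊢
    exact (hrhs.continuousAt.eventually_lt (hlhs c).continuousAt hc)

end IsCoinMean

end CoinMean

/-! ### The subjective mixture as a bisymmetric mean. -/

section Mixture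

variable {Ω : Type*} {G : MeasurableSpace Ω} [F : MeasurableSpace Ω] {hG : G ≤ F}
  {P : Measure Ω} [IsProbabilityMeasure P] {pref : Act Ω → Act Ω → Prop}

namespace IsRegularPreference

lemma isCoinMean (h : IsRegularPreference G P pref) (hG : G ≤ F) {R : Set Ω}
    (hR : IsCoinFlip G P R) :
    IsCoinMean fun x y => certEq pref (binAct x R (hG R hR.1) y) where
  cont := by
    refine continuous_iff_seqContinuous.2 fun p p₀ hp => ?_
    obtain ⟨M, hM⟩ := (Metric.isBounded_range_of_tendsto p hp).exists_norm_le
    have h1 : Tendsto (fun n => (p n).1) atTop (𝓝 p₀.1) := (continuous_fst.tendsto p₀).comp hp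
    have h2 : Tendsto (fun n => (p n).2) atTop (𝓝 p₀.2) := (continuous_snd.tendsto p₀).comp hp
    refine h.tendsto_certEq (M := M) (fun n ω => ?_) fun ω => ?_
    · have := hM _ (Set.mem_range_self n)
      by_cases hω : ω ∈ R
      · rw [binAct_apply_mem hω]
        exact (norm_fst_le (p n)).trans this
      · rw [binAct_apply_notMem hω]
        exact (norm_snd_le (p n)).trans this
    · by_cases hω : ω ∈ R
      · simp only [binAct_apply_mem hω]
        exact h1
      · simp only [binAct_apply_notMem hω]
        exact h2
  left y x x' hx := h.certEq_binAct_lt hG hR.1 hx.le le_rfl (Or.inl ⟨hx, by rw [hR.2]; norm_num⟩)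
  right x y y' hy := h.certEq_binAct_lt hG hR.1 le_rfl hy.le (Or.inr ⟨hy, by rw [hR.2]; norm_num⟩)
  idem x := by rw [binAct_self, h.certEq_constAct]

/-- By (RC) the certainty equivalents of coin flips are the same for all coin-flip events, so a
solution for one event solves the equation for all. -/
lemma outcomeMix_spec (h : IsRegularPreference G P pref) (hG : G ≤ F) (x y : ℝ) :
    outcomeMix G hG P pref x y ∈ Set.Icc (min x y) (max x y) ∧
    ∀ (R : Set Ω) (hR : IsCoinFlip G P R),
      Indiff pref (binAct (max x y) R (hG R hR.1) (min x y))
        (binAct (certEq pref (binAct (max x y) R (hG R hR.1) (outcomeMix G hG P pref x y))) R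
          (hG R hR.1)
          (certEq pref (binAct (outcomeMix G hG P pref x y) R (hG R hR.1) (min x y)))) := by
  refine Classical.epsilon_spec (p := fun z : ℝ => z ∈ Set.Icc (min x y) (max x y) ∧
    ∀ (R : Set Ω) (hR : IsCoinFlip G P R),
      Indiff pref (binAct (max x y) R (hG R hR.1) (min x y))
        (binAct (certEq pref (binAct (max x y) R (hG R hR.1) z)) R (hG R hR.1)
          (certEq pref (binAct z R (hG R hR.1) (min x y))))) ?_
  obtain ⟨R₀, hR₀⟩ := h.exists_coinFlip
  obtain ⟨z, hz, he⟩ := (h.isCoinMean hG hR₀).exists_mix (min_le_max (a := x) (b := y))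
  refine ⟨z, hz, fun R hR => ?_⟩
  have hc : ∀ s t, certEq pref (binAct s R (hG R hR.1) t) =
      certEq pref (binAct s R₀ (hG R₀ hR₀.1) t) := fun s t =>
    h.certEq_binAct_congr hG s t hR.1 hR₀.1 (hR.2.trans hR₀.2.symm)
  rw [h.indiff_iff]
  simp only [hc]
  exact he.symm

lemma outcomeMix_eq (h : IsRegularPreference G P pref) (hG : G ≤ F) {R : Set Ω}
    (hR : IsCoinFlip G P R) (x y : ℝ) :
    certEq pref (binAct
      (certEq pref (binAct (max x y) R (hG R hR.1) (outcomeMix G hG P pref x y))) R (hG R hR.1)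
      (certEq pref (binAct (outcomeMix G hG P pref x y) R (hG R hR.1) (min x y)))) =
    certEq pref (binAct (max x y) R (hG R hR.1) (min x y)) :=
  (h.indiff_iff.1 ((h.outcomeMix_spec hG x y).2 R hR)).symm

lemma continuous_outcomeMix (h : IsRegularPreference G P pref) (hG : G ≤ F) :
    Continuous fun p : ℝ × ℝ => outcomeMix G hG P pref p.1 p.2 := by
  obtain ⟨R, hR⟩ := h.exists_coinFlip
  exact (h.isCoinMean hG hR).continuous_mix (h.outcomeMix_eq hG hR)

omit [IsProbabilityMeasure P] in
lemma outcomeMix_comm (x y : ℝ) : outcomeMix G hG P pref x y = outcomeMix G hG P pref y x := by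
  simp only [outcomeMix, max_comm x y, min_comm x y]

lemma outcomeMix_self (h : IsRegularPreference G P pref) (hG : G ≤ F) (x : ℝ) :
    outcomeMix G hG P pref x x = x := by
  have := (h.outcomeMix_spec hG x x).1
  simpa using this

lemma isAct_mix (h : IsRegularPreference G P pref) (hG : G ≤ F) (X Y : Act Ω) :
    IsAct fun ω => outcomeMix G hG P pref (X ω) (Y ω) := by
  refine ⟨(h.continuous_outcomeMix hG).measurable.comp (X.2.1.prodMk Y.2.1), ?_⟩
  obtain ⟨M, hM0, hM⟩ := X.2.exists_bound
  obtain ⟨N, hN0, hN⟩ := Y.2.exists_bound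
  refine ⟨max M N, fun ω => ?_⟩
  have hmem := (h.outcomeMix_spec hG (X ω) (Y ω)).1
  refine (abs_le_max_abs_abs hmem.1 hmem.2).trans (max_le ?_ ?_)
  · rcases min_choice (X ω) (Y ω) with he | he <;> rw [he]
    · exact (hM ω).trans (le_max_left _ _)
    · exact (hN ω).trans (le_max_right _ _)
  · rcases max_choice (X ω) (Y ω) with he | he <;> rw [he]
    · exact (hM ω).trans (le_max_left _ _)
    · exact (hN ω).trans (le_max_right _ _)

lemma actMix_apply (h : IsRegularPreference G P pref) (hG : G ≤ F) (X Y : Act Ω) (ω : Ω) :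
    actMix G hG P pref X Y ω = outcomeMix G hG P pref (X ω) (Y ω) := by
  have e : actMix G hG P pref X Y = ⟨_, h.isAct_mix hG X Y⟩ := dif_pos (h.isAct_mix hG X Y)
  rw [e]

lemma actMix_comm (h : IsRegularPreference G P pref) (hG : G ≤ F) (X Y : Act Ω) :
    actMix G hG P pref X Y = actMix G hG P pref Y X :=
  Subtype.ext (funext fun ω => by
    rw [h.actMix_apply hG, h.actMix_apply hG, outcomeMix_comm])

lemma actMix_constAct (h : IsRegularPreference G P pref) (hG : G ≤ F) (x y : ℝ) :
    actMix G hG P pref (constAct Ω x) (constAct Ω y) =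
      constAct Ω (outcomeMix G hG P pref x y) :=
  Subtype.ext (funext fun ω => h.actMix_apply hG _ _ ω)

lemma actMix_binAct (h : IsRegularPreference G P pref) (hG : G ≤ F) (x y z w : ℝ) {A : Set Ω}
    (hA : MeasurableSet A) :
    actMix G hG P pref (binAct x A hA y) (binAct z A hA w) =
      binAct (outcomeMix G hG P pref x z) A hA (outcomeMix G hG P pref y w) :=
  Subtype.ext (funext fun ω => by
    rw [h.actMix_apply hG]
    by_cases hω : ω ∈ A
    · simp only [binAct_apply_mem hω]
    · simp only [binAct_apply_notMem hω])

omit [IsProbabilityMeasure P] in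
lemma comonotonic_constAct (X : Act Ω) (c : ℝ) : Comonotonic X (constAct Ω c) := fun ω ω' => by
  have : (constAct Ω c) ω - (constAct Ω c) ω' = 0 := sub_self c
  rw [this, mul_zero]

omit [IsProbabilityMeasure P] in
lemma _root_.CRDU.Comonotonic.symm {X Y : Act Ω} (h : Comonotonic X Y) : Comonotonic Y X :=
  fun ω ω' => by
    rw [mul_comm]
    exact h ω ω'

omit [IsProbabilityMeasure P] in
lemma comonotonic_binAct {x y z w : ℝ} (hxy : y ≤ x) (hzw : w ≤ z) {A : Set Ω}
    (hA : MeasurableSet A) : Comonotonic (binAct x A hA y) (binAct z A hA w) := fun ω ω' => by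
  by_cases hω : ω ∈ A <;> by_cases hω' : ω' ∈ A
  · simp only [binAct_apply_mem hω, binAct_apply_mem hω']
    simp
  · simp only [binAct_apply_mem hω, binAct_apply_notMem hω']
    exact mul_nonneg (sub_nonneg.2 hxy) (sub_nonneg.2 hzw)
  · simp only [binAct_apply_notMem hω, binAct_apply_mem hω']
    exact mul_nonneg_of_nonpos_of_nonpos (sub_nonpos.2 hxy) (sub_nonpos.2 hzw)
  · simp only [binAct_apply_notMem hω, binAct_apply_notMem hω']
    simp

/-- Under comonotonic independence, certainty equivalents commute with mixtures of comonotonic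
acts. -/
lemma certEq_actMix (h : IsRegularPreference G P pref)
    (hS : SubjectiveComonotonicIndependence G hG P pref) {X Z : Act Ω} (hXZ : Comonotonic X Z) :
    certEq pref (actMix G hG P pref X Z) =
      outcomeMix G hG P pref (certEq pref X) (certEq pref Z) := by
  -- Each act is replaced in turn by its certainty equivalent; constants are comonotonic with
  -- everything, so (SCI) applies both times.
  have h1 := h.indiff_iff.1 (hS X (constAct Ω (certEq pref X)) Z (comonotonic_constAct _ _) hXZ
    (comonotonic_constAct _ _).symm (h.indiff_certEq X))
  have h2 := h.indiff_iff.1 (hS Z (constAct Ω (certEq pref Z)) (constAct Ω (certEq pref X))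
    (comonotonic_constAct _ _) (comonotonic_constAct _ _) (comonotonic_constAct _ _)
    (h.indiff_certEq Z))
  rw [h1, h.actMix_comm hG, h2, h.actMix_constAct hG, h.certEq_constAct, outcomeMix_comm]

/-- With f the coin-flip mean, a mixture equal to `y` would mean f(f(x, y), y) = f(x, y), impossible
since f(x, y) < x. -/
lemma lt_outcomeMix (h : IsRegularPreference G P pref) (hG : G ≤ F) {x y : ℝ} (hxy : y < x) :
    y < outcomeMix G hG P pref x y := by
  obtain ⟨R, hR⟩ := h.exists_coinFlip
  have hf := h.isCoinMean hG hR
  have hmem := (h.outcomeMix_spec hG x y).1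
  have he := h.outcomeMix_eq hG hR x y
  rw [max_eq_left hxy.le, min_eq_right hxy.le] at hmem he
  refine lt_of_le_of_ne hmem.1 fun heq => ?_
  rw [← heq, binAct_self, h.certEq_constAct] at he
  have h1 := hf.right x hxy
  have h2 : certEq pref (binAct x R (hG R hR.1) x) = x := hf.idem x
  exact (hf.left y (lt_of_lt_of_eq h1 h2)).ne he

/-- Under comonotonic independence, mixing with a fixed outcome is injective. -/
lemma outcomeMix_injective (h : IsRegularPreference G P pref)
    (hS : SubjectiveComonotonicIndependence G hG P pref) (z : ℝ) :
    Function.Injective fun x => outcomeMix G hG P pref x z := by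
  -- Mixing with `z` carries a bet on `x` versus `w` worth `t` to a bet on the mixed outcomes worth
  -- the mixture of `t` with `z`.
  have key : ∀ x w, w ≤ x → ∀ t ∈ Set.Icc w x, ∃ (A : Set Ω) (hA : MeasurableSet[G] A),
      certEq pref (binAct x A (hG A hA) w) = t ∧
      certEq pref (binAct (outcomeMix G hG P pref x z) A (hG A hA) (outcomeMix G hG P pref w z)) =
        outcomeMix G hG P pref t z := fun x w hwx t ht => by
    obtain ⟨A, hA, he⟩ := h.exists_certEq_binAct_eq hG hwx ht
    refine ⟨A, hA, he, ?_⟩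
    have := h.certEq_actMix hS (comonotonic_constAct (binAct x A (hG A hA) w) z)
    rw [he, h.certEq_constAct, ← binAct_self z (hG A hA), h.actMix_binAct hG] at this
    exact this
  have hinj : ∀ x x', x' < x →
      outcomeMix G hG P pref x z ≠ outcomeMix G hG P pref x' z := fun x x' hlt he => by
    set t := outcomeMix G hG P pref x z with ht
    -- A coincidence propagates. Write `x'` as the value of a bet on `x` against a lower `w`, lost
    -- with positive probability. After mixing, the prize is `t` and the bet is worth `t`, so
    -- strictness forces the other outcome to be `t` too.
    have hbelow : ∀ w ≤ x', outcomeMix G hG P pref w z = t := fun w hw => by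
      rcases hw.eq_or_lt with rfl | hw
      · exact he.symm
      obtain ⟨A, hA, hA1, hA2⟩ := key x w (hw.le.trans hlt.le) x' ⟨hw.le, hlt.le⟩
      rw [← he, ← ht] at hA2
      have hPA : P.real A < 1 := by
        refine lt_of_le_of_ne measureReal_le_one fun h1 => ?_
        have := h.certEq_binAct_congr hG x w hA (@MeasurableSet.univ _ G)
          (h1.trans probReal_univ.symm)
        rw [hA1, ← betValue_eq, h.betValue_univ] at this
        exact hlt.ne this
      by_contra hne
      rcases lt_or_gt_of_ne hne with hl | hl
      · have := h.certEq_binAct_lt hG hA (le_refl t) hl.le (Or.inr ⟨hl, hPA⟩)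
        rw [hA2, binAct_self, h.certEq_constAct] at this
        exact lt_irrefl _ this
      · have := h.certEq_binAct_lt hG hA (le_refl t) hl.le (Or.inr ⟨hl, hPA⟩)
        rw [hA2, binAct_self, h.certEq_constAct] at this
        exact lt_irrefl _ this
    have habove : ∀ w ≥ x, outcomeMix G hG P pref w z = t := fun w hw => by
      rcases hw.eq_or_lt with rfl | hw
      · exact ht.symm
      obtain ⟨A, hA, hA1, hA2⟩ := key w x' (hlt.le.trans hw.le) x ⟨hlt.le, hw.le⟩
      rw [← he, ← ht] at hA2
      have hPA : 0 < P.real A := by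
        refine lt_of_le_of_ne measureReal_nonneg fun h1 => ?_
        have := h.certEq_binAct_congr hG w x' hA (@MeasurableSet.empty _ G)
          (h1.symm.trans measureReal_empty.symm)
        rw [hA1, ← betValue_eq, h.betValue_empty] at this
        exact hlt.ne' this
      by_contra hne
      rcases lt_or_gt_of_ne hne with hl | hl
      · have := h.certEq_binAct_lt hG hA hl.le (le_refl t) (Or.inl ⟨hl, hPA⟩)
        rw [hA2, binAct_self, h.certEq_constAct] at this
        exact lt_irrefl _ this
      · have := h.certEq_binAct_lt hG hA hl.le (le_refl t) (Or.inl ⟨hl, hPA⟩)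
        rw [hA2, binAct_self, h.certEq_constAct] at this
        exact lt_irrefl _ this
    -- Mixing with `z` is now constant on both rays `(-∞, x']` and `[x, ∞)`. Either `z` lies in one
    -- of them, or it lies between `x'` and `x` and internality of the mixture squeezes `t` to `z`.
    -- Then mixing `z` with a larger outcome returns `z`, contradicting `lt_outcomeMix`.
    have htz : t = z := by
      rcases le_or_gt z x' with hz | hz
      · rw [← hbelow z hz, h.outcomeMix_self hG]
      rcases le_or_gt x z with hz' | hz'
      · rw [← habove z hz', h.outcomeMix_self hG]
      have h1 := (h.outcomeMix_spec hG x z).1.1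
      have h2 := (h.outcomeMix_spec hG x' z).1.2
      rw [min_eq_right hz'.le, ← ht] at h1
      rw [max_eq_right hz.le, ← he] at h2
      exact le_antisymm h2 h1
    have hup : outcomeMix G hG P pref (max x z + 1) z = t :=
      habove _ ((le_max_left _ _).trans (by linarith))
    have := h.lt_outcomeMix hG (show z < max x z + 1 by linarith [le_max_right x z])
    rw [hup, htz] at this
    exact lt_irrefl _ this
  intro x x' he
  rcases lt_trichotomy x x' with hlt | heq | hlt
  · exact absurd he.symm (hinj _ _ hlt)
  · exact heq
  · exact absurd he (hinj _ _ hlt)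

/-- A continuous injective function on the line is strictly monotone or strictly antitone; the
mixture of `z` with `z + 1` exceeds `z`, which excludes the second. -/
lemma outcomeMix_strictMono (h : IsRegularPreference G P pref)
    (hS : SubjectiveComonotonicIndependence G hG P pref) (z : ℝ) :
    StrictMono (outcomeMix G hG P pref z) := by
  have hinj := h.outcomeMix_injective hS z
  have hcomm : (fun x => outcomeMix G hG P pref x z) = outcomeMix G hG P pref z :=
    funext fun x => outcomeMix_comm x z
  have hc : Continuous (outcomeMix G hG P pref z) :=
    (h.continuous_outcomeMix hG).comp (continuous_const.prodMk continuous_id)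
  rw [hcomm] at hinj
  refine (hc.strictMono_of_inj hinj).resolve_right fun hanti => ?_
  have h1 := hanti (show z < z + 1 by linarith)
  have h2 := h.lt_outcomeMix hG (show z < z + 1 by linarith)
  rw [h.outcomeMix_self hG] at h1
  rw [outcomeMix_comm] at h2
  exact lt_asymm h1 h2

/-- Under comonotonic independence, the subjective mixture is a bisymmetric mean. -/
theorem isBisymmetricMean_outcomeMix (h : IsRegularPreference G P pref)
    (hS : SubjectiveComonotonicIndependence G hG P pref) :
    IsBisymmetricMean (outcomeMix G hG P pref) := by
  obtain ⟨R, hR⟩ := h.exists_coinFlip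
  have hf := h.isCoinMean hG hR
  set f : ℝ → ℝ → ℝ := fun x y => certEq pref (binAct x R (hG R hR.1) y) with hfdef
  set m := outcomeMix G hG P pref with hm
  have hstrict := h.outcomeMix_strictMono hS
  have hsymm : ∀ x y, m x y = m y x := outcomeMix_comm
  have hmono : ∀ x x' y y', x ≤ x' → y ≤ y' → m x y ≤ m x' y' := fun x x' y y' hx hy => by
    refine ((hstrict x).monotone hy).trans ?_
    change m x y' ≤ m x' y'
    rw [hsymm x, hsymm x']
    exact (hstrict y').monotone hx
  have hspec : ∀ x y, y ≤ x → m x y ∈ Set.Icc y x ∧ f (f x (m x y)) (f (m x y) y) = f x y :=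
    fun x y hxy => by
      have h1 := (h.outcomeMix_spec hG x y).1
      have h2 := h.outcomeMix_eq hG hR x y
      rw [max_eq_left hxy, min_eq_right hxy] at h1 h2
      exact ⟨h1, h2⟩
  -- Coin flips on the same event with the better outcome on the same side are comonotonic, so
  -- certainty equivalents commute with their mixture.
  have hcomm : ∀ x y z w, y ≤ x → w ≤ z → f (m x z) (m y w) = m (f x y) (f z w) :=
    fun x y z w hxy hzw => by
      have := h.certEq_actMix hS (comonotonic_binAct hxy hzw (hG R hR.1))
      rwa [h.actMix_binAct hG] at this
  -- Applying `hcomm` to the equations defining `m a b` and `m c d` shows that `m (m a b) (m c d)`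
  -- solves the equation defining `m (m a c) (m b d)`, whose solution is unique.
  have hbis : ∀ a b c d, b ≤ a → d ≤ c → m (m a b) (m c d) = m (m a c) (m b d) := by
    intro a b c d hab hcd
    obtain ⟨⟨hz1, hz2⟩, hz⟩ := hspec a b hab
    obtain ⟨⟨hw1, hw2⟩, hw⟩ := hspec c d hcd
    have hsr : m b d ≤ m a c := hmono _ _ _ _ hab hcd
    obtain ⟨-, hst⟩ := hspec (m a c) (m b d) hsr
    refine (hf.strictMono_comp (m a c) (m b d)).injective ?_
    rw [hst, hcomm _ _ _ _ hz2 hw2, hcomm _ _ _ _ hz1 hw1,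
      hcomm _ _ _ _ (hf.mono₂ hz2 hz1) (hf.mono₂ hw2 hw1), hz, hw, hcomm _ _ _ _ hab hcd]
  refine ⟨fun x => (h.continuous_outcomeMix hG).comp (continuous_const.prodMk continuous_id),
    hsymm, h.outcomeMix_self hG, hstrict, fun a b c d => ?_⟩
  have hbis' : ∀ a b c d, (b ≤ a ∧ d ≤ c) ∨ (a ≤ b ∧ c ≤ d) →
      m (m a b) (m c d) = m (m a c) (m b d) := by
    rintro a b c d (⟨h1, h2⟩ | ⟨h1, h2⟩)
    · exact hbis a b c d h1 h2
    · rw [hsymm a b, hsymm c d, hbis b a d c h1 h2, hsymm (m b d)]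
  -- For oppositely ordered pairs, the identity is symmetric under exchanging `b` and `c`, and
  -- symmetry of `m` allows further swaps, bringing it back to pairs ordered alike. One ordering
  -- closes into a cycle and forces all four outcomes to be equal.
  have hmain : ∀ a b c d, b ≤ a → c ≤ d → m (m a b) (m c d) = m (m a c) (m b d) := by
    intro a b c d hab hcd
    rcases le_total c a with hca | hca
    · rcases le_total d b with hdb | hdb
      · exact (hbis' a c b d (Or.inl ⟨hca, hdb⟩)).symm
      · rw [hsymm c d, hbis' a b d c (Or.inl ⟨hab, hcd⟩), hsymm b d,
          hbis' a c d b (Or.inl ⟨hca, hdb⟩), hsymm c b]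
    · rcases le_total d b with hdb | hdb
      · have e1 : b = a := le_antisymm hab (hca.trans (hcd.trans hdb))
        have e2 : c = a := le_antisymm (hcd.trans (hdb.trans hab)) hca
        have e3 : d = a := le_antisymm (hdb.trans hab) (hca.trans hcd)
        rw [e1, e2, e3]
      · exact (hbis' a c b d (Or.inr ⟨hca, hdb⟩)).symm
  rcases le_total b a with h1 | h1 <;> rcases le_total d c with h2 | h2
  · exact hbis' _ _ _ _ (Or.inl ⟨h1, h2⟩)
  · exact hmain _ _ _ _ h1 h2
  · rw [hsymm a b, hsymm c d, hmain b a d c h1 h2, hsymm (m b d)]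
  · exact hbis' _ _ _ _ (Or.inr ⟨h1, h2⟩)

end IsRegularPreference

end Mixture

/-! ### From the axioms to the representation. -/

section Sufficiency

variable {Ω : Type*} {G : MeasurableSpace Ω} [F : MeasurableSpace Ω] {hG : G ≤ F}
  {P : Measure Ω} [IsProbabilityMeasure P] {pref : Act Ω → Act Ω → Prop} {u : ℝ → ℝ}

omit [IsProbabilityMeasure P] in
lemma isAct_comp (hu : Monotone u) (X : Act Ω) : IsAct fun ω => u (X ω) := by
  obtain ⟨M, -, hM⟩ := X.2.exists_bound
  exact ⟨hu.measurable.comp X.2.1, max |u (-M)| |u M|, fun ω =>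
    abs_le_max_abs_abs (hu (abs_le.1 (hM ω)).1) (hu (abs_le.1 (hM ω)).2)⟩

/-- Solve pointwise by the intermediate value theorem; measurability follows because the set where
the solution is at most `t` is the set where `φ` is at most `u t`. -/
lemma exists_act_comp_eq (hu : StrictMono u) (huc : Continuous u) {a b : ℝ} (hab : a ≤ b)
    {φ : Ω → ℝ} (hφ : φ ∈ boundedFunctions Ω (u a) (u b)) :
    ∃ Y : Act Ω, ∀ ω, u (Y ω) = φ ω := by
  choose y hy hyφ using fun ω => intermediate_value_Icc hab huc.continuousOn (hφ.2 ω)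
  refine ⟨⟨y, measurable_of_Iic fun t => ?_, max |a| |b|, fun ω =>
    abs_le_max_abs_abs (hy ω).1 (hy ω).2⟩, hyφ⟩
  have : y ⁻¹' Set.Iic t = {ω | φ ω ≤ u t} := by
    ext ω
    simp only [Set.mem_preimage, Set.mem_Iic, Set.mem_ofPred_eq, ← hyφ ω, hu.le_iff_le]
  rw [this]
  exact measurableSet_le hφ.1 measurable_const

lemma act_eq_of_comp_eq (hu : StrictMono u) {Y Z : Act Ω} (h : ∀ ω, u (Y ω) = u (Z ω)) : Y = Z :=
  Subtype.ext (funext fun ω => hu.injective (h ω))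

lemma Comonotonic.of_comp (hu : StrictMono u) {Y Z : Act Ω}
    (h : ∀ ω ω', 0 ≤ (u (Y ω) - u (Y ω')) * (u (Z ω) - u (Z ω'))) : Comonotonic Y Z :=
  fun ω ω' => by
    by_contra hlt
    refine absurd (h ω ω') (not_le.2 ?_)
    rcases mul_neg_iff.1 (not_le.1 hlt) with ⟨h1, h2⟩ | ⟨h1, h2⟩
    · exact mul_neg_of_pos_of_neg (sub_pos.2 (hu (sub_pos.1 h1))) (sub_neg.2 (hu (sub_neg.1 h2)))
    · exact mul_neg_of_neg_of_pos (sub_neg.2 (hu (sub_neg.1 h1))) (sub_pos.2 (hu (sub_pos.1 h2)))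

lemma Comonotonic.comp (hu : Monotone u) {Y Z : Act Ω} (h : Comonotonic Y Z) (ω ω' : Ω) :
    0 ≤ (u (Y ω) - u (Y ω')) * (u (Z ω) - u (Z ω')) := by
  by_contra hlt
  refine absurd (h ω ω') (not_le.2 ?_)
  rcases mul_neg_iff.1 (not_le.1 hlt) with ⟨h1, h2⟩ | ⟨h1, h2⟩
  · exact mul_neg_of_pos_of_neg (sub_pos.2 (hu.reflect_lt (sub_pos.1 h1)))
      (sub_neg.2 (hu.reflect_lt (sub_neg.1 h2)))
  · exact mul_neg_of_neg_of_pos (sub_neg.2 (hu.reflect_lt (sub_neg.1 h1)))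
      (sub_pos.2 (hu.reflect_lt (sub_pos.1 h2)))

namespace IsRegularPreference

lemma betValue_mem_Icc (h : IsRegularPreference G P pref) {A : Set Ω} (hA : MeasurableSet A) :
    betValue pref 1 0 A ∈ Set.Icc (0 : ℝ) 1 := by
  rw [betValue_eq 1 0 hA]
  refine h.certEq_mem_Icc fun ω => ?_
  by_cases hω : ω ∈ A
  · rw [binAct_apply_mem hω]; simp
  · rw [binAct_apply_notMem hω]; simp

lemma isCapacity_utility_betValue (h : IsRegularPreference G P pref) (hu : Monotone u)
    (hu0 : u 0 = 0) (hu1 : u 1 = 1) : IsCapacity fun A => u (betValue pref 1 0 A) where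
  empty := by simp only [h.betValue_empty, hu0]
  univ := by simp only [h.betValue_univ, hu1]
  mono A B hA hB hAB := hu (h.betValue_mono zero_le_one hA hB hAB)

lemma isContinuousSetFun_utility_betValue (h : IsRegularPreference G P pref)
    (hu : Continuous u) : IsContinuousSetFun fun A => u (betValue pref 1 0 A) where
  upward A hA hmono := (hu.tendsto _).comp ((h.betValue_continuous 1 0).upward A hA hmono)
  downward A hA hanti := (hu.tendsto _).comp ((h.betValue_continuous 1 0).downward A hA hanti)

/-- The utility of the certainty equivalent is the Choquet integral of the utility with respect to
the utilities of the certainty equivalents of bets. -/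
theorem utility_certEq_eq_choquet (h : IsRegularPreference G P pref)
    (hS : SubjectiveComonotonicIndependence G hG P pref) (hu : StrictMono u) (huc : Continuous u)
    (hu0 : u 0 = 0) (hu1 : u 1 = 1) (hum : IsMidpointOn (outcomeMix G hG P pref) Set.univ u)
    (X : Act Ω) :
    u (certEq pref X) = choquet (fun A => u (betValue pref 1 0 A)) fun ω => u (X ω) := by
  classical
  have hτ := h.isCapacity_utility_betValue hu.monotone hu0 hu1
  have hτc := h.isContinuousSetFun_utility_betValue huc
  obtain ⟨M, hM0, hM⟩ := X.2.exists_bound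
  -- Taking at least 1 puts 0 and 1 in `[u (-N), u N]`, as `eq_of_indicator` requires.
  set N := max M 1 with hN
  have hN1 : 1 ≤ N := le_max_right _ _
  have hNN : -N ≤ N := by linarith
  -- The certainty equivalent in utility units, as a functional of utility profiles. The act is
  -- determined by its profile since `u` is injective; the default 0 concerns only functions that
  -- are not profiles of acts.
  let I : (Ω → ℝ) → ℝ := fun φ =>
    if hφ : ∃ Y : Act Ω, ∀ ω, u (Y ω) = φ ω then u (certEq pref hφ.choose) else 0
  have hI : ∀ Y : Act Ω, ∀ φ : Ω → ℝ, (∀ ω, u (Y ω) = φ ω) → I φ = u (certEq pref Y) :=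
    fun Y φ hY => by
      have hex : ∃ Y : Act Ω, ∀ ω, u (Y ω) = φ ω := ⟨Y, hY⟩
      have e : hex.choose = Y :=
        act_eq_of_comp_eq hu fun ω => (hex.choose_spec ω).trans (hY ω).symm
      simp only [I, dif_pos hex, e]
  have hImid : IsComonotoneMidpoint (u (-N)) (u N) I := by
    refine ⟨fun φ hφ ψ hψ hle => ?_, fun c hc => ?_, fun φ hφ ψ hψ hcom => ?_⟩
    · obtain ⟨Y, hY⟩ := exists_act_comp_eq hu huc hNN hφ
      obtain ⟨Z, hZ⟩ := exists_act_comp_eq hu huc hNN hψ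
      rw [hI Y φ hY, hI Z ψ hZ]
      refine hu.monotone (h.certEq_mono fun ω => ?_)
      rw [← hu.le_iff_le, hY, hZ]
      exact hle ω
    · obtain ⟨x, -, rfl⟩ := intermediate_value_Icc hNN huc.continuousOn hc
      rw [hI (constAct Ω x) (fun _ => u x) fun _ => rfl, h.certEq_constAct]
    · obtain ⟨Y, hY⟩ := exists_act_comp_eq hu huc hNN hφ
      obtain ⟨Z, hZ⟩ := exists_act_comp_eq hu huc hNN hψ
      simp only [← hY, ← hZ] at hcom
      rw [hI Y φ hY, hI Z ψ hZ, hI (actMix G hG P pref Y Z),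
        h.certEq_actMix hS (Comonotonic.of_comp hu hcom), hum _ trivial _ trivial]
      intro ω
      rw [h.actMix_apply hG, hum _ trivial _ trivial, hY, hZ]
  have hmem : (fun ω => u (X ω)) ∈ boundedFunctions Ω (u (-N)) (u N) :=
    ⟨hu.monotone.measurable.comp X.2.1, fun ω =>
      ⟨hu.monotone (by linarith [(abs_le.1 (hM ω)).1, le_max_left M 1]),
        hu.monotone ((abs_le.1 (hM ω)).2.trans (le_max_left _ _))⟩⟩
  have hind : ∀ A : Set Ω, MeasurableSet A → I (A.indicator 1) =
      choquet (fun A => u (betValue pref 1 0 A)) (A.indicator 1) := fun A hA => by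
    rw [hτ.choquet_indicator, betValue_eq 1 0 hA]
    refine hI _ _ fun ω => ?_
    by_cases hω : ω ∈ A
    · rw [binAct_apply_mem hω, Set.indicator_of_mem hω, hu1, Pi.one_apply]
    · rw [binAct_apply_notMem hω, Set.indicator_of_notMem hω, hu0]
  have := hImid.eq_of_indicator (hτ.isComonotoneMidpoint hτc _ _)
    (hu0 ▸ hu.monotone (by linarith)) (hu1 ▸ hu.monotone hN1) hind hmem
  rw [← this]
  exact (hI X _ fun _ => rfl).symm

lemma betValue_lt (h : IsRegularPreference G P pref) (hG : G ≤ F) {A B : Set Ω}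
    (hA : MeasurableSet[G] A) (hB : MeasurableSet[G] B) (hAB : A ⊆ B) (hlt : P.real A < P.real B) :
    betValue pref 1 0 A < betValue pref 1 0 B := by
  rw [betValue_eq 1 0 (hG A hA), betValue_eq 1 0 (hG B hB)]
  have hle : ∀ ω, binAct 1 A (hG A hA) 0 ω ≤ binAct 1 B (hG B hB) 0 ω := fun ω => by
    by_cases hω : ω ∈ A
    · rw [binAct_apply_mem hω, binAct_apply_mem (hAB hω)]
    · rw [binAct_apply_notMem hω]
      by_cases hω' : ω ∈ B
      · rw [binAct_apply_mem hω']; exact zero_le_one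
      · rw [binAct_apply_notMem hω']
  have hs := h.strictRiskMonotonicity (binAct 1 B (hG B hB) 0) (binAct 1 A (hG A hA) 0)
    (measurable_binAct hG 1 0 hB) (measurable_binAct hG 1 0 hA) ⟨?_, fun hge => ?_⟩
  · exact not_le.1 fun hle => hs.2 (h.pref_iff.2 hle)
  · rw [GeAS, Set.eq_univ_of_forall (s := {ω | _ ≤ _}) hle, measure_univ]
  · rw [GeAS] at hge
    have hBA : MeasurableSet (B \ A) := (hG B hB).diff (hG A hA)
    have hsub : {ω | binAct 1 B (hG B hB) 0 ω ≤ binAct 1 A (hG A hA) 0 ω} ⊆ (B \ A)ᶜ :=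
      fun ω hω hωB => by
        simp only [Set.mem_ofPred_eq, binAct_apply_mem hωB.1, binAct_apply_notMem hωB.2] at hω
        linarith
    have h1 : P (B \ A)ᶜ = 1 := le_antisymm prob_le_one (hge ▸ measure_mono hsub)
    rw [prob_compl_eq_one_iff hBA] at h1
    have h2 := measureReal_sdiff (μ := P) hAB (hG A hA)
    rw [measureReal_def, h1] at h2
    simp only [ENNReal.toReal_zero] at h2
    linarith

end IsRegularPreference

/-- Strictly increasing functions reflect order, so convergence of the images passes back to the
arguments. It transfers continuity from the values of bets to the matching probabilities. -/
lemma tendsto_of_strictMonoOn_comp {γ : ℝ → ℝ} (hγ : StrictMonoOn γ (Set.Icc 0 1)) {x : ℕ → ℝ}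
    {x₀ : ℝ} (hx : ∀ n, x n ∈ Set.Icc (0 : ℝ) 1) (hx₀ : x₀ ∈ Set.Icc (0 : ℝ) 1)
    (hlim : Tendsto (fun n => γ (x n)) atTop (𝓝 (γ x₀))) : Tendsto x atTop (𝓝 x₀) := by
  refine tendsto_order.2 ⟨fun c hc => ?_, fun c hc => ?_⟩
  · rcases lt_or_ge c 0 with h0 | h0
    · exact Eventually.of_forall fun n => h0.trans_le (hx n).1
    · have hcm : c ∈ Set.Icc (0 : ℝ) 1 := ⟨h0, hc.le.trans hx₀.2⟩
      filter_upwards [hlim.eventually_const_lt (hγ hcm hx₀ hc)] with n hn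
      exact (hγ.lt_iff_lt hcm (hx n)).1 hn
  · rcases lt_or_ge 1 c with h0 | h0
    · exact Eventually.of_forall fun n => (hx n).2.trans_lt h0
    · have hcm : c ∈ Set.Icc (0 : ℝ) 1 := ⟨hx₀.1.trans hc.le, h0⟩
      filter_upwards [hlim.eventually_lt_const (hγ hx₀ hcm hc)] with n hn
      exact (hγ.lt_iff_lt (hx n) hcm).1 hn

/-- Regular preferences satisfying comonotonic independence have a Choquet rank-dependent utility
representation. -/
theorem IsRegularPreference.exists_representation (h : IsRegularPreference G P pref)
    (hS : SubjectiveComonotonicIndependence G hG P pref) :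
    ∃ (u g : ℝ → ℝ) (ν : Set Ω → ℝ), IsCRDURepresentation G P pref u g ν := by
  obtain ⟨u, hu, huc, hu0, hu1, hum⟩ := (h.isBisymmetricMean_outcomeMix hS).exists_utility
  obtain ⟨γ, hγ, -, hγc⟩ := h.exists_betValue_eq hG (zero_le_one' ℝ)
  have hγ0 : γ 0 = 0 := by
    have := hγ ∅ (@MeasurableSet.empty _ G)
    rwa [h.betValue_empty, measureReal_empty, eq_comm] at this
  have hγ1 : γ 1 = 1 := by
    have := hγ Set.univ (@MeasurableSet.univ _ G)
    rwa [h.betValue_univ, probReal_univ, eq_comm] at this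
  have hγs : StrictMonoOn γ (Set.Icc 0 1) := fun p hp q hq hpq => by
    obtain ⟨B, hB, rfl⟩ := h.atomless.exists_measure_eq hq
    have hmem : p ∈ Set.Icc 0 (P.real B) := ⟨hp.1, hpq.le⟩
    rw [← h.atomless B hB] at hmem
    obtain ⟨A, hA, hAB, rfl⟩ := hmem
    rw [← hγ A hA, ← hγ B hB]
    exact h.betValue_lt hG hA hB hAB hpq
  have h0 : (0 : ℝ) ∈ Set.Icc (0 : ℝ) 1 := ⟨le_rfl, zero_le_one⟩
  have h1 : (1 : ℝ) ∈ Set.Icc (0 : ℝ) 1 := ⟨zero_le_one, le_rfl⟩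
  -- `ν A` is the probability of a risky event whose bet is worth as much as the bet on `A`.
  have hex : ∀ A : Set Ω, ∃ p, MeasurableSet A →
      p ∈ Set.Icc (0 : ℝ) 1 ∧ γ p = betValue pref 1 0 A := fun A => by
    by_cases hA : MeasurableSet A
    · obtain ⟨p, hp, hpA⟩ := intermediate_value_Icc (zero_le_one' ℝ) hγc
        (by rw [hγ0, hγ1]; exact h.betValue_mem_Icc hA)
      exact ⟨p, fun _ => ⟨hp, hpA⟩⟩
    · exact ⟨0, fun h' => absurd h' hA⟩
  choose ν hν using hex
  have hν01 : ∀ A, MeasurableSet A → ν A ∈ Set.Icc (0 : ℝ) 1 := fun A hA => (hν A hA).1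
  have hγν : ∀ A, MeasurableSet A → γ (ν A) = betValue pref 1 0 A := fun A hA => (hν A hA).2
  -- With `g = u ∘ γ`, the composite `g ∘ ν` is the capacity `u ∘ betValue` of the Choquet formula
  -- on measurable sets.
  refine ⟨u, fun p => u (γ p), ν, ⟨hu.monotone, huc, 0, 1, by rw [hu0, hu1]; exact zero_ne_one⟩,
    hu, ⟨fun p hp => ?_, fun p hp q hq hpq => hu.monotone (hγs.monotoneOn hp hq hpq),
      by simp only [hγ0, hu0], by simp only [hγ1, hu1]⟩, fun p hp q hq hpq => hu (hγs hp hq hpq),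
    huc.comp_continuousOn hγc, ⟨?_, ?_, fun A B hA hB hAB => ?_⟩, ⟨fun A hA hmono => ?_,
      fun A hA hanti => ?_⟩, fun A hA => ?_, fun X Y => ?_⟩
  · constructor
    · rw [← hu0, ← hγ0]
      exact hu.monotone (hγs.monotoneOn h0 hp hp.1)
    · rw [← hu1]
      refine hu.monotone ?_
      rw [← hγ1]
      exact hγs.monotoneOn hp h1 hp.2
  · refine hγs.injOn (hν01 _ MeasurableSet.empty) h0 ?_
    rw [hγν _ MeasurableSet.empty, h.betValue_empty, hγ0]
  · refine hγs.injOn (hν01 _ MeasurableSet.univ) h1 ?_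
    rw [hγν _ MeasurableSet.univ, h.betValue_univ, hγ1]
  · rw [← hγs.le_iff_le (hν01 A hA) (hν01 B hB), hγν A hA, hγν B hB]
    exact h.betValue_mono zero_le_one hA hB hAB
  · refine tendsto_of_strictMonoOn_comp hγs (fun n => hν01 _ (hA n))
      (hν01 _ (MeasurableSet.iUnion hA)) ?_
    simp only [fun n => hγν _ (hA n), hγν _ (MeasurableSet.iUnion hA)]
    exact (h.betValue_continuous 1 0).upward A hA hmono
  · refine tendsto_of_strictMonoOn_comp hγs (fun n => hν01 _ (hA n))
      (hν01 _ (MeasurableSet.iInter hA)) ?_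
    simp only [fun n => hγν _ (hA n), hγν _ (MeasurableSet.iInter hA)]
    exact (h.betValue_continuous 1 0).downward A hA hanti
  · refine hγs.injOn (hν01 _ (hG A hA)) ⟨measureReal_nonneg, measureReal_le_one⟩ ?_
    rw [hγν _ (hG A hA), hγ A hA]
  · have key : ∀ X : Act Ω, choquet (fun A => u (γ (ν A))) (fun ω => u (X ω)) =
        u (certEq pref X) := fun X => by
      rw [h.utility_certEq_eq_choquet hS hu huc hu0 hu1 hum X]
      refine choquet_congr fun x => ?_
      rw [hγν _ (measurableSet_tail (isAct_comp hu.monotone X).1 x)]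
    rw [key, key, h.pref_iff, ge_iff_le, hu.le_iff_le]

end Sufficiency

/-! ### From the representation to the axioms, and uniqueness. -/

section Necessity

variable {Ω : Type*} {G : MeasurableSpace Ω} [F : MeasurableSpace Ω] {hG : G ≤ F}
  {P : Measure Ω} [IsProbabilityMeasure P] {pref : Act Ω → Act Ω → Prop} {u g : ℝ → ℝ}
  {ν : Set Ω → ℝ}

namespace IsCRDURepresentation

omit [IsProbabilityMeasure P] in
lemma capacity_mem_Icc (r : IsCRDURepresentation G P pref u g ν) {A : Set Ω}
    (hA : MeasurableSet A) : ν A ∈ Set.Icc (0 : ℝ) 1 :=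
  ⟨r.capacity.nonneg hA, r.capacity.le_one hA⟩

omit [IsProbabilityMeasure P] in
lemma isCapacity_comp (r : IsCRDURepresentation G P pref u g ν) :
    IsCapacity fun A => g (ν A) where
  empty := by simp only [r.capacity.empty, r.distortion.zero]
  univ := by simp only [r.capacity.univ, r.distortion.one]
  mono A B hA hB hAB := r.distortion.mono (r.capacity_mem_Icc hA) (r.capacity_mem_Icc hB)
    (r.capacity.mono A B hA hB hAB)

omit [IsProbabilityMeasure P] in
lemma isContinuousSetFun_comp (r : IsCRDURepresentation G P pref u g ν) :
    IsContinuousSetFun fun A => g (ν A) where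
  upward A hA hmono :=
    (r.distortion_continuous _ (r.capacity_mem_Icc (MeasurableSet.iUnion hA))).tendsto.comp
      (tendsto_nhdsWithin_iff.2 ⟨r.capacity_continuous.upward A hA hmono,
        Eventually.of_forall fun n => r.capacity_mem_Icc (hA n)⟩)
  downward A hA hanti :=
    (r.distortion_continuous _ (r.capacity_mem_Icc (MeasurableSet.iInter hA))).tendsto.comp
      (tendsto_nhdsWithin_iff.2 ⟨r.capacity_continuous.downward A hA hanti,
        Eventually.of_forall fun n => r.capacity_mem_Icc (hA n)⟩)

omit [IsProbabilityMeasure P] in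
lemma isAct_utility (r : IsCRDURepresentation G P pref u g ν) (X : Act Ω) :
    IsAct fun ω => u (X ω) := isAct_comp r.utility.mono X

omit [IsProbabilityMeasure P] in
lemma measurableSet_tail_utility (r : IsCRDURepresentation G P pref u g ν) {X : Act Ω}
    (hX : Measurable[G] X) (x : ℝ) : MeasurableSet[G] {ω | x < u (X ω)} :=
  @measurableSet_tail Ω G (fun ω => u (X ω)) (r.utility.mono.measurable.comp hX) x

/-- The tail of the utility of a risky act is determined by the tails of the act. -/
lemma measure_tail_utility_le (r : IsCRDURepresentation G P pref u g ν) {X Y : Act Ω}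
    (h : GeSD P X Y) (x : ℝ) : P {ω | x < u (Y ω)} ≤ P {ω | x < u (X ω)} := by
  -- The range of `u` may be a proper interval. A level outside it lies, by continuity, below all
  -- values or above all values of `u`, so both tails are full or both are empty.
  by_cases hex : ∃ y, u y = x
  · obtain ⟨y, rfl⟩ := hex
    simp only [r.utility_strict.lt_iff_lt]
    exact h y
  · have hconst : (∀ y, x < u y) ∨ ∀ y, u y < x := by
      by_contra hcon
      push Not at hcon
      obtain ⟨⟨y, hy⟩, z, hz⟩ := hcon
      exact hex (mem_range_of_exists_le_of_exists_ge r.utility.continuous ⟨y, hy⟩ ⟨z, hz⟩)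
    rcases hconst with hc | hc
    · simp [hc]
    · have : ∀ y, ¬ x < u y := fun y => not_lt.2 (hc y).le
      simp [this]

lemma riskConformity (r : IsCRDURepresentation G P pref u g ν) (hG : G ≤ F) :
    RiskConformity G P pref := by
  have key : ∀ X Y : Act Ω, Measurable[G] X → Measurable[G] Y → GeSD P X Y → pref X Y :=
    fun X Y hX hY hXY => by
      refine (r.represents X Y).2 (r.isCapacity_comp.choquet_mono_of_tail (r.isAct_utility Y)
        (r.isAct_utility X) fun x => ?_)
      have hmX := r.measurableSet_tail_utility hX x
      have hmY := r.measurableSet_tail_utility hY x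
      refine r.distortion.mono (r.capacity_mem_Icc (hG _ hmY)) (r.capacity_mem_Icc (hG _ hmX)) ?_
      rw [r.capacity_riskConforming _ hmX, r.capacity_riskConforming _ hmY]
      exact ENNReal.toReal_mono (measure_ne_top _ _) (r.measure_tail_utility_le hXY x)
  exact fun X Y hX hY h => ⟨key X Y hX hY h.1, key Y X hY hX h.2⟩

omit [IsProbabilityMeasure P] in
lemma monotonicity (r : IsCRDURepresentation G P pref u g ν) : Monotonicity pref :=
  fun X Y hle => (r.represents X Y).2 (r.isCapacity_comp.choquet_mono (r.isAct_utility Y)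
    (r.isAct_utility X) fun ω => r.utility.mono (hle ω))

omit [IsProbabilityMeasure P] in
lemma continuityAxiom (r : IsCRDURepresentation G P pref u g ν) : ContinuityAxiom pref := by
  have key : ∀ (Y : ℕ → Act Ω) (Z : Act Ω), (∃ M : ℝ, ∀ n ω, |Y n ω| ≤ M) →
      (∀ ω, Tendsto (fun n => Y n ω) atTop (𝓝 (Z ω))) →
      Tendsto (fun n => choquet (fun A => g (ν A)) fun ω => u (Y n ω)) atTop
        (𝓝 (choquet (fun A => g (ν A)) fun ω => u (Z ω))) := by
    rintro Y Z ⟨M, hM⟩ hlim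
    refine r.isCapacity_comp.tendsto_choquet r.isContinuousSetFun_comp
      (M := max |u (-M)| |u M|) (fun n => (r.isAct_utility (Y n)).1) (r.isAct_utility Z).1
      (fun n ω => ?_) fun ω => (r.utility.continuous.tendsto _).comp (hlim ω)
    exact abs_le_max_abs_abs (r.utility.mono (abs_le.1 (hM n ω)).1)
      (r.utility.mono (abs_le.1 (hM n ω)).2)
  refine fun X => ⟨fun Y Z hY hM hlim => ?_, fun Y Z hY hM hlim => ?_⟩
  · exact (r.represents X Z).2 (le_of_tendsto' (key Y Z hM hlim) fun n =>
      (r.represents X (Y n)).1 (hY n))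
  · exact (r.represents Z X).2 (ge_of_tendsto' (key Y Z hM hlim) fun n =>
      (r.represents (Y n) X).1 (hY n))

lemma strictRiskMonotonicity (r : IsCRDURepresentation G P pref u g ν) (hG : G ≤ F)
    (hpref : IsPreference pref) : StrictRiskMonotonicity G P pref := by
  intro X Y hX hY hXY
  obtain ⟨hge, hnot⟩ := hXY
  have hae : ∀ᵐ ω ∂P, Y ω ≤ X ω := by
    rw [ae_iff]
    have hm : MeasurableSet {ω | Y ω ≤ X ω} := measurableSet_le Y.2.1 X.2.1
    exact (prob_compl_eq_zero_iff hm).2 hge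
  have hpos : P {ω | Y ω < X ω} ≠ 0 := fun h0 => by
    refine hnot ?_
    have hm : MeasurableSet {ω | Y ω < X ω} := measurableSet_lt Y.2.1 X.2.1
    have := (prob_compl_eq_one_iff hm).2 h0
    have he : {ω | Y ω < X ω}ᶜ = {ω | X ω ≤ Y ω} := by
      ext ω
      simp
    rwa [he] at this
  -- By countability of the rationals, some pair `p < q` separates `Y` from `X` on an event of
  -- positive probability. At every level in `[u p, u q]`, the tail of `u(X)` then has probability
  -- larger than that of `u(Y)` by at least the probability of this event.
  obtain ⟨p, q, hpq, hE⟩ : ∃ p q : ℚ, p < q ∧ P {ω | Y ω ≤ p ∧ (q : ℝ) < X ω} ≠ 0 := by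
    by_contra hcon
    push Not at hcon
    refine hpos (measure_mono_null (t := ⋃ p : ℚ, ⋃ q : ℚ, ⋃ _ : p < q,
      {ω | Y ω ≤ p ∧ (q : ℝ) < X ω}) (fun ω hω => ?_) ?_)
    · obtain ⟨p, hp1, hp2⟩ := exists_rat_btwn (show Y ω < X ω from hω)
      obtain ⟨q, hq1, hq2⟩ := exists_rat_btwn hp2
      simp only [Set.mem_iUnion]
      exact ⟨p, q, by exact_mod_cast hq1, hp1.le, hq2⟩
    · exact measure_iUnion_null fun p => measure_iUnion_null fun q =>
        measure_iUnion_null fun hpq => hcon p q hpq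
  set E := {ω | Y ω ≤ p ∧ (q : ℝ) < X ω} with hEdef
  have hEm : MeasurableSet E :=
    (measurableSet_le Y.2.1 measurable_const).inter (measurableSet_lt measurable_const X.2.1)
  have hEpos : 0 < P.real E := ENNReal.toReal_pos hE (measure_ne_top _ _)
  have hmX := fun x => r.measurableSet_tail_utility hX x
  have hmY := fun x => r.measurableSet_tail_utility hY x
  have hPle : ∀ x, P.real {ω | x < u (Y ω)} ≤ P.real {ω | x < u (X ω)} := fun x => by
    refine ENNReal.toReal_mono (measure_ne_top _ _) (measure_mono_ae ?_)
    filter_upwards [hae] with ω hω h1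
    exact lt_of_lt_of_le h1 (r.utility.mono hω)
  have hlt : choquet (fun A => g (ν A)) (fun ω => u (Y ω)) <
      choquet (fun A => g (ν A)) fun ω => u (X ω) := by
    refine r.isCapacity_comp.choquet_lt_of_tail (r.isAct_utility Y) (r.isAct_utility X)
      (fun x => ?_) (a := u p) (b := u q) (r.utility_strict (by exact_mod_cast hpq)) fun x hx => ?_
    · refine r.distortion.mono (r.capacity_mem_Icc (hG _ (hmY x)))
        (r.capacity_mem_Icc (hG _ (hmX x))) ?_
      rw [r.capacity_riskConforming _ (hmX x), r.capacity_riskConforming _ (hmY x)]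
      exact hPle x
    · refine r.distortion_strict (r.capacity_mem_Icc (hG _ (hmY x)))
        (r.capacity_mem_Icc (hG _ (hmX x))) ?_
      rw [r.capacity_riskConforming _ (hmX x), r.capacity_riskConforming _ (hmY x)]
      have hdisj : Disjoint {ω | x < u (Y ω)} E := Set.disjoint_left.2 fun ω h1 h2 =>
        absurd (lt_of_le_of_lt hx.1 h1) (not_lt.2 (r.utility.mono h2.1))
      have hun : P.real ({ω | x < u (Y ω)} ∪ E) ≤ P.real {ω | x < u (X ω)} := by
        refine ENNReal.toReal_mono (measure_ne_top _ _) (measure_mono_ae ?_)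
        filter_upwards [hae] with ω hω h1
        rcases h1 with h1 | h1
        · exact lt_of_lt_of_le h1 (r.utility.mono hω)
        · exact lt_of_le_of_lt hx.2 (r.utility_strict h1.2)
      rw [measureReal_union hdisj hEm] at hun
      linarith
  have hn : ¬ pref Y X := fun hYX => absurd hlt (not_lt.2 ((r.represents Y X).1 hYX))
  exact ⟨(hpref.total X Y).resolve_right hn, hn⟩

lemma isRegularPreference (r : IsCRDURepresentation G P pref u g ν) (hG : G ≤ F)
    (hP : IsAtomlessOn G P) (hpref : IsPreference pref) : IsRegularPreference G P pref :=
  ⟨hP, hpref, r.riskConformity hG, r.monotonicity, r.strictRiskMonotonicity hG hpref,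
    r.continuityAxiom⟩

omit [IsProbabilityMeasure P] in
lemma utility_certEq (r : IsCRDURepresentation G P pref u g ν) (h : IsRegularPreference G P pref)
    (X : Act Ω) : u (certEq pref X) = choquet (fun A => g (ν A)) fun ω => u (X ω) := by
  have hi := h.indiff_certEq X
  have h1 := (r.represents _ _).1 hi.1
  have h2 := (r.represents _ _).1 hi.2
  have h3 : choquet (fun A => g (ν A)) (fun ω => u (constAct Ω (certEq pref X) ω)) =
      u (certEq pref X) :=
    r.isCapacity_comp.choquet_const r.isContinuousSetFun_comp (u (certEq pref X))
  rw [h3] at h1 h2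
  exact le_antisymm h1 h2

omit [IsProbabilityMeasure P] in
lemma utility_certEq_binAct (r : IsCRDURepresentation G P pref u g ν)
    (h : IsRegularPreference G P pref) {x y : ℝ} (hxy : y ≤ x) {A : Set Ω}
    (hA : MeasurableSet A) :
    u (certEq pref (binAct x A hA y)) = (u x - u y) * g (ν A) + u y := by
  have he : (fun ω => u (binAct x A hA y ω)) =
      fun ω => (u x - u y) * A.indicator 1 ω + u y := by
    funext ω
    by_cases hω : ω ∈ A
    · rw [binAct_apply_mem hω, Set.indicator_of_mem hω, Pi.one_apply]
      ring
    · rw [binAct_apply_notMem hω, Set.indicator_of_notMem hω]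
      ring
  have hact : IsAct (A.indicator (1 : Ω → ℝ)) := ⟨measurable_one.indicator hA, 1, fun ω => by
    by_cases hω : ω ∈ A <;> simp [hω]⟩
  rw [r.utility_certEq h, he, r.isCapacity_comp.choquet_affine r.isContinuousSetFun_comp hact
    (sub_nonneg.2 (r.utility.mono hxy)), r.isCapacity_comp.choquet_indicator]

omit [IsProbabilityMeasure P] in
lemma utility_certEq_coinFlip (r : IsCRDURepresentation G P pref u g ν)
    (h : IsRegularPreference G P pref) (hG : G ≤ F) {x y : ℝ} (hxy : y ≤ x) {R : Set Ω}
    (hR : IsCoinFlip G P R) :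
    u (certEq pref (binAct x R (hG R hR.1) y)) = (u x - u y) * g (1 / 2) + u y := by
  rw [r.utility_certEq_binAct h hxy, r.capacity_riskConforming R hR.1, hR.2]

lemma certEq_binAct_le (h : IsRegularPreference G P pref) {x y z w : ℝ} (hx : x ≤ z) (hy : y ≤ w)
    {A : Set Ω} (hA : MeasurableSet A) :
    certEq pref (binAct x A hA y) ≤ certEq pref (binAct z A hA w) :=
  h.certEq_mono fun ω => by
    by_cases hω : ω ∈ A
    · simpa only [binAct_apply_mem hω] using hx
    · simpa only [binAct_apply_notMem hω] using hy

/-- With k = g(1/2), both sides have utility k²u(x) + k(1 - k)(u(z) + u(z')) + (1 - k)²u(y),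
symmetric in z and z'. -/
lemma riskSymmetry (r : IsCRDURepresentation G P pref u g ν) (h : IsRegularPreference G P pref)
    (hG : G ≤ F) : RiskSymmetry G hG P pref := by
  intro R hR x y z z' hxy hz hz'
  rw [h.indiff_iff]
  refine r.utility_strict.injective ?_
  rw [r.utility_certEq_coinFlip h hG (certEq_binAct_le h hz'.2 hz.1 _) hR,
    r.utility_certEq_coinFlip h hG (certEq_binAct_le h hz.2 hz'.1 _) hR,
    r.utility_certEq_coinFlip h hG hz.2 hR, r.utility_certEq_coinFlip h hG hz'.1 hR,
    r.utility_certEq_coinFlip h hG hz'.2 hR, r.utility_certEq_coinFlip h hG hz.1 hR]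
  ring

/-- The utility of a subjective mixture is the average of the utilities. -/
lemma isMidpointOn_outcomeMix (r : IsCRDURepresentation G P pref u g ν)
    (h : IsRegularPreference G P pref) (hG : G ≤ F) :
    IsMidpointOn (outcomeMix G hG P pref) Set.univ u := by
  intro x _ y _
  obtain ⟨R, hR⟩ := h.exists_coinFlip
  have hmem := (h.outcomeMix_spec hG x y).1
  have he := congrArg u (h.outcomeMix_eq hG hR x y)
  have hle := certEq_binAct_le h hmem.2 hmem.1 (hG R hR.1)
  rw [r.utility_certEq_coinFlip h hG hle hR, r.utility_certEq_coinFlip h hG hmem.2 hR,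
    r.utility_certEq_coinFlip h hG hmem.1 hR, r.utility_certEq_coinFlip h hG min_le_max hR] at he
  have hg0 : 0 < g (1 / 2) := by
    have := r.distortion_strict (a := 0) (b := 1 / 2) (by norm_num) (by norm_num) (by norm_num)
    rwa [r.distortion.zero] at this
  have hg1 : g (1 / 2) < 1 := by
    have := r.distortion_strict (a := 1 / 2) (b := 1) (by norm_num) (by norm_num) (by norm_num)
    rwa [r.distortion.one] at this
  have hsum : u (max x y) + u (min x y) = u x + u y := by
    rcases le_total x y with hxy | hxy
    · rw [max_eq_right hxy, min_eq_left hxy, add_comm]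
    · rw [max_eq_left hxy, min_eq_right hxy]
  rw [← hsum]
  -- With k = g(1/2), the mixture equation reduces to 2k(1 - k) times the utility of the mixture
  -- being k(1 - k)(u(x) + u(y)).
  have hne : g (1 / 2) * (1 - g (1 / 2)) ≠ 0 := (mul_pos hg0 (sub_pos.2 hg1)).ne'
  refine mul_left_cancel₀ hne ?_
  linear_combination he / 2

/-- Because `u` turns mixtures into arithmetic means, comonotonic additivity makes the utility of
the certainty equivalent of a comonotonic mixture the average of the two utilities, which depends on
each act only through its certainty equivalent. -/
lemma subjectiveComonotonicIndependence (r : IsCRDURepresentation G P pref u g ν)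
    (h : IsRegularPreference G P pref) (hG : G ≤ F) :
    SubjectiveComonotonicIndependence G hG P pref := by
  have hmid := r.isMidpointOn_outcomeMix h hG
  have key : ∀ X Z : Act Ω, Comonotonic X Z → u (certEq pref (actMix G hG P pref X Z)) =
      (u (certEq pref X) + u (certEq pref Z)) / 2 := fun X Z hXZ => by
    have he : (fun ω => u (actMix G hG P pref X Z ω)) = fun ω => (u (X ω) + u (Z ω)) / 2 := by
      funext ω
      rw [h.actMix_apply hG, hmid _ trivial _ trivial]
    obtain ⟨M, hM0, hM⟩ := (r.isAct_utility X).exists_bound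
    obtain ⟨N, hN0, hN⟩ := (r.isAct_utility Z).exists_bound
    rw [r.utility_certEq h, r.utility_certEq h, r.utility_certEq h, he]
    refine (r.isCapacity_comp.isComonotoneMidpoint r.isContinuousSetFun_comp (-max M N)
      (max M N)).midpoint _ ⟨(r.isAct_utility X).1, fun ω => ?_⟩ _
      ⟨(r.isAct_utility Z).1, fun ω => ?_⟩ (hXZ.comp r.utility.mono)
    · exact abs_le.1 ((hM ω).trans (le_max_left _ _))
    · exact abs_le.1 ((hN ω).trans (le_max_right _ _))
  intro X Y Z _ hXZ hYZ hXY
  rw [h.indiff_iff] at hXY ⊢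
  refine r.utility_strict.injective ?_
  rw [key X Z hXZ, key Y Z hYZ, hXY]

omit [IsProbabilityMeasure P] in
lemma affine (r : IsCRDURepresentation G P pref u g ν) {a : ℝ} (ha : 0 < a) (b : ℝ) :
    IsCRDURepresentation G P pref (fun x => a * u x + b) g ν := by
  have hs : StrictMono fun x => a * u x + b := fun x y hxy =>
    add_lt_add_left (mul_lt_mul_of_pos_left (r.utility_strict hxy) ha) b
  refine ⟨⟨hs.monotone, (r.utility.continuous.const_mul a).add_const b, 0, 1, ?_⟩, hs,
    r.distortion, r.distortion_strict, r.distortion_continuous, r.capacity, r.capacity_continuous,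
    r.capacity_riskConforming, fun X Y => ?_⟩
  · exact (hs one_pos).ne
  · have key := fun X : Act Ω => r.isCapacity_comp.choquet_affine r.isContinuousSetFun_comp
      (r.isAct_utility X) ha.le b
    rw [key, key, r.represents X Y, ge_iff_le, ge_iff_le, add_le_add_iff_right,
      mul_le_mul_iff_right₀ ha]

omit [IsProbabilityMeasure P] in
/-- The distorted capacity is the normalized utility of the certainty equivalents of bets. -/
lemma utility_betValue (r : IsCRDURepresentation G P pref u g ν)
    (h : IsRegularPreference G P pref) {A : Set Ω} (hA : MeasurableSet A) :
    u (certEq pref (betAct A hA)) = (u 1 - u 0) * g (ν A) + u 0 :=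
  r.utility_certEq_binAct h zero_le_one hA

/-- Both utilities turn the same mean, defined by the preference alone, into the arithmetic mean, so
they are affinely related. Normalized utilities of bets then give equality of the distorted
capacities. On risky events the capacities are the given probability, which takes all values in [0,
1], so the distortions agree; their injectivity identifies the capacities. -/
theorem unique {u' g' : ℝ → ℝ} {ν' : Set Ω → ℝ} (r : IsCRDURepresentation G P pref u g ν)
    (r' : IsCRDURepresentation G P pref u' g' ν') (h : IsRegularPreference G P pref)
    (hG : G ≤ F) :
    (∃ a b : ℝ, 0 < a ∧ ∀ x, u' x = a * u x + b) ∧ Set.EqOn g' g (Set.Icc 0 1) ∧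
      ∀ A : Set Ω, MeasurableSet A → ν' A = ν A := by
  have hmean := h.isBisymmetricMean_outcomeMix (r.subjectiveComonotonicIndependence h hG)
  obtain ⟨a, b, ha, hu'⟩ := hmean.utility_unique r.utility_strict r'.utility_strict
    (r.isMidpointOn_outcomeMix h hG) (r'.isMidpointOn_outcomeMix h hG)
  have hτ : ∀ A, MeasurableSet A → g' (ν' A) = g (ν A) := fun A hA => by
    have h1 := r.utility_betValue h hA
    have h2 := r'.utility_betValue h hA
    simp only [hu', h1] at h2
    have hne : a * (u 1 - u 0) ≠ 0 := (mul_pos ha (sub_pos.2 (r.utility_strict one_pos))).ne'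
    refine mul_left_cancel₀ hne ?_
    linear_combination -h2
  have hg : Set.EqOn g' g (Set.Icc 0 1) := fun p hp => by
    obtain ⟨A, hA, rfl⟩ := h.atomless.exists_measure_eq hp
    have := hτ A (hG A hA)
    rwa [r.capacity_riskConforming A hA, r'.capacity_riskConforming A hA] at this
  refine ⟨⟨a, b, ha, hu'⟩, hg, fun A hA => ?_⟩
  refine r.distortion_strict.injOn (r'.capacity_mem_Icc hA) (r.capacity_mem_Icc hA) ?_
  rw [← hg (r'.capacity_mem_Icc hA), hτ A hA]

lemma indiff_betAct_iff (r : IsCRDURepresentation G P pref u g ν)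
    (h : IsRegularPreference G P pref) {A B : Set Ω} (hA : MeasurableSet A)
    (hB : MeasurableSet B) : Indiff pref (betAct A hA) (betAct B hB) ↔ ν A = ν B := by
  have hne : u 1 - u 0 ≠ 0 := (sub_pos.2 (r.utility_strict one_pos)).ne'
  rw [h.indiff_iff, ← r.utility_strict.injective.eq_iff, r.utility_betValue h hA,
    r.utility_betValue h hB, add_left_inj, mul_right_inj' hne,
    r.distortion_strict.injOn.eq_iff (r.capacity_mem_Icc hA) (r.capacity_mem_Icc hB)]

/-- Bets are indifferent exactly when their events have equal `ν`, and `ν` is the given probability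
on risky events; atomlessness supplies a risky event of probability `ν A`. -/
theorem isMatchingProbability_iff (r : IsCRDURepresentation G P pref u g ν)
    (h : IsRegularPreference G P pref) (hG : G ≤ F) (m : Set Ω → ℝ) :
    IsMatchingProbability G hG P pref m ↔ ∀ A : Set Ω, MeasurableSet A → m A = ν A := by
  refine ⟨fun hm A hA => ?_, fun hm A hA => ?_⟩
  · obtain ⟨R, hR, hmR, hi⟩ := hm A hA
    rw [hmR, ← r.capacity_riskConforming R hR]
    exact ((r.indiff_betAct_iff h hA (hG R hR)).1 hi).symm
  · obtain ⟨R, hR, hPR⟩ := h.atomless.exists_measure_eq (r.capacity_mem_Icc hA)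
    refine ⟨R, hR, by rw [hm A hA, hPR], (r.indiff_betAct_iff h hA (hG R hR)).2 ?_⟩
    rw [r.capacity_riskConforming R hR, hPR]

end IsCRDURepresentation

end Necessity

end CRDU

/-! ### The characterization with uniqueness. -/

theorem theorem1 {Ω : Type*} (G : MeasurableSpace Ω) [F : MeasurableSpace Ω] (hG : G ≤ F)
    (P : MeasureTheory.Measure Ω) [MeasureTheory.IsProbabilityMeasure P]
    (hP : CRDU.IsAtomlessOn G P)
    (pref : CRDU.Act Ω → CRDU.Act Ω → Prop) (hpref : CRDU.IsPreference pref) :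
    ((CRDU.RiskConformity G P pref ∧ CRDU.Monotonicity pref ∧
        CRDU.StrictRiskMonotonicity G P pref ∧ CRDU.ContinuityAxiom pref ∧
        CRDU.RiskSymmetry G hG P pref ∧ CRDU.SubjectiveComonotonicIndependence G hG P pref) ↔
      ∃ (u g : ℝ → ℝ) (ν : Set Ω → ℝ), CRDU.IsCRDURepresentation G P pref u g ν) ∧
    (∀ (u g : ℝ → ℝ) (ν : Set Ω → ℝ), CRDU.IsCRDURepresentation G P pref u g ν →
      (∀ (u' g' : ℝ → ℝ) (ν' : Set Ω → ℝ), CRDU.IsCRDURepresentation G P pref u' g' ν' →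
        (∃ a b : ℝ, 0 < a ∧ ∀ x, u' x = a * u x + b) ∧
        Set.EqOn g' g (Set.Icc 0 1) ∧
        (∀ A : Set Ω, MeasurableSet A → ν' A = ν A)) ∧
      (∀ a b : ℝ, 0 < a → CRDU.IsCRDURepresentation G P pref (fun x => a * u x + b) g ν) ∧
      (∀ m : Set Ω → ℝ, CRDU.IsMatchingProbability G hG P pref m ↔
        ∀ A : Set Ω, MeasurableSet A → m A = ν A)) := by
  refine ⟨⟨?_, ?_⟩, fun u g ν r => ?_⟩
  · rintro ⟨hRC, hM, hSRM, hC, -, hSCI⟩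
    exact CRDU.IsRegularPreference.exists_representation ⟨hP, hpref, hRC, hM, hSRM, hC⟩ hSCI
  · rintro ⟨u, g, ν, r⟩
    have h := r.isRegularPreference hG hP hpref
    exact ⟨h.riskConformity, h.monotonicity, h.strictRiskMonotonicity, h.continuity,
      r.riskSymmetry h hG, r.subjectiveComonotonicIndependence h hG⟩
  · have h := r.isRegularPreference hG hP hpref
    exact ⟨fun u' g' ν' r' => r.unique r' h hG, fun a b ha => r.affine ha b,
      fun m => r.isMatchingProbability_iff h hG m⟩
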